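/- **Setting.** Let $V=\mathbb C^{N}$; for an operator $X$ on $V^{\otimes 2}$ let $X_i$ denote $X$ acting in the factors $i,i+1$ of $V^{\otimes n}$, and let $P$ be the flip of $V^{\otimes 2}$. An *R-matrix* is an invertible $R\in\mathrm{End}(V^{\otimes 2})$ with $R_1R_2R_1=R_2R_1R_2$. It is *skew invertible* if there is $\Psi_R\in\mathrm{End}(V^{\otimes2})$ with $\mathrm{Tr}_{(2)}R_{12}\Psi_{R\,23}=\mathrm{Tr}_{(2)}\Psi_{R\,12}R_{23}=P_{13}$, and *strict skew invertible* if moreover $D_R:=\mathrm{Tr}_{(2)}\Psi_{R\,12}$ is invertible. The R-trace $\mathrm{Tr}_R$ over a set of tensor factors is the trace weighted by $D_R$ in each of them. A pair $\{R,F\}$ of R-matrices is *compatible* if $R_1F_2F_1=F_2F_1R_2$ and $R_2F_1F_2=F_1F_2R_1$. Let $q\in\mathbb C\setminus\{0,\pm1\}$, $\mu\in\mathbb C\setminus\{0,q,-q^{-1}\}$, $j_q:=\frac{q^j-q^{-j}}{q-q^{-1}}$. An R-matrix $R$ is of *BMW type* if its minimal polynomial is $(x-q)(x+q^{-1})(x-\mu)$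 and $K:=\frac{(q-R)(q^{-1}+R)}{\mu(q-q^{-1})}$ satisfies $K_2K_1=K_2R_1^{\pm1}R_2^{\pm1}$ and $K_1K_2K_1=K_1$. Put $\sigma_i^{\pm}(x):=1+\frac{x-1}{q-q^{-1}}R_i+\frac{\mu(x-1)}{\mu\mp q^{\mp1}x}K_i$ and define the (anti)symmetrizers by $a^{(1)}=s^{(1)}=1$, $a^{(i+1)}=\frac{q^i}{(i+1)_q}a^{(i)}\sigma_i^-(q^{-2i})a^{(i)}$, $s^{(i+1)}=\frac{q^{-i}}{(i+1)_q}s^{(i)}\sigma_i^+(q^{2i})s^{(i)}$; $a^{(m)}$ is defined when $j_q\ne0$ and $\mu\neq-q^{3-2j}$ for $2\le j\le m$, and $s^{(m)}$ when $j_q\neq0$ and $\mu\ne q^{2j-3}$ for $2\le j\le m$. For $k\ge2$, $R$ is of *$Sp(2k)$ type* if it is skew invertible, of BMW type with $\mu=-q^{-1-2k}$, $j_q\neq0$ for $2\le j\le k$, $a^{(i)}\ne0$ on $V^{\otimes i}$ for $2\le i\le k$, and $a^{(k)}\sigma^-_k(q^{-2k})a^{(k)}=0$ on $V^{\otimes(k+1)}$.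 Let $\{R,F\}$ be a compatible pair with $R$ of $Sp(2k)$ type and $F$ strict skew invertible. The quantum matrix algebra $\mathcal M(R,F)$ is the unital associative $\mathbb C$-algebra generated by the entries of an $N\times N$ matrix $M$ with the relations $R_1M_{\overline1}M_{\overline2}=M_{\overline1}M_{\overline2}R_1$, where $M_{\overline1}=M_1$, $M_{\overline{i+1}}=F_iM_{\overline i}F_i^{-1}$. For $\alpha$ in the algebra generated by $R_1^{\pm1},\dots,R_{n-1}^{\pm1}$ put $ch(\alpha):=\mathrm{Tr}_{R(1,\dots,n)}(M_{\overline1}\cdots M_{\overline n}\,\alpha)$; these elements and $1$ generate the characteristic subalgebra $\mathcal C(R,F)$. Put $$g=\tfrac{\mu(q-q^{-1})}{(q-\mu)(q^{-1}+\mu)}\,ch(K_1),\quad a_i=ch(a^{(i)})\ (1\le i\le k),\quad p_0=\mathrm{Tr}_RI,\quad p_1=\mathrm{Tr}_RM,\quad p_i=ch(R_{i-1}\cdots R_2R_1)\ (i\ge2).$$ Let $\mathcal E_{2k}$ be the commutative $\mathbb C$-algebra generated by $\nu_0,\dots,\nu_{2k}$ with the relations $\nu_{k+i}\nu_{k+1-i}=\nu_0^2$,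 $1\le i\le k$; it is an integral domain. Let $n\geq 0$ be such that $i_q\neq0$ for $2\le i\le n$. **Statement.** 1. The Newton relations, for $1\le m\le n$, $$\sum_{i=0}^{m-1}(-q)^ia_ip_{m-i}=(-1)^{m-1}m_q\,a_m+(-1)^m\sum_{i=1}^{\lfloor m/2\rfloor}(\mu q^{m-2i}-q^{1-m+2i})\,a_{m-2i}\,g^i,$$ $$\sum_{i=0}^{m-1}q^{-i}s_ip_{m-i}=m_q\,s_m+\sum_{i=1}^{\lfloor m/2\rfloor}(\mu q^{2i-m}+q^{m-2i-1})\,s_{m-2i}\,g^i,$$ with $a_0=s_0=1$, determine unique elements $a_0,\dots,a_n$ and $s_0,\dots,s_n$ of $\mathcal C(R,F)$. For $1\le m\le n$ one has $a_m=ch(a^{(m)})$ whenever $a^{(m)}$ is defined and $s_m=ch(s^{(m)})$ whenever $s^{(m)}$ is defined. 2. Let $\pi_{Sp(2k)}:\mathcal C(R,F)\to\mathcal E_{2k}$ be a homomorphism of $\mathbb C$-algebras with $g\mapsto\nu_0^2$ and $a_i\mapsto e_i(\nu_0,-\nu_0,\nu_1,\dots,\nu_{2k})$ for $1\le i\le k$,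 where $e_i$ is the elementary symmetric polynomial. Then, with $h_n$ the complete symmetric polynomial, $$\pi_{Sp(2k)}(s_n)=h_n(\nu_1,\dots,\nu_{2k}),\qquad \pi_{Sp(2k)}(p_n)=q^{n-1}\sum_{i=1}^{2k}d_i\,\nu_i^n ,$$ the second equality being in the field of fractions of $\mathcal E_{2k}$, where $$d_i=\frac{\nu_i-q^{-4}\nu_{2k+1-i}}{\nu_i-\nu_{2k+1-i}}\prod_{\substack{1\le j\le 2k\\ j\ne i,\,2k+1-i}}\frac{\nu_i-q^{-2}\nu_j}{\nu_i-\nu_j}.$$ 3. The rational function $q^{n-1}\sum_{i=1}^{2k}d_i\nu_i^n$ belongs to $\mathcal E_{2k}$, i.e. it simplifies, modulo the relations between the $\nu$'s, to a polynomial in the spectral variables. -/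

import Mathlib

open scoped BigOperators

noncomputable section

namespace QuantumMatrix

/-! ### Idempotents of the Birman-Murakami-Wenzl algebra

All indices are shifted by one: `σ 0, σ 1, …` are the generators `σ_1, σ_2, …`. The formulas make
sense in every `ℂ`-algebra in which the `σ`'s have been realised. -/

section BMW

variable {B : Type*} [Ring B] [Algebra ℂ B]

/-- The `q`-number `j_q = (q^j - q^{-j}) / (q - q⁻¹)`. -/
def qnum (q : ℂ) (j : ℕ) : ℂ := (q ^ j - (q⁻¹) ^ j) / (q - q⁻¹)

/-- `κ = (q - σ)(q⁻¹ + σ) / (μ (q - q⁻¹))`. -/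
def kappa (q μ : ℂ) (s : B) : B :=
  (μ * (q - q⁻¹))⁻¹ • ((algebraMap ℂ B q - s) * (algebraMap ℂ B q⁻¹ + s))

/-- The baxterized element `σ⁻(x) = 1 + (x-1)/(q-q⁻¹) σ + μ(x-1)/(μ + q x) κ`. -/
def sigmaMinus (q μ x : ℂ) (s : B) : B :=
  1 + ((x - 1) / (q - q⁻¹)) • s + (μ * (x - 1) / (μ + q * x)) • kappa q μ s

/-- The baxterized element `σ⁺(x) = 1 + (x-1)/(q-q⁻¹) σ + μ(x-1)/(μ - q⁻¹ x) κ`. -/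
def sigmaPlus (q μ x : ℂ) (s : B) : B :=
  1 + ((x - 1) / (q - q⁻¹)) • s + (μ * (x - 1) / (μ - q⁻¹ * x)) • kappa q μ s

/-- The antisymmetrizers: `a^{(1)} = 1`,
`a^{(i+1)} = q^i / (i+1)_q · a^{(i)} σ⁻_i(q^{-2i}) a^{(i)}` (and `a^{(0)} = 1`). -/
def antisymmetrizer (q μ : ℂ) (σ : ℕ → B) : ℕ → B
  | 0 => 1
  | 1 => 1
  | i + 2 => (q ^ (i + 1) / qnum q (i + 2)) •
      (antisymmetrizer q μ σ (i + 1) * sigmaMinus q μ ((q⁻¹) ^ (2 * (i + 1))) (σ i) *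
        antisymmetrizer q μ σ (i + 1))

/-- The symmetrizers: `s^{(1)} = 1`,
`s^{(i+1)} = q^{-i} / (i+1)_q · s^{(i)} σ⁺_i(q^{2i}) s^{(i)}` (and `s^{(0)} = 1`). -/
def symmetrizer (q μ : ℂ) (σ : ℕ → B) : ℕ → B
  | 0 => 1
  | 1 => 1
  | i + 2 => ((q⁻¹) ^ (i + 1) / qnum q (i + 2)) •
      (symmetrizer q μ σ (i + 1) * sigmaPlus q μ (q ^ (2 * (i + 1))) (σ i) *
        symmetrizer q μ σ (i + 1))

end BMW

/-! ### Operators on tensor powers of `V = ℂ^N` -/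

/-- `End (V ⊗ V)`, as matrices. -/
abbrev TwoSite (N : ℕ) : Type := Matrix (Fin N × Fin N) (Fin N × Fin N) ℂ

/-- `End (V^{⊗ n}) ⊗ A`: matrices over `A` indexed by multi-indices. -/
abbrev TensorOp (N n : ℕ) (A : Type*) : Type _ := Matrix (Fin n → Fin N) (Fin n → Fin N) A

/-- The operator `X` acting in the tensor factors number `m` and `m + 1` (counted from `0`) of
`V^{⊗ n}` and as the identity in the others; by convention `0` if there are no such factors. -/
def site {N : ℕ} (n m : ℕ) (X : TwoSite N) : TensorOp N n ℂ := fun a b =>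
  if h : m + 1 < n then
    if ∀ l : Fin n, (l : ℕ) ≠ m → (l : ℕ) ≠ m + 1 → a l = b l then
      X (a ⟨m, by omega⟩, a ⟨m + 1, h⟩) (b ⟨m, by omega⟩, b ⟨m + 1, h⟩)
    else 0
  else 0

/-- The matrix `M` over `A` acting in the first tensor factor of `V^{⊗ n}`. -/
def firstSite {N : ℕ} {A : Type*} [Zero A] (n : ℕ) (M : Matrix (Fin N) (Fin N) A) :
    TensorOp N n A := fun a b =>
  if h : 0 < n then
    if ∀ l : Fin n, (l : ℕ) ≠ 0 → a l = b l then M (a ⟨0, h⟩) (b ⟨0, h⟩) else 0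
  else 0

/-- `R` is an R-matrix: invertible, with `R₁ R₂ R₁ = R₂ R₁ R₂`. -/
def IsRMatrix {N : ℕ} (R : TwoSite N) : Prop :=
  IsUnit R ∧
    site 3 0 R * site 3 1 R * site 3 0 R = site 3 1 R * site 3 0 R * site 3 1 R

/-- `Ψ` is the skew inverse of `R`: `Tr₍₂₎ R₁₂ Ψ₂₃ = Tr₍₂₎ Ψ₁₂ R₂₃ = P₁₃` with `P` the flip,
written in matrix entries. -/
def IsSkewInverse {N : ℕ} (R Ψ : TwoSite N) : Prop :=
  (∀ a₁ a₃ b₁ b₃ : Fin N,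
    ∑ c, ∑ d, R (a₁, c) (b₁, d) * Ψ (d, a₃) (c, b₃) = if a₁ = b₃ ∧ a₃ = b₁ then 1 else 0) ∧
  (∀ a₁ a₃ b₁ b₃ : Fin N,
    ∑ c, ∑ d, Ψ (a₁, c) (b₁, d) * R (d, a₃) (c, b₃) = if a₁ = b₃ ∧ a₃ = b₁ then 1 else 0)

/-- The operator `D = Tr₍₂₎ Ψ₁₂` on `V`. -/
def dMatrix {N : ℕ} (Ψ : TwoSite N) : Matrix (Fin N) (Fin N) ℂ := fun a b => ∑ c, Ψ (a, c) (b, c)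

/-- Strict skew invertibility: a skew inverse exists and the operator `D` is invertible. -/
def IsStrictSkewInvertible {N : ℕ} (R : TwoSite N) : Prop :=
  ∃ Ψ, IsSkewInverse R Ψ ∧ IsUnit (dMatrix Ψ)

/-- `{R, F}` is a compatible pair of R-matrices. -/
def IsCompatiblePair {N : ℕ} (R F : TwoSite N) : Prop :=
  IsRMatrix R ∧ IsRMatrix F ∧
    site 3 0 R * site 3 1 F * site 3 0 F = site 3 1 F * site 3 0 F * site 3 1 R ∧
    site 3 1 R * site 3 0 F * site 3 1 F = site 3 0 F * site 3 1 F * site 3 0 R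

/-- R-matrices of Birman-Murakami-Wenzl type with parameters `q ∉ {0, ±1}`, `μ ∉ {0, q, -q⁻¹}`:
the minimal polynomial is `(x - q)(x + q⁻¹)(x - μ)`, and `K` satisfies
`K₂ K₁ = K₂ R₁^{±1} R₂^{±1}` and `K₁ K₂ K₁ = K₁`. -/
def IsBMWType {N : ℕ} (q μ : ℂ) (R : TwoSite N) : Prop :=
  (q ≠ 0 ∧ q ≠ 1 ∧ q ≠ -1 ∧ μ ≠ 0 ∧ μ ≠ q ∧ μ ≠ -q⁻¹) ∧
  IsRMatrix R ∧
  minpoly ℂ R = (Polynomial.X - Polynomial.C q) * (Polynomial.X + Polynomial.C q⁻¹) *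
    (Polynomial.X - Polynomial.C μ) ∧
  site 3 1 (kappa q μ R) * site 3 0 (kappa q μ R) =
    site 3 1 (kappa q μ R) * site 3 0 R * site 3 1 R ∧
  site 3 1 (kappa q μ R) * site 3 0 (kappa q μ R) =
    site 3 1 (kappa q μ R) * site 3 0 R⁻¹ * site 3 1 R⁻¹ ∧
  site 3 0 (kappa q μ R) * site 3 1 (kappa q μ R) * site 3 0 (kappa q μ R) =
    site 3 0 (kappa q μ R)

/-- `R` has height `k ≥ 2`: the parameters satisfy `i_q ≠ 0` for `2 ≤ i ≤ k` and
`μ ≠ -q^{-2i+1}` for `1 ≤ i ≤ k`, the antisymmetrizers `ρ_R(a^{(i)}) ∈ End (V^{⊗ i})`, `2 ≤ i ≤ k`,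
are nonzero, and `ρ_R(a^{(k)} σ⁻_k(q^{-2k}) a^{(k)}) = 0` in `End (V^{⊗ (k+1)})`. -/
def HasHeight {N : ℕ} (q μ : ℂ) (R : TwoSite N) (k : ℕ) : Prop :=
  2 ≤ k ∧ (∀ i, 2 ≤ i → i ≤ k → qnum q i ≠ 0) ∧
  (∀ i : ℕ, 1 ≤ i → i ≤ k → μ ≠ -q ^ (1 - 2 * (i : ℤ))) ∧
  (∀ i, 2 ≤ i → i ≤ k → (antisymmetrizer q μ (fun m => site i m R) i).rank ≠ 0) ∧
  antisymmetrizer q μ (fun m => site (k + 1) m R) k *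
    sigmaMinus q μ ((q⁻¹) ^ (2 * k)) (site (k + 1) (k - 1) R) *
    antisymmetrizer q μ (fun m => site (k + 1) m R) k = 0

/-- The value `μ = -q^{-1-2k}`. -/
def spMu (q : ℂ) (k : ℕ) : ℂ := -q ^ (-1 - 2 * (k : ℤ))

/-- Symplectic R-matrices: skew invertible, of BMW type, of height `k`, with `μ = -q^{-1-2k}`. -/
def IsSpType {N : ℕ} (q : ℂ) (k : ℕ) (R : TwoSite N) : Prop :=
  (∃ Ψ, IsSkewInverse R Ψ) ∧ IsBMWType q (spMu q k) R ∧ HasHeight q (spMu q k) R k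

/-! ### The quantum matrix algebra -/

section Copies

variable {N : ℕ} {A : Type*} [Ring A] [Algebra ℂ A]

/-- A numerical operator regarded as an operator with coefficients in `A`. -/
def scal (A : Type*) [Ring A] [Algebra ℂ A] {n : ℕ} (X : TensorOp N n ℂ) : TensorOp N n A :=
  X.map (algebraMap ℂ A)

/-- The copies `M_{\bar 1} = M₁`, `M_{\overline{i+1}} = F_i M_{\bar i} F_i⁻¹` of a matrix `M`, as
operators on `V^{⊗ n}`; the index is shifted by one. -/
def copy (F : TwoSite N) (M : Matrix (Fin N) (Fin N) A) (n : ℕ) : ℕ → TensorOp N n A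
  | 0 => firstSite n M
  | i + 1 => scal A (site n i F) * copy F M n i * scal A (site n i F⁻¹)

/-- The product `M_{\bar 1} M_{\bar 2} ⋯ M_{\bar n}` on `V^{⊗ n}`. -/
def copyProd (F : TwoSite N) (M : Matrix (Fin N) (Fin N) A) (n : ℕ) : TensorOp N n A :=
  ((List.range n).map (copy F M n)).prod

/-- The R-trace over all the factors of `V^{⊗ n}`: the trace of `D^{⊗ n} Y`. -/
def fullTrace (D : Matrix (Fin N) (Fin N) ℂ) {n : ℕ} (Y : TensorOp N n A) : A :=
  ∑ a, ∑ b, (∏ l, D (a l) (b l)) • Y b a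

end Copies

/-- The matrix of free generators. -/
def freeMatrix (N : ℕ) : Matrix (Fin N) (Fin N) (FreeAlgebra ℂ (Fin N × Fin N)) :=
  fun a b => FreeAlgebra.ι ℂ (a, b)

/-- The entries of `R₁ M_{\bar 1} M_{\bar 2} = M_{\bar 1} M_{\bar 2} R₁`. -/
inductive QMRel {N : ℕ} (R F : TwoSite N) :
    FreeAlgebra ℂ (Fin N × Fin N) → FreeAlgebra ℂ (Fin N × Fin N) → Prop
  | entry (a b : Fin 2 → Fin N) :
      QMRel R F
        ((scal (FreeAlgebra ℂ (Fin N × Fin N)) (site 2 0 R) * copyProd F (freeMatrix N) 2 :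
          TensorOp N 2 (FreeAlgebra ℂ (Fin N × Fin N))) a b)
        ((copyProd F (freeMatrix N) 2 * scal (FreeAlgebra ℂ (Fin N × Fin N)) (site 2 0 R) :
          TensorOp N 2 (FreeAlgebra ℂ (Fin N × Fin N))) a b)

/-- The quantum matrix algebra `M(R, F)`. -/
abbrev QMAlgebra {N : ℕ} (R F : TwoSite N) : Type := RingQuot (QMRel R F)

/-- The matrix `M` of generators of `M(R, F)`. -/
def genMatrix {N : ℕ} (R F : TwoSite N) : Matrix (Fin N) (Fin N) (QMAlgebra R F) :=
  fun a b => RingQuot.mkAlgHom ℂ (QMRel R F) (FreeAlgebra.ι ℂ (a, b))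

/-- The image `ρ_R(ℂ[B_n]) ⊆ End (V^{⊗ n})` of the group algebra of the braid group: the algebra
generated by the operators `R_i` and their inverses. -/
def braidImage {N : ℕ} (R : TwoSite N) (n : ℕ) : Subalgebra ℂ (TensorOp N n ℂ) :=
  Algebra.adjoin ℂ (Set.range (fun m => site n m R) ∪ Set.range (fun m => site n m R⁻¹))

/-- The generator `ρ_R(σ_{m+1})`. -/
def braidGen {N : ℕ} (R : TwoSite N) (n m : ℕ) : braidImage R n :=
  ⟨site n m R, Algebra.subset_adjoin (Or.inl ⟨m, rfl⟩)⟩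

/-- `ch(X) = Tr_{R(1…n)} (M_{\bar 1} ⋯ M_{\bar n} X)` in `M(R, F)`; here `Ψ` is the skew inverse
of `R`, and `n = 0` gives the multiples of the unit. -/
def chValue {N : ℕ} (R F Ψ : TwoSite N) (n : ℕ) (X : TensorOp N n ℂ) : QMAlgebra R F :=
  fullTrace (dMatrix Ψ) (copyProd F (genMatrix R F) n * scal _ X)

/-- The characteristic subalgebra `C(R, F)`, generated by the elements `ch(α)`, where `α` is in
(the group algebra of) the braid group `B_n`, `n ≥ 0`. -/
def charSubalgebra {N : ℕ} (R F Ψ : TwoSite N) : Subalgebra ℂ (QMAlgebra R F) :=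
  Algebra.adjoin ℂ {x | ∃ (n : ℕ) (X : braidImage R n), x = chValue R F Ψ n X}

section Elements

variable {N : ℕ} (q μ : ℂ) (R F Ψ : TwoSite N)

/-- `ch(X)` as an element of `C(R, F)`. -/
def ch (n : ℕ) (X : braidImage R n) : charSubalgebra R F Ψ :=
  ⟨chValue R F Ψ n X, Algebra.subset_adjoin ⟨n, X, rfl⟩⟩

/-- The 2-contraction `g = μ(q-q⁻¹) / ((q-μ)(q⁻¹+μ)) · Tr_{R(1,2)} (M_{\bar 1} M_{\bar 2} K₁)`. -/
def contraction : charSubalgebra R F Ψ :=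
  (μ * (q - q⁻¹) / ((q - μ) * (q⁻¹ + μ))) • ch R F Ψ 2 (kappa q μ (braidGen R 2 0))

/-- The power sums: `p_0 = Tr_R I`, `p_1 = Tr_R M`, `p_n = ch(σ_{n-1} ⋯ σ_2 σ_1)`. -/
def powerSum : ℕ → charSubalgebra R F Ψ
  | 0 => algebraMap ℂ _ (dMatrix Ψ).trace
  | n + 1 => ch R F Ψ (n + 1) (((List.range n).reverse.map (braidGen R (n + 1))).prod)

/-- The elementary symmetric functions `a_n = ch(a^{(n)})`. -/
def elemSym (n : ℕ) : charSubalgebra R F Ψ :=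
  ch R F Ψ n (antisymmetrizer q μ (braidGen R n) n)

/-- The complete symmetric functions `s_n = ch(s^{(n)})`. -/
def complSym (n : ℕ) : charSubalgebra R F Ψ :=
  ch R F Ψ n (symmetrizer q μ (braidGen R n) n)

/-- `a_0 = 1` and, for `1 ≤ m ≤ n`,
`∑_{i<m} (-q)^i a_i p_{m-i} = (-1)^{m-1} m_q a_m
  + (-1)^m ∑_{i=1}^{⌊m/2⌋} (μ q^{m-2i} - q^{1-m+2i}) a_{m-2i} g^i`. -/
def NewtonElem (n : ℕ) (a : ℕ → charSubalgebra R F Ψ) : Prop :=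
  a 0 = 1 ∧ ∀ m, 1 ≤ m → m ≤ n →
    ∑ i ∈ Finset.range m, (-q) ^ i • (a i * powerSum R F Ψ (m - i)) =
      ((-1) ^ (m - 1) * qnum q m) • a m +
        (-1 : ℂ) ^ m • ∑ i ∈ Finset.Icc 1 (m / 2),
          (μ * q ^ ((m : ℤ) - 2 * i) - q ^ (1 - (m : ℤ) + 2 * i)) •
            (a (m - 2 * i) * contraction q μ R F Ψ ^ i)

/-- `s_0 = 1` and, for `1 ≤ m ≤ n`,
`∑_{i<m} q^{-i} s_i p_{m-i} = m_q s_m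
  + ∑_{i=1}^{⌊m/2⌋} (μ q^{2i-m} + q^{m-2i-1}) s_{m-2i} g^i`. -/
def NewtonCompl (n : ℕ) (s : ℕ → charSubalgebra R F Ψ) : Prop :=
  s 0 = 1 ∧ ∀ m, 1 ≤ m → m ≤ n →
    ∑ i ∈ Finset.range m, (q⁻¹) ^ i • (s i * powerSum R F Ψ (m - i)) =
      qnum q m • s m +
        ∑ i ∈ Finset.Icc 1 (m / 2),
          (μ * q ^ (2 * (i : ℤ) - m) + q ^ ((m : ℤ) - 2 * i - 1)) •
            (s (m - 2 * i) * contraction q μ R F Ψ ^ i)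

end Elements

/-! ### The algebra of spectral variables -/

/-- The relations `ν_i ν_{2k+1-i} = ν_0²`, `1 ≤ i ≤ 2k`. The variable `none` is `ν_0`, and
`some i` is `ν_{i+1}` for `0 ≤ i < 2k`. -/
def spectralIdeal (k : ℕ) : Ideal (MvPolynomial (Option (Fin (2 * k))) ℂ) :=
  Ideal.span (Set.range fun i : Fin (2 * k) =>
    MvPolynomial.X (some i) * MvPolynomial.X (some i.rev) - MvPolynomial.X none ^ 2)

/-- The algebra `E_{2k}` of polynomials in the spectral variables. -/
abbrev Spectral (k : ℕ) : Type := MvPolynomial (Option (Fin (2 * k))) ℂ ⧸ spectralIdeal k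

/-- `ν_0`. -/
def nuZero (k : ℕ) : Spectral k := Ideal.Quotient.mk _ (MvPolynomial.X none)

/-- `ν_1, …, ν_{2k}`, indexed from `0`. -/
def nu (k : ℕ) (i : Fin (2 * k)) : Spectral k := Ideal.Quotient.mk _ (MvPolynomial.X (some i))

/-! `E_{2k}` is an integral domain, so that it has a field of fractions: it embeds into a ring of
Laurent polynomials. -/

/-- Exponents of the monomial map `ν_i ↦ z t_i`, `ν_0 ↦ z`, where `t_{2k+1-i} = t_i⁻¹`. -/
def toricExp (k : ℕ) : (Option (Fin (2 * k)) →₀ ℕ) →+ (Option (Fin (2 * k)) → ℤ) where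
  toFun m o := match o with
    | none => (m none : ℤ) + ∑ j, (m (some j) : ℤ)
    | some j => (m (some j) : ℤ) - m (some j.rev)
  map_zero' := by funext o; cases o <;> simp
  map_add' m m' := by
    funext o
    cases o
    · simp [Finset.sum_add_distrib]; ring
    · simp; ring

/-- The reduced exponent with given image under `toricExp`. -/
def toricSection (k : ℕ) (t : Option (Fin (2 * k)) → ℤ) : Option (Fin (2 * k)) →₀ ℕ :=
  Finsupp.equivFunOnFinite.symm fun o => match o with
    | none => (t none - ∑ j, ((t (some j)).toNat : ℤ)).toNat
    | some j => (t (some j)).toNat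

/-- The corresponding homomorphism to Laurent polynomials. -/
def toricHom (k : ℕ) : MvPolynomial (Option (Fin (2 * k))) ℂ →ₐ[ℂ]
    AddMonoidAlgebra ℂ (Option (Fin (2 * k)) → ℤ) :=
  AddMonoidAlgebra.mapDomainAlgHom ℂ ℂ (toricExp k)

lemma toricExp_none (k : ℕ) (m : Option (Fin (2 * k)) →₀ ℕ) :
    toricExp k m none = (m none : ℤ) + ∑ j, (m (some j) : ℤ) := rfl

lemma toricExp_some (k : ℕ) (m : Option (Fin (2 * k)) →₀ ℕ) (j : Fin (2 * k)) :
    toricExp k m (some j) = (m (some j) : ℤ) - m (some j.rev) := rfl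

lemma toricHom_monomial (k : ℕ) (m : Option (Fin (2 * k)) →₀ ℕ) (c : ℂ) :
    toricHom k (MvPolynomial.monomial m c) = AddMonoidAlgebra.single (toricExp k m) c := by
  simp [toricHom, MvPolynomial.monomial, AddMonoidAlgebra.mapDomain_single]

lemma rev_ne (k : ℕ) (i : Fin (2 * k)) : i.rev ≠ i := by
  intro h
  have := congrArg Fin.val h
  simp only [Fin.val_rev] at this
  omega

lemma toricExp_pair (k : ℕ) (i : Fin (2 * k)) :
    toricExp k (Finsupp.single (some i) 1 + Finsupp.single (some i.rev) 1) =
      toricExp k (Finsupp.single none 2) := by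
  funext o
  cases o with
  | none =>
    simp [toricExp_none, Finsupp.single_apply, Finset.sum_add_distrib]
  | some j =>
    simp only [toricExp_some, Finsupp.add_apply, Finsupp.single_apply, Option.some.injEq,
      Fin.rev_inj]
    have h : (i = j.rev) = (i.rev = j) := by
      rw [← Fin.rev_inj, Fin.rev_rev]
    simp only [h]
    simp
    split_ifs <;> simp

lemma mk_pair (k : ℕ) (i : Fin (2 * k)) (m : Option (Fin (2 * k)) →₀ ℕ) :
    (Ideal.Quotient.mk (spectralIdeal k) (MvPolynomial.monomial
      (m + (Finsupp.single (some i) 1 + Finsupp.single (some i.rev) 1)) 1)) =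
    Ideal.Quotient.mk (spectralIdeal k) (MvPolynomial.monomial (m + Finsupp.single none 2) 1) := by
  rw [Ideal.Quotient.eq]
  have h : MvPolynomial.monomial
        (m + (Finsupp.single (some i) 1 + Finsupp.single (some i.rev) 1)) (1 : ℂ) -
      MvPolynomial.monomial (m + Finsupp.single none 2) 1 =
      MvPolynomial.monomial m 1 * (MvPolynomial.X (some i) * MvPolynomial.X (some i.rev) -
        MvPolynomial.X none ^ 2) := by
    simp [MvPolynomial.X, mul_sub, MvPolynomial.monomial_mul, MvPolynomial.monomial_pow]
  rw [h]
  exact Ideal.mul_mem_left _ _ (Ideal.subset_span ⟨i, rfl⟩)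

lemma mk_section (k : ℕ) : ∀ (d : ℕ) (m : Option (Fin (2 * k)) →₀ ℕ), ∑ j, m (some j) = d →
    Ideal.Quotient.mk (spectralIdeal k)
      (MvPolynomial.monomial (toricSection k (toricExp k m)) 1) =
    Ideal.Quotient.mk (spectralIdeal k) (MvPolynomial.monomial m 1) := by
  intro d
  induction d using Nat.strong_induction_on with
  | _ d ih =>
    intro m hm
    by_cases h : ∃ i : Fin (2 * k), 1 ≤ m (some i) ∧ 1 ≤ m (some i.rev)
    · obtain ⟨i, h1, h2⟩ := h
      have hle : Finsupp.single (some i) 1 + Finsupp.single (some i.rev) 1 ≤ m := by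
        intro o
        simp only [Finsupp.add_apply, Finsupp.single_apply]
        have := rev_ne k i
        split_ifs with e1 e2 e2
        · rw [← e1] at e2
          exact absurd (Option.some.inj e2) this
        · subst e1; simpa using h1
        · subst e2; simpa using h2
        · simp
      obtain ⟨m₀, rfl⟩ := le_iff_exists_add'.1 hle
      rw [mk_pair, map_add, toricExp_pair, ← map_add]
      refine ih _ ?_ _ rfl
      rw [← hm]
      simp [Finsupp.single_apply, Finset.sum_add_distrib]
    · push Not at h
      have : toricSection k (toricExp k m) = m := by
        have hs : ∀ j : Fin (2 * k), (toricExp k m (some j)).toNat = m (some j) := by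
          intro j
          rw [toricExp_some]
          have := h j
          omega
        ext o
        cases o with
        | none =>
          change (toricExp k m none - ∑ j, ((toricExp k m (some j)).toNat : ℤ)).toNat = m none
          simp only [hs, toricExp_none]
          simp
        | some j => exact hs j
      rw [this]

lemma ker_toricHom (k : ℕ) : RingHom.ker (toricHom k) = spectralIdeal k := by
  apply le_antisymm
  · intro f hf
    let Θ : AddMonoidAlgebra ℂ (Option (Fin (2 * k)) → ℤ) →ₗ[ℂ] Spectral k :=
      (Finsupp.lsum ℂ fun t => (LinearMap.toSpanSingleton ℂ (Spectral k)
        (Ideal.Quotient.mk (spectralIdeal k) (MvPolynomial.monomial (toricSection k t) 1)))) ∘ₗ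
        (AddMonoidAlgebra.coeffLinearEquiv ℂ).toLinearMap
    have key : Θ ∘ₗ (toricHom k).toLinearMap =
        (Ideal.Quotient.mkₐ ℂ (spectralIdeal k)).toLinearMap := by
      apply MvPolynomial.linearMap_ext
      intro m
      ext
      simp only [LinearMap.comp_apply, AlgHom.toLinearMap_apply, toricHom_monomial]
      rw [Ideal.Quotient.mkₐ_eq_mk, ← mk_section k _ m rfl]
      simp [Θ]
    have h := LinearMap.congr_fun key f
    rw [LinearMap.comp_apply, AlgHom.toLinearMap_apply, RingHom.mem_ker.1 hf, map_zero] at h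
    exact Ideal.Quotient.eq_zero_iff_mem.1 h.symm
  · refine Ideal.span_le.2 ?_
    rintro _ ⟨i, rfl⟩
    have h1 : (MvPolynomial.X (some i) * MvPolynomial.X (some i.rev) :
        MvPolynomial (Option (Fin (2 * k))) ℂ) = MvPolynomial.monomial
          (Finsupp.single (some i) 1 + Finsupp.single (some i.rev) 1) 1 := by
      simp [MvPolynomial.X, MvPolynomial.monomial_mul]
    have h2 : (MvPolynomial.X none ^ 2 : MvPolynomial (Option (Fin (2 * k))) ℂ) =
        MvPolynomial.monomial (Finsupp.single none 2) 1 := by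
      simp [MvPolynomial.X, MvPolynomial.monomial_pow]
    simp only [SetLike.mem_coe, RingHom.mem_ker]
    rw [map_sub, h1, h2, toricHom_monomial, toricHom_monomial, toricExp_pair, sub_self]

instance (k : ℕ) : IsDomain (Spectral k) := by
  have : (spectralIdeal k).IsPrime := by
    rw [← ker_toricHom]
    exact RingHom.ker_isPrime _
  exact Ideal.Quotient.isDomain _

/-- The denominators below do not vanish. -/
lemma nu_injective (k : ℕ) : Function.Injective (nu k) := by
  intro i j h
  have h' := Ideal.Quotient.eq.1 h
  rw [← ker_toricHom, RingHom.mem_ker, map_sub, sub_eq_zero] at h'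
  change toricHom k (MvPolynomial.monomial _ 1) = toricHom k (MvPolynomial.monomial _ 1) at h'
  rw [toricHom_monomial, toricHom_monomial] at h'
  have h2 := congrFun (AddMonoidAlgebra.single_left_injective one_ne_zero h') (some i)
  have := rev_ne k i
  by_contra hne
  simp [toricExp_some, Finsupp.single_apply, this.symm, Ne.symm hne] at h2
  split_ifs at h2
  simp at h2

/-- `e_i(ν_0, -ν_0, ν_1, …, ν_{2k})`. -/
def spectralElem (k i : ℕ) : Spectral k :=
  (nuZero k ::ₘ -nuZero k ::ₘ Finset.univ.val.map (nu k)).esymm i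

/-- `h_n(ν_1, …, ν_{2k})`. -/
def spectralCompl (k n : ℕ) : Spectral k :=
  MvPolynomial.aeval (nu k) (MvPolynomial.hsymm (Fin (2 * k)) ℂ n)

/-- The field of fractions of `E_{2k}`. -/
abbrev SpectralField (k : ℕ) : Type := FractionRing (Spectral k)

/-- `ν_1, …, ν_{2k}` in the field of fractions. -/
def nuF (k : ℕ) (i : Fin (2 * k)) : SpectralField k := algebraMap (Spectral k) _ (nu k i)

/-- The weights `d_i = (ν_i - q⁻⁴ ν_{2k+1-i}) / (ν_i - ν_{2k+1-i}) ·
  ∏_{j ≠ i, 2k+1-i} (ν_i - q⁻² ν_j) / (ν_i - ν_j)`. -/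
def weight (q : ℂ) (k : ℕ) (i : Fin (2 * k)) : SpectralField k :=
  (nuF k i - q ^ (-4 : ℤ) • nuF k i.rev) / (nuF k i - nuF k i.rev) *
    ∏ j ∈ Finset.univ.filter (fun j => j ≠ i ∧ j ≠ i.rev),
      (nuF k i - q ^ (-2 : ℤ) • nuF k j) / (nuF k i - nuF k j)

/-- `q^{n-1} ∑_i d_i ν_i^n`. -/
def spectralPower (q : ℂ) (k n : ℕ) : SpectralField k :=
  q ^ ((n : ℤ) - 1) • ∑ i, weight q k i * nuF k i ^ n

end QuantumMatrix

end

open QuantumMatrix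

open scoped BigOperators

noncomputable section

/-! The whole argument lives in two families of elements: the hooks `m_q ch(a^{(m)} σ_{m+i-1} ⋯
σ_m)` and the contracted hooks `m_q ch(a^{(m)} σ_{m+i} ⋯ σ_{m+1} κ_m)`. At `i = 0` a hook is `m_q
a_m`, and at `m = 1` it is a power sum, so linear recursions between hooks connect the `a_m` with
the `p_m`.

Two inputs make the recursions available. On the algebraic side, the baxterized generators satisfy
the Yang–Baxter equation (`BMWPair.yang_baxter`), hence the antisymmetrizers are idempotent
(`antisymmetrizer_mul_self`). On the tensor side, `ch` is cyclic (`chValue_comm`), because `D ⊗ D`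
commutes with `R` and braid words commute with the product of the copies of `M`; and it is
multiplicative on juxtaposed braids (`chValue_mul`), because `Tr₍₂₎ D₂ F₁₂ X₁ F₁₂⁻¹ = Tr(D X) · 1`,
which is `conjTrace_eq`. Inserting `(m+1)_q a^{(m+1)} = a^{(m)}(q^m - m_q σ_m - c_m κ_m)a^{(m)}`
into a hook and simplifying under `ch` gives the system `BMWTower.hookSystem`. Its alternating sums
telescope; the contracted hooks telescope again in steps of two, and each step releases one factor
`g`. This is the Newton relation (`HookSystem.newton`). The BMW relations are unchanged under `q ↦
-q⁻¹`, which exchanges antisymmetrizers and symmetrizers, so the second family of relations is the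
first one for `-q⁻¹`. Existence and uniqueness are immediate, since the coefficient of `a_m` is `±
m_q ≠ 0`.

For the images under `π` only `a_1, …, a_k` are given. The remaining information is the height
condition: the hooks of height `k+1` vanish (`BMWTower.hook_vanish`). Pass to generating series in
`z`, with `P = ∑_{n ≥ 1} p_n z^n`. The two recursions become a first order recursion in `m`, which
for `μ = -q^{-1-2k}` has an explicit integrating factor (`horner_closed`); the vanishing at height
`k+1` is then one linear equation for `P` (`hook_functional_equation`). It contains truncated sums
of the `a_m`. The relations `ν_j ν_{2k+1-j} = ν_0²` make the elementary symmetric functions of `ν_0,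
-ν_0, ν_1, …, ν_{2k}` antisymmetric about degree `k+1`, so that these truncated sums are full
products over the `ν_j` (`sum_pairElem`). The result is the functional equation `SpectralSeries`, in
which the coefficient of `P` is an invertible power series.

Everything else is read off from that equation. Divided by the products, it becomes the Newton
relations for `h_n(ν)` (`newton_complete`), so uniqueness gives `π(s_n) = h_n`. Over the field of
fractions it is solved by partial fractions: the relevant polynomial has degree at most `2k+2` and
`2k+3` distinct zeros (`IsSpectrum.residuePoly_eq_zero`), and the residues are the weights `d_i`;
this gives `π(p_n)` for `n ≥ 1`. Since the equation is already solvable over `E_{2k}`, the sums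
`q^{n-1} ∑ d_i ν_i^n` lie in `E_{2k}`. For `n = 0` both sides are the scalar `(q-μ)(q⁻¹+μ)/(q-q⁻¹)`:
on one side through `trace_dMatrix`, on the other through the top coefficient of the partial
fraction identity (`IsSpectrum.sum_weight`). -/

namespace QuantumMatrix

/-! ### Relations of the Birman–Murakami–Wenzl algebra on two and three strands. -/

section BMWAlgebra

variable {B : Type*} [Ring B] [Algebra ℂ B] {q μ : ℂ}

/-- The admissible parameters of the Birman-Murakami-Wenzl algebra. -/
structure BMWParam (q μ : ℂ) : Prop where
  q_ne : q ≠ 0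
  lam_ne : q - q⁻¹ ≠ 0
  mu_ne : μ ≠ 0
  sub_ne : q - μ ≠ 0
  add_ne : q⁻¹ + μ ≠ 0

/-- The loop value: `κ² = δ κ`. -/
def loopValue (q μ : ℂ) : ℂ := (q - μ) * (q⁻¹ + μ) / (μ * (q - q⁻¹))

lemma BMWParam.loopValue_ne (h : BMWParam q μ) : loopValue q μ ≠ 0 :=
  div_ne_zero (mul_ne_zero h.sub_ne h.add_ne) (mul_ne_zero h.mu_ne h.lam_ne)

lemma BMWParam.dual (h : BMWParam q μ) : BMWParam (-q⁻¹) μ where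
  q_ne := by simpa using h.q_ne
  lam_ne := by
    have := h.lam_ne
    rw [inv_neg, inv_inv]
    rwa [neg_sub_neg]
  mu_ne := h.mu_ne
  sub_ne := by
    have := h.add_ne
    intro h'
    apply this
    linear_combination -h'
  add_ne := by
    have := h.sub_ne
    rw [inv_neg, inv_inv]
    intro h'
    apply this
    linear_combination -h'

lemma loopValue_dual (q μ : ℂ) : loopValue (-q⁻¹) μ = loopValue q μ := by
  unfold loopValue
  rw [inv_neg, inv_inv]
  congr 1 <;> ring

lemma kappa_dual (q μ : ℂ) (s : B) : kappa (-q⁻¹) μ s = kappa q μ s := by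
  unfold kappa
  rw [inv_neg, inv_inv]
  simp only [map_neg, Algebra.algebraMap_eq_smul_one]
  have h : (-q⁻¹ - -q) = q - q⁻¹ := by ring
  rw [h]
  congr 1
  simp only [sub_mul, mul_add, smul_mul_assoc, mul_smul_comm, one_mul, mul_one, neg_mul, mul_neg]
  module

lemma sigmaPlus_eq (q μ x : ℂ) (s : B) : sigmaPlus q μ x s = sigmaMinus (-q⁻¹) μ x s := by
  unfold sigmaPlus sigmaMinus
  rw [inv_neg, inv_inv, kappa_dual]
  have h : (-q⁻¹ - -q) = q - q⁻¹ := by ring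
  rw [h, neg_mul, ← sub_eq_add_neg]

lemma qnum_dual (q : ℂ) (j : ℕ) : qnum (-q⁻¹) (j + 1) = (-1) ^ j * qnum q (j + 1) := by
  unfold qnum
  rw [inv_neg, inv_inv, neg_pow, neg_pow q]
  have h : (-q⁻¹ - -q) = q - q⁻¹ := by ring
  rw [h, pow_succ (-1 : ℂ)]
  ring

/-- Under `q ↦ -q⁻¹` the element `κ` is fixed, `σ⁺` becomes `σ⁻`, and the signs of the `q`-number
and of the power of `q` in the normalisation cancel. All statements about symmetrizers are obtained
from those about antisymmetrizers through this lemma. -/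
lemma symmetrizer_eq (q μ : ℂ) (σ : ℕ → B) :
    ∀ m, symmetrizer q μ σ m = antisymmetrizer (-q⁻¹) μ σ m
  | 0 => rfl
  | 1 => rfl
  | i + 2 => by
    rw [symmetrizer, antisymmetrizer, symmetrizer_eq q μ σ (i + 1), sigmaPlus_eq, qnum_dual,
      inv_neg, inv_inv]
    congr 1
    · rw [neg_pow]
      rcases neg_one_pow_eq_or ℂ (i + 1) with h | h <;> simp [h, neg_div_neg_eq]
    · rw [pow_mul, pow_mul, neg_sq]

lemma kappa_eq (q μ : ℂ) (hq : q ≠ 0) (s : B) :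
    kappa q μ s = (μ * (q - q⁻¹))⁻¹ • (1 + (q - q⁻¹) • s - s * s) := by
  unfold kappa
  simp only [Algebra.algebraMap_eq_smul_one, sub_mul, mul_add, smul_mul_assoc, mul_smul_comm,
    one_mul, mul_one]
  match_scalars <;> field_simp
  ring

/-- A single generator of the Birman-Murakami-Wenzl algebra together with its `κ`. -/
structure BMWGen (q μ : ℂ) (x k : B) : Prop where
  sq : x * x = 1 + (q - q⁻¹) • x - ((q - q⁻¹) * μ) • k
  mul_k : x * k = μ • k
  k_mul : k * x = μ • k
  k_sq : k * k = loopValue q μ • k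

/-- Up to a scalar `κ` is the quadratic factor `(q - x)(q⁻¹ + x)`, so the cubic relation says `κ(x -
μ) = 0`. Replacing `x` by `μ` in one of the two factors of `κ²` then gives the loop value. -/
lemma BMWGen.of_cubic (hp : BMWParam q μ) {x : B}
    (h : (x - algebraMap ℂ B q) * (x + algebraMap ℂ B q⁻¹) * (x - algebraMap ℂ B μ) = 0) :
    BMWGen q μ x (kappa q μ x) := by
  have hk := kappa_eq q μ hp.q_ne x
  have hne := mul_ne_zero hp.mu_ne hp.lam_ne
  have hsq : x * x = 1 + (q - q⁻¹) • x - ((q - q⁻¹) * μ) • kappa q μ x := by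
    rw [hk, smul_smul, mul_comm (q - q⁻¹), mul_inv_cancel₀ hne, one_smul]
    abel
  have hmk : kappa q μ x * x = μ • kappa q μ x := by
    have h2 : (1 + (q - q⁻¹) • x - x * x) * (x - algebraMap ℂ B μ) = 0 := by
      rw [← neg_eq_zero, ← h, ← neg_mul]
      congr 1
      simp only [Algebra.algebraMap_eq_smul_one, sub_mul, mul_add, smul_mul_assoc, mul_smul_comm,
        one_mul, mul_one]
      have := hp.q_ne
      match_scalars <;> field_simp
      ring
    rw [mul_sub, sub_eq_zero, Algebra.algebraMap_eq_smul_one, mul_smul_comm, mul_one] at h2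
    rw [hk, smul_mul_assoc, h2, smul_comm]
  have hcomm : x * kappa q μ x = kappa q μ x * x := by
    rw [hk]
    simp only [mul_smul_comm, smul_mul_assoc, mul_add, mul_sub, add_mul, sub_mul, mul_assoc,
      one_mul, mul_one]
  refine ⟨hsq, hcomm.trans hmk, hmk, ?_⟩
  have : kappa q μ x * kappa q μ x = kappa q μ x *
    ((μ * (q - q⁻¹))⁻¹ • (1 + (q - q⁻¹) • x - x * x)) := by rw [← hk]
  rw [this, mul_smul_comm, mul_sub (kappa q μ x), mul_add (kappa q μ x), mul_one, mul_smul_comm,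
    ← mul_assoc, hmk, smul_mul_assoc, hmk, loopValue]
  have hq := hp.q_ne
  have := hp.mu_ne
  have := hp.lam_ne
  match_scalars
  field_simp
  ring

variable {x y kx ky : B}

/-- The inverse of a generator. -/
def genInv (q : ℂ) (x k : B) : B := x - (q - q⁻¹) • 1 + (q - q⁻¹) • k

lemma BMWGen.mul_inv (h : BMWGen q μ x kx) : x * genInv q x kx = 1 := by
  simp only [genInv, mul_add, mul_sub, mul_smul_comm, mul_one, h.sq, h.mul_k]
  module

lemma BMWGen.inv_mul (h : BMWGen q μ x kx) : genInv q x kx * x = 1 := by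
  simp only [genInv, add_mul, sub_mul, smul_mul_assoc, one_mul, h.sq, h.k_mul]
  module

lemma BMWGen.inv_mul_k (hp : BMWParam q μ) (h : BMWGen q μ x kx) :
    genInv q x kx * kx = μ⁻¹ • kx := by
  have : genInv q x kx * (x * kx) = kx := by rw [← mul_assoc, h.inv_mul, one_mul]
  rw [h.mul_k, mul_smul_comm] at this
  rw [eq_inv_smul_iff₀ hp.mu_ne, this]

/-- Two neighbouring generators of the Birman-Murakami-Wenzl algebra. -/
structure BMWPair (q μ : ℂ) (x y kx ky : B) : Prop where
  gen_x : BMWGen q μ x kx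
  gen_y : BMWGen q μ y ky
  braid : x * y * x = y * x * y
  kxyx : kx * ky * kx = kx
  kyxy : ky * kx * ky = ky
  xykx : x * y * kx = ky * kx
  kyxy' : ky * x * y = ky * kx
  yxky : y * x * ky = kx * ky
  kxyx' : kx * y * x = kx * ky

lemma BMWPair.symm (h : BMWPair q μ x y kx ky) : BMWPair q μ y x ky kx :=
  ⟨h.gen_y, h.gen_x, h.braid.symm, h.kyxy, h.kxyx, h.yxky, h.kxyx', h.xykx, h.kyxy'⟩

lemma kappa_intertwine {u s t : B} (h : u * s = t * u) :
    u * kappa q μ s = kappa q μ t * u := by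
  unfold kappa
  rw [mul_smul_comm, smul_mul_assoc, Algebra.algebraMap_eq_smul_one,
    Algebra.algebraMap_eq_smul_one]
  congr 1
  simp only [sub_mul, mul_add, mul_sub, add_mul, smul_mul_assoc, mul_smul_comm, one_mul, mul_one,
    smul_sub, h, mul_assoc]
  simp only [← mul_assoc, h]
  rw [mul_assoc, h, ← mul_assoc]

lemma kappa_commute {u s : B} (h : Commute u s) : Commute u (kappa q μ s) :=
  kappa_intertwine h

/-- The three defining relations are not symmetric in the two strands. The symmetric list follows
because `xy` conjugates `κ_x` to `κ_y` (and `yx` conjugates back), and because multiplying `κ_y κ_x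
y x = κ_y` by `κ_x` on the left gives `κ_x y x = κ_x κ_y`. -/
lemma BMWPair.of_rel (hx : BMWGen q μ x (kappa q μ x))
    (hy : BMWGen q μ y (kappa q μ y)) (braid : x * y * x = y * x * y)
    (h1 : kappa q μ y * kappa q μ x = kappa q μ y * x * y)
    (h2 : kappa q μ y * kappa q μ x * y * x = kappa q μ y)
    (h3 : kappa q μ x * kappa q μ y * kappa q μ x = kappa q μ x) :
    BMWPair q μ x y (kappa q μ x) (kappa q μ y) := by
  have e1 : (x * y) * kappa q μ x = kappa q μ y * (x * y) :=
    kappa_intertwine (by rw [← mul_assoc, ← braid])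
  have e2 : (y * x) * kappa q μ y = kappa q μ x * (y * x) :=
    kappa_intertwine (by rw [← mul_assoc, braid])
  have e3 : kappa q μ x * y * x = kappa q μ x * kappa q μ y := by
    conv_rhs => rw [← h2, ← mul_assoc, ← mul_assoc, ← mul_assoc, h3]
  refine ⟨hx, hy, braid, h3, ?_, ?_, h1.symm, ?_, e3⟩
  · rw [mul_assoc, ← e3, ← mul_assoc, ← mul_assoc, h2]
  · rw [e1, h1, mul_assoc]
  · rw [e2, ← e3, mul_assoc]

namespace BMWPair

variable (hp : BMWParam q μ) (h : BMWPair q μ x y kx ky)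
include h

lemma x_ky_kx : x * ky * kx = genInv q y ky * kx := by
  have e : y * (x * ky * kx) = kx := by
    rw [← mul_assoc, ← mul_assoc, h.yxky, h.kxyx]
  rw [← one_mul (x * ky * kx), ← h.gen_y.inv_mul, mul_assoc, e]

lemma kx_ky_x : kx * ky * x = kx * genInv q y ky := by
  have e : (kx * ky * x) * y = kx := by
    rw [mul_assoc, mul_assoc, ← mul_assoc ky, h.kyxy', ← mul_assoc, h.kxyx]
  rw [← mul_one (kx * ky * x), ← h.gen_y.mul_inv, ← mul_assoc, e]

lemma x_ky : x * ky = genInv q y ky * kx * ky := by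
  rw [mul_assoc, ← h.yxky, ← mul_assoc, ← mul_assoc, h.gen_y.inv_mul, one_mul]

lemma ky_x : ky * x = ky * kx * genInv q y ky := by
  rw [← h.kyxy', mul_assoc _ y, h.gen_y.mul_inv, mul_one]

include hp in
lemma kx_y_kx : kx * y * kx = μ⁻¹ • kx := by
  have e : kx * y * (x * kx) = kx := by rw [← mul_assoc, h.kxyx', h.kxyx]
  rw [h.gen_x.mul_k, mul_smul_comm] at e
  rw [eq_inv_smul_iff₀ hp.mu_ne, e]

/-- Both sides come from `x κ_y x = y⁻¹ κ_x y⁻¹`. This is the one relation that chooses between two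
words of degree three, and it completes the rewriting to normal form on three strands. -/
lemma x_ky_x : x * ky * x = y * kx * y + (q - q⁻¹) • (x * ky + ky * x - y * kx - kx * y) +
    (q - q⁻¹) ^ 2 • (kx - ky) := by
  have e : x * ky * x = genInv q y ky * kx * genInv q y ky := by
    rw [h.x_ky, mul_assoc _ ky, h.ky_x]
    simp only [← mul_assoc]
    rw [mul_assoc _ kx ky, mul_assoc _ (kx * ky) kx, h.kxyx]
  have e1 : y * kx * ky = x * ky - (q - q⁻¹) • ky + (q - q⁻¹) • (kx * ky) := by
    rw [h.symm.x_ky_kx, genInv]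
    simp only [add_mul, sub_mul, smul_mul_assoc, one_mul]
  have e2 : ky * kx * y = ky * x - (q - q⁻¹) • ky + (q - q⁻¹) • (ky * kx) := by
    rw [h.symm.kx_ky_x, genInv]
    simp only [mul_add, mul_sub, mul_smul_comm, mul_one]
  rw [e, genInv]
  simp only [add_mul, sub_mul, mul_add, mul_sub, smul_mul_assoc, mul_smul_comm, one_mul, mul_one,
    e1, e2, h.kyxy]
  module

end BMWPair

/-- `1 + a x + b κ`. -/
def lin (a b : ℂ) (x k : B) : B := 1 + a • x + b • k

-- Both sides are reduced to combinations of the fifteen normal words of the three-strand algebra,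
-- and the coefficients are compared as rational functions of `q, μ, s, t`. The spectral parameters
-- are multiplicative: the middle factor carries the product of the outer ones.
include x y kx ky in
lemma BMWPair.yang_baxter (hp : BMWParam q μ) (h : BMWPair q μ x y kx ky) (s t : ℂ)
    (hs : μ + q * s ≠ 0) (ht : μ + q * t ≠ 0) (hst : μ + q * (s * t) ≠ 0) :
    lin ((s - 1) / (q - q⁻¹)) (μ * (s - 1) / (μ + q * s)) x kx *
      lin ((s * t - 1) / (q - q⁻¹)) (μ * (s * t - 1) / (μ + q * (s * t))) y ky *
      lin ((t - 1) / (q - q⁻¹)) (μ * (t - 1) / (μ + q * t)) x kx =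
    lin ((t - 1) / (q - q⁻¹)) (μ * (t - 1) / (μ + q * t)) y ky *
      lin ((s * t - 1) / (q - q⁻¹)) (μ * (s * t - 1) / (μ + q * (s * t))) x kx *
      lin ((s - 1) / (q - q⁻¹)) (μ * (s - 1) / (μ + q * s)) y ky := by
  have g1 := h.gen_x.sq
  have g2 := h.gen_x.mul_k
  have g3 := h.gen_x.k_mul
  have g4 := h.gen_x.k_sq
  have g5 := h.gen_y.sq
  have g6 := h.gen_y.mul_k
  have g7 := h.gen_y.k_mul
  have g8 := h.gen_y.k_sq
  have a1 : x * ky * kx = y * kx - (q - q⁻¹) • kx + (q - q⁻¹) • (ky * kx) := by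
    rw [h.x_ky_kx, genInv]; simp only [add_mul, sub_mul, smul_mul_assoc, one_mul]
  have a2 : kx * ky * x = kx * y - (q - q⁻¹) • kx + (q - q⁻¹) • (kx * ky) := by
    rw [h.kx_ky_x, genInv]; simp only [mul_add, mul_sub, mul_smul_comm, mul_one]
  have a3 : y * kx * ky = x * ky - (q - q⁻¹) • ky + (q - q⁻¹) • (kx * ky) := by
    rw [h.symm.x_ky_kx, genInv]; simp only [add_mul, sub_mul, smul_mul_assoc, one_mul]
  have a4 : ky * kx * y = ky * x - (q - q⁻¹) • ky + (q - q⁻¹) • (ky * kx) := by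
    rw [h.symm.kx_ky_x, genInv]; simp only [mul_add, mul_sub, mul_smul_comm, mul_one]
  have hq := hp.q_ne
  have hm := hp.mu_ne
  have hl := hp.lam_ne
  simp only [lin, add_mul, mul_add, smul_mul_assoc, mul_smul_comm, one_mul, mul_one, smul_add,
    h.braid, h.kxyx, h.kyxy, h.xykx, h.kyxy', h.yxky, h.kxyx', h.kx_y_kx hp, h.symm.kx_y_kx hp,
    a1, a2, a3, a4, g1, g2, g3, g4, g5, g6, g7, g8, h.x_ky_x, loopValue]
  have hl' : q ^ 2 - 1 ≠ 0 := by
    intro h0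
    apply hl
    rw [sub_eq_zero]
    exact eq_inv_of_mul_eq_one_left (by linear_combination h0)
  have hs' : μ + s * q ≠ 0 := by rwa [mul_comm s]
  have ht' : μ + t * q ≠ 0 := by rwa [mul_comm t]
  have h1 : μ + q * s * t ≠ 0 := by convert hst using 2; ring
  have h2 : μ + q * t * s ≠ 0 := by convert hst using 2; ring
  have h3 : μ + s * q * t ≠ 0 := by convert hst using 2; ring
  have h4 : μ + s * t * q ≠ 0 := by convert hst using 2; ring
  have h5 : μ + t * s * q ≠ 0 := by convert hst using 2; ring
  have h6 : μ + t * q * s ≠ 0 := by convert hst using 2; ring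
  match_scalars <;> (first | ring1 | (field_simp; ring1))

end BMWAlgebra

/-! ### Idempotency of the antisymmetrizers. -/

section Antisymmetrizer

variable {B : Type*} [Ring B] [Algebra ℂ B] {q μ : ℂ}

/-- The elements `r 0, …, r (n - 2)` satisfy the relations of the Birman-Murakami-Wenzl algebra
on `n` strands. -/
structure BMWRel (q μ : ℂ) (n : ℕ) (r : ℕ → B) : Prop where
  gen : ∀ i, i + 1 < n → BMWGen q μ (r i) (kappa q μ (r i))
  pair : ∀ i, i + 2 < n → BMWPair q μ (r i) (r (i + 1)) (kappa q μ (r i)) (kappa q μ (r (i + 1)))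
  comm : ∀ i j, i + 2 ≤ j → j + 1 < n → Commute (r i) (r j)

/-- The parameters for which the antisymmetrizer `a^{(m)}` is defined. -/
def AsymDef (q μ : ℂ) (m : ℕ) : Prop :=
  ∀ i, i + 2 ≤ m → qnum q (i + 2) ≠ 0 ∧ μ + q * (q⁻¹) ^ (2 * (i + 1)) ≠ 0

lemma AsymDef.mono {m m' : ℕ} (h : AsymDef q μ m) (hm : m' ≤ m) : AsymDef q μ m' :=
  fun i hi => h i (hi.trans hm)

lemma sigmaMinus_eq_lin (q μ x : ℂ) (s : B) : sigmaMinus q μ x s =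
    lin ((x - 1) / (q - q⁻¹)) (μ * (x - 1) / (μ + q * x)) s (kappa q μ s) := rfl

lemma sigmaMinus_commute {u s : B} (x : ℂ) (h : Commute u s) : Commute u (sigmaMinus q μ x s) :=
  ((Commute.one_right u).add_right (h.smul_right _)).add_right ((kappa_commute h).smul_right _)

lemma antisymmetrizer_commute {σ : ℕ → B} {u : B} : ∀ {m : ℕ},
    (∀ i, i + 1 < m → Commute u (σ i)) → Commute u (antisymmetrizer q μ σ m)
  | 0, _ => Commute.one_right u
  | 1, _ => Commute.one_right u
  | m + 2, h => by
    rw [antisymmetrizer]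
    have := antisymmetrizer_commute (m := m + 1)
      fun i hi => h i (hi.trans (Nat.lt_succ_self _))
    exact ((this.mul_right (sigmaMinus_commute _ (h m (Nat.lt_succ_self _)))).mul_right
      this).smul_right _

lemma antisymmetrizer_congr {σ σ' : ℕ → B} : ∀ {m : ℕ}, (∀ i, i + 1 < m → σ i = σ' i) →
    antisymmetrizer q μ σ m = antisymmetrizer q μ σ' m
  | 0, _ => rfl
  | 1, _ => rfl
  | m + 2, h => by
    rw [antisymmetrizer, antisymmetrizer, antisymmetrizer_congr (m := m + 1)
      fun i hi => h i (hi.trans (Nat.lt_succ_self _)), h m (Nat.lt_succ_self _)]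

section Map

variable {B' : Type*} [Ring B'] [Algebra ℂ B'] (φ : B →ₐ[ℂ] B')

lemma map_kappa (s : B) : φ (kappa q μ s) = kappa q μ (φ s) := by simp [kappa]

lemma map_sigmaMinus (x : ℂ) (s : B) : φ (sigmaMinus q μ x s) = sigmaMinus q μ x (φ s) := by
  simp [sigmaMinus, map_kappa]

lemma map_antisymmetrizer (σ : ℕ → B) : ∀ m,
    φ (antisymmetrizer q μ σ m) = antisymmetrizer q μ (fun i => φ (σ i)) m
  | 0 => map_one φ
  | 1 => map_one φ
  | m + 2 => by
    rw [antisymmetrizer, antisymmetrizer, map_smul, map_mul, map_mul, map_sigmaMinus,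
      map_antisymmetrizer σ (m + 1)]

end Map

lemma kappa_mul_eigen (hq : q ≠ 0) {s a : B} (h : s * a = (-q⁻¹) • a) : kappa q μ s * a = 0 := by
  rw [kappa_eq q μ hq, smul_mul_assoc, sub_mul, add_mul, smul_mul_assoc, mul_assoc, h,
    mul_smul_comm, h, one_mul]
  have : a + (q - q⁻¹) • (-q⁻¹) • a - (-q⁻¹) • (-q⁻¹) • a = 0 := by
    match_scalars; field_simp; ring
  rw [this, smul_zero]

lemma sigmaMinus_mul_eigen (hq : q ≠ 0) (x : ℂ) {s a : B} (h : s * a = (-q⁻¹) • a) :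
    sigmaMinus q μ x s * a = (1 - q⁻¹ * ((x - 1) / (q - q⁻¹))) • a := by
  rw [sigmaMinus, add_mul, add_mul, smul_mul_assoc, smul_mul_assoc, h, kappa_mul_eigen hq h,
    one_mul]
  module

/-- At `x = q⁻²` the baxterized generator degenerates to a multiple of the projector onto the
eigenvalue `-q⁻¹`. -/
lemma mul_sigmaMinus_inv_sq (hp : BMWParam q μ) {s : B} (h : BMWGen q μ s (kappa q μ s)) :
    s * sigmaMinus q μ ((q⁻¹) ^ 2) s = (-q⁻¹) • sigmaMinus q μ ((q⁻¹) ^ 2) s := by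
  have hq := hp.q_ne
  have hl := hp.lam_ne
  have hm := hp.add_ne
  have hl' : q ^ 2 - 1 ≠ 0 := fun h0 => hl <| sub_eq_zero.2 <|
    eq_inv_of_mul_eq_one_left (by linear_combination h0)
  have hm' : μ + q * (q⁻¹) ^ 2 ≠ 0 := by
    convert hm using 1; field_simp; ring
  have hm'' : μ * q + 1 ≠ 0 := by
    intro h0; apply hm; field_simp; linear_combination h0
  have hm3 : q * μ + 1 ≠ 0 := by rwa [mul_comm]
  simp only [sigmaMinus, mul_add, mul_smul_comm, mul_one, h.sq, h.mul_k]
  match_scalars <;> field_simp <;> ring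

lemma qnum_succ (hl : q - q⁻¹ ≠ 0) (m : ℕ) :
    qnum q (m + 1) = q ^ m + q⁻¹ * qnum q m := by
  unfold qnum
  rw [div_eq_iff hl, add_mul, mul_assoc, div_mul_cancel₀ _ hl, pow_succ, pow_succ]
  ring

lemma qnum_one (hl : q - q⁻¹ ≠ 0) : qnum q 1 = 1 := by
  unfold qnum; simp [hl]

lemma sub_one_div_lam (hq : q ≠ 0) (m : ℕ) :
    ((q⁻¹) ^ (2 * m) - 1) / (q - q⁻¹) = -((q⁻¹) ^ m * qnum q m) := by
  unfold qnum
  rw [← mul_div_assoc, ← neg_div]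
  congr 1
  rw [mul_sub, two_mul, pow_add, inv_pow, inv_mul_cancel₀ (pow_ne_zero m hq)]
  ring

/-- Idempotency needs the last generator to act by `-q⁻¹`, and proving that one level higher needs
idempotency and absorption one level lower; hence the joint induction. Writing the index as `i + 1 =
m` makes the eigenvalue claim empty for `m = 0`. -/
lemma antisymmetrizer_mul_self_aux (hp : BMWParam q μ) {n : ℕ} {r : ℕ → B} (hr : BMWRel q μ n r) :
    ∀ m, m + 1 ≤ n → AsymDef q μ (m + 1) →
      antisymmetrizer q μ r (m + 1) * antisymmetrizer q μ r (m + 1) =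
        antisymmetrizer q μ r (m + 1) ∧
      antisymmetrizer q μ r m * antisymmetrizer q μ r (m + 1) =
        antisymmetrizer q μ r (m + 1) ∧
      ∀ i, i + 1 = m → r i * antisymmetrizer q μ r (m + 1) =
        (-q⁻¹) • antisymmetrizer q μ r (m + 1) := by
  have hq := hp.q_ne
  have hl := hp.lam_ne
  intro m
  induction m with
  | zero => intro _ _; exact ⟨one_mul _, one_mul _, fun i hi => absurd hi (by omega)⟩
  | succ m ih =>
    intro hn hd
    obtain ⟨idem, hprev, eig⟩ := ih (by omega) (hd.mono (by omega))
    obtain ⟨hqn, hmu⟩ := hd m le_rfl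
    set a := antisymmetrizer q μ r (m + 1) with ha
    set X := a * sigmaMinus q μ ((q⁻¹) ^ (2 * (m + 1))) (r m) * a with hX
    have hgen := hr.gen m (by omega)
    have hrX : r m * X = (-q⁻¹) • X := by
      cases m with
      | zero =>
        have : a = 1 := rfl
        rw [hX, this, one_mul, mul_one, zero_add, mul_one, mul_sigmaMinus_inv_sq hp hgen]
      | succ m =>
        obtain ⟨hqn', hmu'⟩ := hd m (by omega)
        obtain ⟨c, hc⟩ : ∃ c : ℂ, c = q ^ (m + 1) / qnum q (m + 2) := ⟨_, rfl⟩
        set b := antisymmetrizer q μ r (m + 1) with hb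
        have hab : a = c • (b * sigmaMinus q μ ((q⁻¹) ^ (2 * (m + 1))) (r m) * b) := by
          rw [ha, antisymmetrizer, ← hb, hc]
        have hbcomm : Commute (r (m + 1)) b :=
          antisymmetrizer_commute fun i hi => (hr.comm i (m + 1) (by omega) (by omega)).symm
        obtain ⟨h2q, h2m⟩ := hd 0 (by omega)
        have hy : μ + q * (q⁻¹) ^ 2 ≠ 0 := by simpa using h2m
        have hxy : (q⁻¹) ^ (2 * (m + 1)) * (q⁻¹) ^ 2 = (q⁻¹) ^ (2 * (m + 1 + 1)) := by ring
        have hyb := (hr.pair m (by omega)).yang_baxter hp ((q⁻¹) ^ (2 * (m + 1))) ((q⁻¹) ^ 2)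
          hmu' hy (by rwa [hxy])
        rw [hxy] at hyb
        simp only [← sigmaMinus_eq_lin] at hyb
        -- `a` absorbs `σ⁻(q⁻²)` at the neighbouring site up to the nonzero scalar `q⁻¹ 2_q`.
        -- Inserting this factor produces a Yang–Baxter triple, and the equation carries `σ⁻(q⁻²)`
        -- at the new site to the far left, where it is an eigenvector of `r (m + 1)`.
        have hc' : sigmaMinus q μ ((q⁻¹) ^ 2) (r m) * a = (q⁻¹ * qnum q 2) • a := by
          rw [sigmaMinus_mul_eigen hq _ (eig m rfl)]
          have := sub_one_div_lam hq 1
          rw [mul_one] at this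
          rw [this, qnum_succ hl 1, qnum_one hl]
          congr 1
          field_simp
          ring
        have key : (q⁻¹ * qnum q 2) • X = c • (sigmaMinus q μ ((q⁻¹) ^ 2) (r (m + 1)) *
            (b * sigmaMinus q μ ((q⁻¹) ^ (2 * (m + 1 + 1))) (r m) *
              sigmaMinus q μ ((q⁻¹) ^ (2 * (m + 1))) (r (m + 1)) * a)) := by
          have e1 : X = c • (b * (sigmaMinus q μ ((q⁻¹) ^ (2 * (m + 1))) (r m) *
              sigmaMinus q μ ((q⁻¹) ^ (2 * (m + 1 + 1))) (r (m + 1)) * a)) := by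
            have hcm := (sigmaMinus_commute (q := q) (μ := μ) ((q⁻¹) ^ (2 * (m + 1 + 1)))
              hbcomm.symm).eq
            rw [hX]
            nth_rw 1 [hab]
            rw [smul_mul_assoc, smul_mul_assoc]
            congr 1
            simp only [mul_assoc]
            rw [← mul_assoc b (sigmaMinus q μ _ (r (m + 1))), hcm, mul_assoc, hprev]
          rw [e1, smul_comm]
          congr 1
          rw [← mul_smul_comm, ← mul_smul_comm, ← hc', ← mul_assoc _ _ a, hyb]
          have hcm := (sigmaMinus_commute (q := q) (μ := μ) ((q⁻¹) ^ 2) hbcomm.symm).eq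
          simp only [← mul_assoc]
          rw [hcm]
        have hne : q⁻¹ * qnum q 2 ≠ 0 := mul_ne_zero (inv_ne_zero hq) h2q
        apply smul_right_injective B hne
        change (q⁻¹ * qnum q 2) • (r (m + 1) * X) = (q⁻¹ * qnum q 2) • (-q⁻¹) • X
        rw [← mul_smul_comm, smul_comm _ (-q⁻¹), key, mul_smul_comm, ← mul_assoc,
          mul_sigmaMinus_inv_sq hp hgen, smul_mul_assoc, smul_comm]
    have h1 : a * X = X := by rw [hX, ← mul_assoc, ← mul_assoc, idem]
    -- Since `r m` acts on `X` by `-q⁻¹`, the middle factor acts by a scalar, which is exactly what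
    -- the normalisation `q^{m+1}/(m+2)_q` inverts.
    have hX2 : X * X = ((q⁻¹) ^ (m + 1) * qnum q (m + 2)) • X := by
      have h2 : X * X = a * (sigmaMinus q μ ((q⁻¹) ^ (2 * (m + 1))) (r m) * (a * X)) := by
        rw [hX]; simp only [mul_assoc]
      rw [h2, h1, sigmaMinus_mul_eigen hq _ hrX, mul_smul_comm, h1, sub_one_div_lam hq,
        qnum_succ hl (m + 1)]
      congr 1
      have : (q⁻¹) ^ (m + 1) * q ^ (m + 1) = 1 := by
        rw [← mul_pow, inv_mul_cancel₀ hq, one_pow]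
      rw [mul_add, this]
      ring
    have hdef : antisymmetrizer q μ r (m + 1 + 1) = (q ^ (m + 1) / qnum q (m + 2)) • X := rfl
    rw [hdef]
    refine ⟨?_, by rw [mul_smul_comm, h1], ?_⟩
    · rw [smul_mul_smul_comm, hX2, smul_smul]
      congr 1
      have : (q⁻¹) ^ (m + 1) * q ^ (m + 1) = 1 := by
        rw [← mul_pow, inv_mul_cancel₀ hq, one_pow]
      rw [div_mul_div_comm, div_mul_eq_mul_div, div_eq_div_iff (mul_ne_zero hqn hqn) hqn]
      linear_combination q ^ (m + 1) * qnum q (m + 2) ^ 2 * this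
    · intro i hi
      obtain rfl : i = m := by omega
      rw [mul_smul_comm, hrX, smul_comm]

lemma antisymmetrizer_mul_self (hp : BMWParam q μ) {n : ℕ} {r : ℕ → B} (hr : BMWRel q μ n r)
    {m : ℕ} (hm : m + 1 ≤ n) (hd : AsymDef q μ (m + 1)) :
    antisymmetrizer q μ r (m + 1) * antisymmetrizer q μ r (m + 1) =
      antisymmetrizer q μ r (m + 1) :=
  (antisymmetrizer_mul_self_aux hp hr m hm hd).1

end Antisymmetrizer

/-! ### Descending words, and the braid that carries a pair of strands past others. -/

section Words

variable {B : Type*} [Ring B]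

/-- The descending word `r (lo + len - 1) ⋯ r (lo + 1) r lo`. -/
def desc (r : ℕ → B) (lo : ℕ) : ℕ → B
  | 0 => 1
  | len + 1 => r (lo + len) * desc r lo len

lemma desc_succ' (r : ℕ → B) (lo : ℕ) : ∀ len, desc r lo (len + 1) = desc r (lo + 1) len * r lo
  | 0 => by simp [desc]
  | len + 1 => by
    rw [desc, desc_succ' r lo len, ← mul_assoc]
    congr 1
    rw [desc, show lo + 1 + len = lo + (len + 1) by omega]

lemma desc_commute {r : ℕ → B} {u : B} {lo : ℕ} : ∀ {len : ℕ},
    (∀ j, lo ≤ j → j < lo + len → Commute u (r j)) → Commute u (desc r lo len)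
  | 0, _ => Commute.one_right u
  | len + 1, h => (h _ (by omega) (by omega)).mul_right
      (desc_commute fun j h1 h2 => h j h1 (by omega))

lemma map_desc {B' : Type*} [Ring B'] (φ : B →+* B') {r : ℕ → B} {r' : ℕ → B'}
    {lo lo' : ℕ} : ∀ {len : ℕ}, (∀ j, j < len → φ (r (lo + j)) = r' (lo' + j)) →
    φ (desc r lo len) = desc r' lo' len
  | 0, _ => map_one φ
  | len + 1, h => by
    rw [desc, desc, map_mul, h len (by omega), map_desc φ fun j hj => h j (by omega)]

/-- The word moving `κ j` to `κ (j + i + 1)`. -/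
def mover (r : ℕ → B) (j : ℕ) : ℕ → B
  | 0 => r j * r (j + 1)
  | i + 1 => r (j + i + 1) * r (j + i + 2) * mover r j i

lemma mover_succ' (r : ℕ → B) (j : ℕ) : ∀ i,
    mover r j (i + 1) = mover r (j + 1) i * (r j * r (j + 1))
  | 0 => by simp [mover]
  | i + 1 => by
    rw [mover, mover_succ' r j i, ← mul_assoc]
    congr 1
    rw [mover, show j + 1 + i + 1 = j + (i + 1) + 1 by omega,
      show j + 1 + i + 2 = j + (i + 1) + 2 by omega]

lemma mover_commute {r : ℕ → B} {u : B} {j : ℕ} : ∀ {i : ℕ},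
    (∀ l, j ≤ l → l ≤ j + i + 1 → Commute u (r l)) → Commute u (mover r j i)
  | 0, h => (h _ (by omega) (by omega)).mul_right (h _ (by omega) (by omega))
  | i + 1, h => ((h _ (by omega) (by omega)).mul_right (h _ (by omega) (by omega))).mul_right
      (mover_commute fun l h1 h2 => h l h1 (by omega))

variable [Algebra ℂ B] {q μ : ℂ} {n : ℕ} {r : ℕ → B}

lemma BMWRel.isUnit (hr : BMWRel q μ n r) {i : ℕ} (hi : i + 1 < n) : IsUnit (r i) :=
  ⟨⟨_, _, (hr.gen i hi).mul_inv, (hr.gen i hi).inv_mul⟩, rfl⟩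

lemma BMWRel.isUnit_mover (hr : BMWRel q μ n r) (j : ℕ) : ∀ i, j + i + 2 < n →
    IsUnit (mover r j i)
  | 0, h => (hr.isUnit (by omega)).mul (hr.isUnit (by omega))
  | i + 1, h => ((hr.isUnit (by omega)).mul (hr.isUnit (by omega))).mul
      (hr.isUnit_mover j i (by omega))

lemma BMWRel.braid_kappa (hr : BMWRel q μ n r) {j : ℕ} (hj : j + 2 < n) :
    r j * r (j + 1) * kappa q μ (r j) = kappa q μ (r (j + 1)) * (r j * r (j + 1)) :=
  kappa_intertwine (by rw [(hr.pair j hj).braid, mul_assoc])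

lemma BMWRel.mover_kappa (hr : BMWRel q μ n r) (j : ℕ) : ∀ i, j + i + 2 < n →
    mover r j i * kappa q μ (r j) = kappa q μ (r (j + i + 1)) * mover r j i
  | 0, h => hr.braid_kappa (by omega)
  | i + 1, h => by
    rw [mover, mul_assoc, hr.mover_kappa j i (by omega), ← mul_assoc,
      hr.braid_kappa (by omega), mul_assoc]
    rfl

/-- The mover is the braid that takes the two strands `j, j+1` past the next `i+1` strands. Those
strands move down by two places, and the word written on them moves with them. -/
lemma BMWRel.mover_desc (hr : BMWRel q μ n r) (j : ℕ) : ∀ i, j + i + 2 < n →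
    mover r j i * desc r (j + 2) i = desc r j i * mover r j i
  | 0, _ => by simp [desc]
  | i + 1, h => by
    have hb1 := (hr.pair (j + i) (by omega)).braid
    have hb2 := (hr.pair (j + i + 1) (by omega)).braid
    have hc := (hr.comm (j + i) (j + i + 2) (by omega) (by omega)).eq
    have key : r (j + i + 1) * r (j + i + 2) * mover r j i * r (j + 2 + i) =
        r (j + i) * (r (j + i + 1) * r (j + i + 2) * mover r j i) := by
      -- Only the two leading letters of the mover interact with `r (j + i + 2)`, so the claim is a
      -- computation with two braid relations.
      have e0 : ∃ v, mover r j i = r (j + i) * r (j + i + 1) * v ∧ Commute (r (j + i + 2)) v := by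
        cases i with
        | zero => exact ⟨1, by simp [mover], Commute.one_right _⟩
        | succ i =>
          exact ⟨mover r j i, by rw [mover]; rfl, mover_commute fun l h1 h2 =>
            (hr.comm l (j + (i + 1) + 2) (by omega) (by omega)).symm⟩
      obtain ⟨v, hv, hvc⟩ := e0
      rw [hv, show j + 2 + i = j + i + 2 by omega]
      set a := r (j + i)
      set b := r (j + i + 1)
      set c := r (j + i + 2)
      have hb2' : b * c * b = c * b * c := hb2
      calc b * c * (a * b * v) * c = b * (c * a) * b * (v * c) := by noncomm_ring
        _ = b * (a * c) * b * (c * v) := by rw [hc, hvc.eq]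
        _ = b * a * (c * b * c) * v := by noncomm_ring
        _ = (b * a * b) * c * b * v := by rw [← hb2']; noncomm_ring
        _ = a * b * (a * c) * b * v := by rw [← hb1]; noncomm_ring
        _ = a * b * (c * a) * b * v := by rw [hc]
        _ = a * (b * c * (a * b * v)) := by noncomm_ring
    have hcm : Commute (r (j + i + 1) * r (j + i + 2)) (desc r j i) :=
      desc_commute fun l h1 h2 =>
        ((hr.comm l (j + i + 1) (by omega) (by omega)).symm).mul_left
          ((hr.comm l (j + i + 2) (by omega) (by omega)).symm)
    rw [desc, desc, mover, ← mul_assoc, key, mul_assoc, mul_assoc _ (mover r j i),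
      hr.mover_desc j i (by omega), ← mul_assoc _ (desc r j i), hcm.eq]
    simp only [mul_assoc]

end Words

/-! ### Sandwiches between two copies of `κ` on four strands. -/

section Triple

variable {B : Type*} [Ring B] [Algebra ℂ B] {q μ : ℂ} {x y z kx ky kz : B}

/-- Both sides are `κ_y κ_x y⁻¹ κ_z κ_y`: an outer generator next to `κ_y` can be traded for `y⁻¹`
and a `κ` on either side. -/
lemma BMWPair.k_mul_k_mul_mul_k (hxy : BMWPair q μ x y kx ky) (hyz : BMWPair q μ y z ky kz) :
    ky * kx * z * ky = ky * x * kz * ky := by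
  rw [mul_assoc _ z ky, hyz.symm.x_ky, hxy.ky_x]
  simp only [← mul_assoc]

/-- The same trade on both sides gives `κ_y κ_x y⁻² κ_z κ_y`, and `y⁻² = 1 - (q-q⁻¹) y⁻¹ + (q-q⁻¹)
μ⁻¹ κ_y`. -/
lemma BMWPair.k_mul_mul_mul_k (hp : BMWParam q μ) (hxy : BMWPair q μ x y kx ky)
    (hyz : BMWPair q μ y z ky kz) :
    ky * x * z * ky = ky * kx * kz * ky - (q - q⁻¹) • (ky * x * kz * ky) +
      ((q - q⁻¹) * μ⁻¹) • ky := by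
  have hinv2 : genInv q y ky * genInv q y ky = 1 - (q - q⁻¹) • genInv q y ky +
      ((q - q⁻¹) * μ⁻¹) • ky := by
    nth_rw 2 [genInv]
    rw [mul_add, mul_sub, hxy.gen_y.inv_mul, mul_smul_comm, mul_smul_comm, mul_one,
      hxy.gen_y.inv_mul_k hp, smul_smul]
  rw [mul_assoc _ z ky, hyz.symm.x_ky, hxy.ky_x]
  have e1 : ky * kx * genInv q y ky * (genInv q y ky * kz * ky) =
      ky * kx * (genInv q y ky * genInv q y ky) * kz * ky := by simp only [mul_assoc]
  rw [e1, hinv2]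
  simp only [mul_add, mul_sub, add_mul, sub_mul, mul_smul_comm, smul_mul_assoc, mul_one]
  rw [hxy.kyxy, hyz.kxyx]

lemma BMWPair.mul_mul_contract
    (hyz : BMWPair q μ y z ky kz) {t : B} (ht : Commute t kz) :
    y * z * (ky * t * kz * ky) = t * kz * (y * z) := by
  have e1 : y * z * (ky * t * kz * ky) = (y * z * ky) * (t * kz) * ky := by
    simp only [mul_assoc]
  rw [e1, hyz.xykx, ht.eq]
  have e2 : kz * ky * (kz * t) * ky = (kz * ky * kz) * t * ky := by simp only [mul_assoc]
  rw [e2, hyz.kyxy, ← ht.eq, mul_assoc, ← hyz.kyxy']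
  simp only [mul_assoc]

end Triple

/-! ### Hooks and contracted hooks in a tower with multiplicative traces. -/

/-- A tower of quotients of the Birman-Murakami-Wenzl algebras with a multiplicative system of
traces `ch`. -/
structure BMWTower (q μ : ℂ) (B : ℕ → Type) [∀ L, Ring (B L)] [∀ L, Algebra ℂ (B L)]
    (C : Type) [Ring C] [Algebra ℂ C] where
  r : ∀ L, ℕ → B L
  rel : ∀ L, BMWRel q μ L (r L)
  ch : ∀ L, B L →ₗ[ℂ] C
  ch_comm : ∀ L x y, ch L (x * y) = ch L (y * x)
  incl : ∀ {m L : ℕ}, m ≤ L → B m →ₐ[ℂ] B L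
  incl_r : ∀ {m L : ℕ} (h : m ≤ L) (i : ℕ), i + 1 < m → incl h (r m i) = r L i
  shift : ∀ {n L : ℕ} (s : ℕ), s + n ≤ L → B n →ₐ[ℂ] B L
  shift_r : ∀ {n L : ℕ} (s : ℕ) (h : s + n ≤ L) (i : ℕ), i + 1 < n →
    shift s h (r n i) = r L (s + i)
  ch_mul : ∀ {m n L : ℕ} (h : m + n = L) (x : B m) (y : B n),
    ch L (incl (by omega) x * shift m h.le y) = ch m x * ch n y
  ch_one : ch 0 1 = 1

namespace BMWTower

variable {q μ : ℂ} {B : ℕ → Type} [∀ L, Ring (B L)] [∀ L, Algebra ℂ (B L)]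
    {C : Type} [Ring C] [Algebra ℂ C] (𝒯 : BMWTower q μ B C)

/-- The antisymmetrizer `a^{(m)}` on `L` strands. -/
def asym (L m : ℕ) : B L := antisymmetrizer q μ (𝒯.r L) m

/-- `κ i` on `L` strands. -/
def k (L i : ℕ) : B L := kappa q μ (𝒯.r L i)

/-- The contraction `g`. -/
def g : C := (loopValue q μ)⁻¹ • 𝒯.ch 2 (𝒯.k 2 0)

/-- The power sum `p_{n+1}`. -/
def p (n : ℕ) : C := 𝒯.ch (n + 1) (desc (𝒯.r (n + 1)) 0 n)

/-- The elementary symmetric function `a_m`. -/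
def a (m : ℕ) : C := 𝒯.ch m (𝒯.asym m m)

/-- The hook `ch (a^{(m+1)} r_{m+i-1} ⋯ r_m)`. -/
def hook (m i : ℕ) : C :=
  𝒯.ch (m + i + 1) (𝒯.asym (m + i + 1) (m + 1) * desc (𝒯.r (m + i + 1)) m i)

/-- The contracted hook `ch (a^{(m+1)} r_{m+i} ⋯ r_{m+1} κ_m)`. -/
def khook (m i : ℕ) : C :=
  𝒯.ch (m + i + 2) (𝒯.asym (m + i + 2) (m + 1) * desc (𝒯.r (m + i + 2)) (m + 1) i *
    𝒯.k (m + i + 2) m)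

lemma hook_eq {L m i : ℕ} (h : m + i + 1 = L) :
    𝒯.ch L (𝒯.asym L (m + 1) * desc (𝒯.r L) m i) = 𝒯.hook m i := by subst h; rfl

lemma khook_eq {L m i : ℕ} (h : m + i + 2 = L) :
    𝒯.ch L (𝒯.asym L (m + 1) * desc (𝒯.r L) (m + 1) i * 𝒯.k L m) = 𝒯.khook m i := by
  subst h; rfl

lemma incl_asym {m L j : ℕ} (h : m ≤ L) (hj : j ≤ m) : 𝒯.incl h (𝒯.asym m j) = 𝒯.asym L j := by
  rw [asym, map_antisymmetrizer]
  exact antisymmetrizer_congr fun i hi => 𝒯.incl_r h i (by omega)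

lemma incl_k {m L i : ℕ} (h : m ≤ L) (hi : i + 1 < m) : 𝒯.incl h (𝒯.k m i) = 𝒯.k L i := by
  rw [k, map_kappa, 𝒯.incl_r h i hi, k]

lemma incl_desc {m L lo len : ℕ} (h : m ≤ L) (hi : lo + len + 1 ≤ m) :
    𝒯.incl h (desc (𝒯.r m) lo len) = desc (𝒯.r L) lo len :=
  map_desc (𝒯.incl h).toRingHom fun j hj => 𝒯.incl_r h _ (by omega)

/-- The last two strands closed by `κ`. -/
lemma ch_mul_k {n L : ℕ} (hp : BMWParam q μ) (h : n + 2 = L) (x : B n) :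
    𝒯.ch L (𝒯.incl (by omega) x * 𝒯.k L n) = loopValue q μ • (𝒯.ch n x * 𝒯.g) := by
  have : 𝒯.k L n = 𝒯.shift n h.le (𝒯.k 2 0) := by
    rw [k, k, map_kappa, 𝒯.shift_r n h.le 0 (by omega), add_zero]
  rw [this, 𝒯.ch_mul h, g, mul_smul_comm, smul_inv_smul₀ hp.loopValue_ne]

lemma ch_asym_desc {m i L : ℕ} (h : m + (i + 1) = L) :
    𝒯.ch L (𝒯.asym L m * desc (𝒯.r L) m i) = 𝒯.a m * 𝒯.p i := by
  have e1 := 𝒯.ch_mul h (𝒯.asym m m) (desc (𝒯.r (i + 1)) 0 i)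
  rw [𝒯.incl_asym _ le_rfl] at e1
  have e2 : 𝒯.shift m h.le (desc (𝒯.r (i + 1)) 0 i) = desc (𝒯.r L) m i :=
    map_desc (𝒯.shift m h.le).toRingHom fun j hj => by
      have := 𝒯.shift_r m h.le j (by omega)
      simpa using this
  rw [e2] at e1
  exact e1

lemma asym_commute {L m j : ℕ} (hm : m ≤ j) (hj : j + 1 < L) :
    Commute (𝒯.asym L m) (𝒯.r L j) :=
  (antisymmetrizer_commute fun i hi => (((𝒯.rel L).comm i j (by omega) hj).symm)).symm

lemma asym_commute_k {L m j : ℕ} (hm : m ≤ j) (hj : j + 1 < L) :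
    Commute (𝒯.asym L m) (𝒯.k L j) :=
  kappa_commute (𝒯.asym_commute hm hj)

lemma asym_commute_desc {L m lo len : ℕ} (hm : m ≤ lo) (hj : lo + len < L) :
    Commute (𝒯.asym L m) (desc (𝒯.r L) lo len) :=
  desc_commute fun j h1 h2 => 𝒯.asym_commute (by omega) (by omega)

lemma ch_conj {L : ℕ} {w z z' : B L} (hw : IsUnit w) (h : w * z = z' * w) :
    𝒯.ch L z = 𝒯.ch L z' := by
  obtain ⟨u, rfl⟩ := hw
  have : z = ↑u⁻¹ * (z' * u) := by rw [← h, Units.inv_mul_cancel_left]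
  rw [this, 𝒯.ch_comm, mul_assoc, Units.mul_inv, mul_one]

/-- The coefficient `c_m`. -/
def cCoeff (q μ : ℂ) (m : ℕ) : ℂ :=
  μ * (q - q⁻¹) * qnum q m / (μ + q * (q⁻¹) ^ (2 * m))

/-- `(m+2)_q a^{(m+2)}`. -/
def pre (L m : ℕ) : B L :=
  𝒯.asym L (m + 1) * (q ^ (m + 1) • 1 - qnum q (m + 1) • 𝒯.r L m -
    cCoeff q μ (m + 1) • 𝒯.k L m) * 𝒯.asym L (m + 1)

lemma pre_factor (hp : BMWParam q μ) (L m : ℕ) :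
    q ^ (m + 1) • 1 - qnum q (m + 1) • 𝒯.r L m - cCoeff q μ (m + 1) • 𝒯.k L m =
      q ^ (m + 1) • sigmaMinus q μ ((q⁻¹) ^ (2 * (m + 1))) (𝒯.r L m) := by
  have hq := hp.q_ne
  have hl := hp.lam_ne
  have h1 := sub_one_div_lam hq (m + 1)
  have h2 : (q⁻¹) ^ (2 * (m + 1)) - 1 = -((q⁻¹) ^ (m + 1) * qnum q (m + 1)) * (q - q⁻¹) := by
    rw [← h1, div_mul_cancel₀ _ hl]
  have h3 : q ^ (m + 1) * (q⁻¹) ^ (m + 1) = 1 := by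
    rw [← mul_pow, mul_inv_cancel₀ hq, one_pow]
  rw [sigmaMinus, smul_add, smul_add, smul_smul, smul_smul, h1, sub_eq_add_neg, sub_eq_add_neg,
    ← neg_smul, ← neg_smul]
  congr 2
  · congr 1
    linear_combination qnum q (m + 1) * h3
  · rw [cCoeff, h2, ← mul_div_assoc, ← neg_div]
    congr 1
    linear_combination (μ * (q - q⁻¹) * qnum q (m + 1)) * h3

lemma qnum_smul_asym (hp : BMWParam q μ) (L m : ℕ) (hm : qnum q (m + 2) ≠ 0) :
    qnum q (m + 2) • 𝒯.asym L (m + 2) = 𝒯.pre L m := by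
  rw [pre, 𝒯.pre_factor hp, mul_smul_comm, smul_mul_assoc, asym, antisymmetrizer, smul_smul,
    mul_div_cancel₀ _ hm]
  rfl

lemma asym_idem (hp : BMWParam q μ) {L m : ℕ} (hm : m + 1 ≤ L) (hd : AsymDef q μ (m + 1)) :
    𝒯.asym L (m + 1) * 𝒯.asym L (m + 1) = 𝒯.asym L (m + 1) :=
  antisymmetrizer_mul_self hp (𝒯.rel L) hm hd

/-- By cyclicity the right-hand idempotent can be brought round to the left; as `z` commutes with
it, the two copies merge into one. What remains is linear in `1, r m, κ m`. -/
lemma ch_pre_mul (hp : BMWParam q μ) {L m : ℕ} (hm : m + 1 ≤ L) (hd : AsymDef q μ (m + 1))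
    {z : B L} (hz : Commute (𝒯.asym L (m + 1)) z) :
    𝒯.ch L (𝒯.pre L m * z) = q ^ (m + 1) • 𝒯.ch L (𝒯.asym L (m + 1) * z) -
      qnum q (m + 1) • 𝒯.ch L (𝒯.asym L (m + 1) * z * 𝒯.r L m) -
      cCoeff q μ (m + 1) • 𝒯.ch L (𝒯.asym L (m + 1) * z * 𝒯.k L m) := by
  have hi := 𝒯.asym_idem hp hm hd
  set e := 𝒯.asym L (m + 1) with he
  set y := q ^ (m + 1) • 1 - qnum q (m + 1) • 𝒯.r L m - cCoeff q μ (m + 1) • 𝒯.k L m with hy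
  have : 𝒯.ch L (𝒯.pre L m * z) = 𝒯.ch L (e * z * y) := by
    rw [pre, ← he, ← hy, mul_assoc (e * y), 𝒯.ch_comm, ← mul_assoc, hz.eq, mul_assoc z, hi]
  rw [this, hy]
  simp only [mul_sub, mul_smul_comm, mul_one, map_sub, map_smul]

/-- The recursion for hooks. -/
lemma ch_pre_desc (hp : BMWParam q μ) {L m i : ℕ} (hL : m + i + 2 = L)
    (hd : AsymDef q μ (m + 1)) :
    𝒯.ch L (𝒯.pre L m * desc (𝒯.r L) (m + 1) i) = q ^ (m + 1) • (𝒯.a (m + 1) * 𝒯.p i) -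
      qnum q (m + 1) • 𝒯.hook m (i + 1) - cCoeff q μ (m + 1) • 𝒯.khook m i := by
  rw [𝒯.ch_pre_mul hp (by omega) hd (𝒯.asym_commute_desc le_rfl (by omega)),
    𝒯.ch_asym_desc (by omega), 𝒯.khook_eq hL, mul_assoc, ← desc_succ', 𝒯.hook_eq (by omega)]

/-- Contraction of `κ` with the descending word next to it. -/
lemma ch_move {L j i : ℕ} (hL : j + i + 3 = L) {y t t' : B L}
    (hy : ∀ l, j ≤ l → l + 1 < L → Commute y (𝒯.r L l))
    (ht : mover (𝒯.r L) j i * t = t' * mover (𝒯.r L) j i) :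
    𝒯.ch L (y * desc (𝒯.r L) (j + 2) i * t) = 𝒯.ch L (y * desc (𝒯.r L) j i * t') := by
  have hw := (𝒯.rel L).isUnit_mover j i (by omega)
  have hyw : Commute y (mover (𝒯.r L) j i) := mover_commute fun l h1 h2 => hy l h1 (by omega)
  have hd := (𝒯.rel L).mover_desc j i (by omega)
  refine 𝒯.ch_conj hw ?_
  rw [← mul_assoc, ← mul_assoc, ← hyw.eq, mul_assoc y, hd, ← mul_assoc, mul_assoc _ _ t, ht]
  simp only [mul_assoc]

/-- After conjugation by the mover the sandwich collapses to a single `κ` on the last two strands,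
where it can be split off as a factor `g`, while `t` stays where it was. It is applied with `t`
equal to `r m` and to `κ m`. -/
lemma mover_contract {L j i : ℕ} (hL : j + i + 4 = L) {t : B L}
    (ht : ∀ l, j + 2 ≤ l → l + 1 < L → Commute t (𝒯.r L l)) :
    mover (𝒯.r L) (j + 1) i * (𝒯.k L (j + 1) * t * 𝒯.k L (j + 2) * 𝒯.k L (j + 1)) =
      (t * 𝒯.k L (j + i + 2)) * mover (𝒯.r L) (j + 1) i := by
  have hyz := (𝒯.rel L).pair (j + 1) (by omega)
  have hS := hyz.mul_mul_contract (kappa_commute (ht (j + 2) (by omega) (by omega)))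
  cases i with
  | zero => exact hS
  | succ i =>
    have hv2 : Commute t (mover (𝒯.r L) (j + 2) i) :=
      mover_commute fun l h1 h2 => ht l h1 (by omega)
    have hv3 := (𝒯.rel L).mover_kappa (j + 2) i (by omega)
    rw [show j + 2 + i + 1 = j + (i + 1) + 2 by omega] at hv3
    set v := mover (𝒯.r L) (j + 2) i
    have hv1 : mover (𝒯.r L) (j + 1) (i + 1) = v * (𝒯.r L (j + 1) * 𝒯.r L (j + 2)) :=
      mover_succ' _ _ _
    rw [hv1, mul_assoc v]
    change v * (𝒯.r L (j + 1) * 𝒯.r L (j + 1 + 1) * _) = _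
    rw [k, k, hS, ← mul_assoc, ← mul_assoc v t, ← hv2.eq, mul_assoc t]
    change t * (v * kappa q μ (𝒯.r L (j + 2))) * _ = _
    rw [hv3]
    simp only [mul_assoc]
    rfl

lemma ch_pre_mul' (hp : BMWParam q μ) {L m : ℕ} (hm : m + 1 ≤ L) (hd : AsymDef q μ (m + 1))
    {z : B L} (hz : Commute (𝒯.asym L (m + 1)) z) :
    𝒯.ch L (𝒯.pre L m * z) = q ^ (m + 1) • 𝒯.ch L (𝒯.asym L (m + 1) * (1 * z)) -
      qnum q (m + 1) • 𝒯.ch L (𝒯.asym L (m + 1) * (𝒯.r L m * z)) -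
      cCoeff q μ (m + 1) • 𝒯.ch L (𝒯.asym L (m + 1) * (𝒯.k L m * z)) := by
  have hi := 𝒯.asym_idem hp hm hd
  set e := 𝒯.asym L (m + 1) with he
  set y := q ^ (m + 1) • 1 - qnum q (m + 1) • 𝒯.r L m - cCoeff q μ (m + 1) • 𝒯.k L m with hy
  have : 𝒯.ch L (𝒯.pre L m * z) = 𝒯.ch L (e * (y * z)) := by
    rw [pre, ← he, ← hy, mul_assoc (e * y), hz.eq, ← mul_assoc, 𝒯.ch_comm]
    simp only [← mul_assoc]
    rw [hi]
  rw [this, hy]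
  simp only [sub_mul, mul_sub, smul_mul_assoc, mul_smul_comm, map_sub, map_smul]

/-- Write `κ = δ⁻¹ κ²` with `δ` the loop value and send one of the two factors round the trace.
Whatever does not commute with `κ` ends up between two copies of it, where the sandwich relations
apply. -/
lemma ch_double_k (hp : BMWParam q μ) {L j : ℕ} (hj : j + 1 < L) {e d t x : B L}
    (he : Commute e (𝒯.k L j)) (hdt : Commute d t) (hd : Commute d (𝒯.k L j)) :
    𝒯.ch L (e * (t * (d * x * 𝒯.k L j))) =
      (loopValue q μ)⁻¹ • 𝒯.ch L (e * d * (𝒯.k L j * t * x * 𝒯.k L j)) := by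
  have hk : 𝒯.k L j = (loopValue q μ)⁻¹ • (𝒯.k L j * 𝒯.k L j) := by
    rw [show 𝒯.k L j * 𝒯.k L j = loopValue q μ • 𝒯.k L j from ((𝒯.rel L).gen j hj).k_sq,
      inv_smul_smul₀ hp.loopValue_ne]
  have h1 : e * (t * (d * x * 𝒯.k L j)) =
      (loopValue q μ)⁻¹ • (e * (t * (d * x * 𝒯.k L j)) * 𝒯.k L j) := by
    conv_lhs => rw [hk]
    simp only [mul_smul_comm, mul_assoc]
  rw [h1, map_smul, 𝒯.ch_comm]
  congr 2
  set κ := 𝒯.k L j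
  calc κ * (e * (t * (d * x * κ))) = (κ * e) * (t * d) * x * κ := by simp only [mul_assoc]
    _ = (e * κ) * (d * t) * x * κ := by rw [he.eq, hdt.eq]
    _ = e * (κ * d) * t * x * κ := by simp only [mul_assoc]
    _ = e * (d * κ) * t * x * κ := by rw [hd.eq]
    _ = e * d * (κ * t * x * κ) := by simp only [mul_assoc]

/-- The recursion for contracted hooks. -/
lemma ch_pre_desc_k (hp : BMWParam q μ) {L m i : ℕ} (hL : m + i + 4 = L)
    (hd : AsymDef q μ (m + 1)) :
    𝒯.ch L (𝒯.pre L m * (desc (𝒯.r L) (m + 2) (i + 1) * 𝒯.k L (m + 1))) =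
      ((q⁻¹) ^ (m + 1) * μ⁻¹) • (𝒯.a (m + 1) * 𝒯.p i * 𝒯.g) -
      qnum q (m + 1) • (𝒯.khook m i * 𝒯.g) +
      (qnum q (m + 1) * (q - q⁻¹) - cCoeff q μ (m + 1)) • (𝒯.hook m (i + 1) * 𝒯.g) := by
  have hδ := hp.loopValue_ne
  have hxy := (𝒯.rel L).pair m (by omega)
  have hyz := (𝒯.rel L).pair (m + 1) (by omega)
  have hek : Commute (𝒯.asym L (m + 1)) (𝒯.k L (m + 1)) := 𝒯.asym_commute_k le_rfl (by omega)
  have hz : Commute (𝒯.asym L (m + 1)) (desc (𝒯.r L) (m + 2) (i + 1) * 𝒯.k L (m + 1)) :=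
    (𝒯.asym_commute_desc (by omega) (by omega)).mul_right hek
  have hdr : Commute (desc (𝒯.r L) (m + 3) i) (𝒯.r L m) :=
    (desc_commute fun l h1 h2 => (𝒯.rel L).comm m l (by omega) (by omega)).symm
  have hdr' : Commute (desc (𝒯.r L) (m + 3) i) (𝒯.r L (m + 1)) :=
    (desc_commute fun l h1 h2 => (𝒯.rel L).comm (m + 1) l (by omega) (by omega)).symm
  have hmove : ∀ {t t' : B L}, mover (𝒯.r L) (m + 1) i * t = t' * mover (𝒯.r L) (m + 1) i →
      𝒯.ch L (𝒯.asym L (m + 1) * desc (𝒯.r L) (m + 3) i * t) =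
        𝒯.ch L (𝒯.asym L (m + 1) * desc (𝒯.r L) (m + 1) i * t') := fun h =>
    𝒯.ch_move (by omega) (fun l h1 h2 => 𝒯.asym_commute h1 h2) h
  have hdk : Commute (desc (𝒯.r L) (m + 3) i) (𝒯.k L m) := kappa_commute hdr
  have hdk' : Commute (desc (𝒯.r L) (m + 3) i) (𝒯.k L (m + 1)) := kappa_commute hdr'
  -- The mover carries `κ` to the last two strands and brings the descending word next to the
  -- antisymmetrizer; the trace then factors.
  have v1 : 𝒯.ch L (𝒯.asym L (m + 1) * desc (𝒯.r L) (m + 3) i * 𝒯.k L (m + 1)) =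
      loopValue q μ • (𝒯.a (m + 1) * 𝒯.p i * 𝒯.g) := by
    have hm : mover (𝒯.r L) (m + 1) i * 𝒯.k L (m + 1) =
        𝒯.k L (m + i + 2) * mover (𝒯.r L) (m + 1) i := by
      have := (𝒯.rel L).mover_kappa (m + 1) i (by omega)
      rwa [show m + 1 + i + 1 = m + i + 2 by omega] at this
    rw [hmove hm]
    have := 𝒯.ch_mul_k hp (n := m + i + 2) (L := L) (by omega)
      (𝒯.asym (m + i + 2) (m + 1) * desc (𝒯.r (m + i + 2)) (m + 1) i)
    rw [map_mul (𝒯.incl _), 𝒯.incl_asym _ (by omega), 𝒯.incl_desc _ (by omega),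
      𝒯.ch_asym_desc (by omega)] at this
    exact this
  -- Here the surviving letter `r m` prolongs the descending word by one and yields an uncontracted
  -- hook; in `v3` the surviving `κ m` yields a contracted one.
  have v2 : 𝒯.ch L (𝒯.asym L (m + 1) * desc (𝒯.r L) (m + 3) i *
      (𝒯.k L (m + 1) * 𝒯.r L m * 𝒯.k L (m + 2) * 𝒯.k L (m + 1))) =
      loopValue q μ • (𝒯.hook m (i + 1) * 𝒯.g) := by
    rw [hmove (𝒯.mover_contract hL fun l h1 h2 => (𝒯.rel L).comm m l h1 h2),
      ← mul_assoc, mul_assoc _ _ (𝒯.r L m), ← desc_succ']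
    have := 𝒯.ch_mul_k hp (n := m + i + 2) (L := L) (by omega)
      (𝒯.asym (m + i + 2) (m + 1) * desc (𝒯.r (m + i + 2)) m (i + 1))
    rw [map_mul (𝒯.incl _), 𝒯.incl_asym _ (by omega), 𝒯.incl_desc _ (by omega),
      𝒯.hook_eq (by omega)] at this
    exact this
  have v3 : 𝒯.ch L (𝒯.asym L (m + 1) * desc (𝒯.r L) (m + 3) i *
      (𝒯.k L (m + 1) * 𝒯.k L m * 𝒯.k L (m + 2) * 𝒯.k L (m + 1))) =
      loopValue q μ • (𝒯.khook m i * 𝒯.g) := by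
    have hm : ∀ l, m + 2 ≤ l → l + 1 < L → Commute (𝒯.k L m) (𝒯.r L l) := fun l h1 h2 =>
      (kappa_commute ((𝒯.rel L).comm m l h1 h2).symm).symm
    rw [hmove (𝒯.mover_contract hL hm), ← mul_assoc]
    have := 𝒯.ch_mul_k hp (n := m + i + 2) (L := L) (by omega)
      (𝒯.asym (m + i + 2) (m + 1) * desc (𝒯.r (m + i + 2)) (m + 1) i * 𝒯.k (m + i + 2) m)
    rw [map_mul (𝒯.incl _), map_mul (𝒯.incl _), 𝒯.incl_asym _ (by omega), 𝒯.incl_desc _ (by omega),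
      𝒯.incl_k _ (by omega), 𝒯.khook_eq (by omega)] at this
    exact this
  -- The three terms of `pre` between two copies of `κ`. The roles cross over: the leading term of
  -- the `r m` sandwich is the one with `κ m`, while the `κ m` sandwich equals the one with `r m`.
  have w1 : 𝒯.k L (m + 1) * 1 * 𝒯.r L (m + 2) * 𝒯.k L (m + 1) = μ⁻¹ • 𝒯.k L (m + 1) := by
    rw [mul_one]; exact hyz.kx_y_kx hp
  have w2 : 𝒯.k L (m + 1) * 𝒯.r L m * 𝒯.r L (m + 2) * 𝒯.k L (m + 1) = _ :=
    hxy.k_mul_mul_mul_k hp hyz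
  have w3 : 𝒯.k L (m + 1) * 𝒯.k L m * 𝒯.r L (m + 2) * 𝒯.k L (m + 1) =
      𝒯.k L (m + 1) * 𝒯.r L m * 𝒯.k L (m + 2) * 𝒯.k L (m + 1) := hxy.k_mul_k_mul_mul_k hyz
  rw [𝒯.ch_pre_mul' hp (by omega) hd hz, desc_succ',
    𝒯.ch_double_k hp (by omega) hek (Commute.one_right _) hdk',
    𝒯.ch_double_k hp (by omega) hek hdr hdk', 𝒯.ch_double_k hp (by omega) hek hdk hdk', w1, w2, w3]
  simp only [mul_add, mul_sub, mul_smul_comm, map_add, map_sub, map_smul]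
  change _ - qnum q (m + 1) • (loopValue q μ)⁻¹ • (𝒯.ch L (𝒯.asym L (m + 1) *
    desc (𝒯.r L) (m + 3) i * (𝒯.k L (m + 1) * 𝒯.k L m * 𝒯.k L (m + 2) * 𝒯.k L (m + 1))) -
    (q - q⁻¹) • 𝒯.ch L (𝒯.asym L (m + 1) *
    desc (𝒯.r L) (m + 3) i * (𝒯.k L (m + 1) * 𝒯.r L m * 𝒯.k L (m + 2) * 𝒯.k L (m + 1))) +
    ((q - q⁻¹) * μ⁻¹) • 𝒯.ch L (𝒯.asym L (m + 1) *
    desc (𝒯.r L) (m + 3) i * 𝒯.k L (m + 1))) - _ = _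
  rw [v1, v2, v3]
  have hl := hp.lam_ne
  -- The coefficient of `a p g` collects `q^{m+1}` from the unit and `-(m+1)_q (q-q⁻¹)` from `r m`.
  have hq : (q⁻¹) ^ (m + 1) = q ^ (m + 1) - qnum q (m + 1) * (q - q⁻¹) := by
    rw [qnum, div_mul_cancel₀ _ hl]; ring
  rw [hq]
  match_scalars <;> field_simp

/-- The boundary case with empty descending word. All three sandwiches are multiples of `κ`, so a
single product `a g` appears, with the loop value in its coefficient. -/
lemma ch_pre_k (hp : BMWParam q μ) {L m : ℕ} (hL : m + 3 = L) (hd : AsymDef q μ (m + 1)) :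
    𝒯.ch L (𝒯.pre L m * 𝒯.k L (m + 1)) =
      (q ^ (m + 1) * loopValue q μ - qnum q (m + 1) * μ⁻¹ - cCoeff q μ (m + 1)) •
        (𝒯.a (m + 1) * 𝒯.g) := by
  have hδ := hp.loopValue_ne
  have hxy := (𝒯.rel L).pair m (by omega)
  have hek : Commute (𝒯.asym L (m + 1)) (𝒯.k L (m + 1)) := 𝒯.asym_commute_k le_rfl (by omega)
  have v1 : 𝒯.ch L (𝒯.asym L (m + 1) * 𝒯.k L (m + 1)) =
      loopValue q μ • (𝒯.a (m + 1) * 𝒯.g) := by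
    have := 𝒯.ch_mul_k hp (n := m + 1) (L := L) (by omega) (𝒯.asym (m + 1) (m + 1))
    rw [𝒯.incl_asym _ (by omega)] at this
    exact this
  have key : ∀ t, 𝒯.ch L (𝒯.asym L (m + 1) * (t * 𝒯.k L (m + 1))) =
      (loopValue q μ)⁻¹ • 𝒯.ch L (𝒯.asym L (m + 1) * (𝒯.k L (m + 1) * t * 𝒯.k L (m + 1))) := by
    intro t
    have := 𝒯.ch_double_k hp (L := L) (j := m + 1) (by omega) hek (d := 1) (t := t) (x := 1)
      (Commute.one_left _) (Commute.one_left _)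
    simpa only [mul_one, one_mul] using this
  have w2 : 𝒯.k L (m + 1) * 𝒯.r L m * 𝒯.k L (m + 1) = μ⁻¹ • 𝒯.k L (m + 1) :=
    hxy.symm.kx_y_kx hp
  have w3 : 𝒯.k L (m + 1) * 𝒯.k L m * 𝒯.k L (m + 1) = 𝒯.k L (m + 1) := hxy.kyxy
  rw [𝒯.ch_pre_mul' hp (by omega) hd hek, one_mul, key (𝒯.r L m), key (𝒯.k L m), w2, w3,
    mul_smul_comm, map_smul, v1]
  match_scalars
  field_simp

/-- With no antisymmetrizer left, the sandwich `κ₀ r₁ κ₀ = μ⁻¹ κ₀` removes one letter, and the mover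
takes `κ₀` to the end of the word. -/
lemma khook_zero_succ (hp : BMWParam q μ) (i : ℕ) :
    𝒯.khook 0 (i + 1) = μ⁻¹ • (𝒯.p i * 𝒯.g) := by
  have hδ := hp.loopValue_ne
  have h1 := 𝒯.khook_eq (L := i + 3) (m := 0) (i := i + 1) (by omega)
  have hyz := (𝒯.rel (i + 3)).pair 0 (by omega)
  have hdr' : Commute (desc (𝒯.r (i + 3)) 2 i) (𝒯.r (i + 3) 0) :=
    (desc_commute fun l h1 h2 => (𝒯.rel (i + 3)).comm 0 l (by omega) (by omega)).symm
  have h2 := 𝒯.ch_double_k hp (L := i + 3) (j := 0) (by omega) (e := 1) (t := 1)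
    (d := desc (𝒯.r (i + 3)) 2 i) (x := 𝒯.r (i + 3) 1) (Commute.one_left _)
    (Commute.one_right _) (kappa_commute hdr')
  have w1 : 𝒯.k (i + 3) 0 * 𝒯.r (i + 3) 1 * 𝒯.k (i + 3) 0 = μ⁻¹ • 𝒯.k (i + 3) 0 :=
    hyz.kx_y_kx hp
  have hone : 𝒯.asym (i + 3) (0 + 1) = 1 := rfl
  rw [← h1, hone, desc_succ']
  rw [one_mul] at h2 ⊢
  rw [mul_one, w1, mul_smul_comm, map_smul] at h2
  have v1 : 𝒯.ch (i + 3) (1 * desc (𝒯.r (i + 3)) 2 i * 𝒯.k (i + 3) 0) =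
      loopValue q μ • (𝒯.p i * 𝒯.g) := by
    have hm : mover (𝒯.r (i + 3)) 0 i * 𝒯.k (i + 3) 0 =
        𝒯.k (i + 3) (0 + i + 1) * mover (𝒯.r (i + 3)) 0 i :=
      (𝒯.rel (i + 3)).mover_kappa 0 i (by omega)
    rw [𝒯.ch_move (j := 0) (by omega) (fun l _ _ => Commute.one_left _) hm]
    have := 𝒯.ch_mul_k hp (n := i + 1) (L := i + 3) (by omega) (desc (𝒯.r (i + 1)) 0 i)
    rw [𝒯.incl_desc _ (by omega)] at this
    rw [one_mul, zero_add]
    exact this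
  rw [v1] at h2
  rw [one_mul] at h2
  refine h2.trans ?_
  match_scalars
  field_simp

lemma khook_zero_zero (hp : BMWParam q μ) : 𝒯.khook 0 0 = loopValue q μ • 𝒯.g := by
  have h : 𝒯.khook 0 0 = 𝒯.ch 2 (1 * 1 * 𝒯.k 2 0) := rfl
  rw [h, one_mul, one_mul, g, smul_inv_smul₀ hp.loopValue_ne]

lemma hook_zero (i : ℕ) : 𝒯.hook 0 i = 𝒯.p i := by
  rw [← 𝒯.hook_eq (L := i + 1) (by omega), p]
  exact congrArg _ (one_mul _)

lemma hook_self (m : ℕ) : 𝒯.hook m 0 = 𝒯.a (m + 1) := by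
  rw [← 𝒯.hook_eq (L := m + 1) (by omega), a]
  exact congrArg _ (mul_one _)

lemma a_zero : 𝒯.a 0 = 1 := 𝒯.ch_one

end BMWTower

/-! ### From the hook recursions to the Newton relations. -/

section HookSystem

variable {q μ : ℂ} {C : Type*} [Ring C] [Algebra ℂ C]

/-- The coefficient `(q - q⁻¹) / (μ + q^{1-2m})`. -/
def gam (q μ : ℂ) (m : ℕ) : ℂ := (q - q⁻¹) / (μ + q * (q⁻¹) ^ (2 * m))

lemma cCoeff_eq (q μ : ℂ) (m : ℕ) : BMWTower.cCoeff q μ m = μ * gam q μ m * qnum q m := by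
  unfold BMWTower.cCoeff gam; ring

lemma qnum_sub_cCoeff {m : ℕ} (h : μ + q * (q⁻¹) ^ (2 * m) ≠ 0) :
    qnum q m * (q - q⁻¹) - BMWTower.cCoeff q μ m =
      q * (q⁻¹) ^ (2 * m) * gam q μ m * qnum q m := by
  have e : gam q μ m * (μ + q * (q⁻¹) ^ (2 * m)) = q - q⁻¹ := div_mul_cancel₀ _ h
  rw [cCoeff_eq]
  linear_combination (-qnum q m) * e

lemma gam_succ_mul (hq : q ≠ 0) {m : ℕ} (h : μ + q * (q⁻¹) ^ (2 * (m + 1)) ≠ 0) :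
    gam q μ (m + 1) * (μ + q⁻¹ * ((q⁻¹) ^ m * (q⁻¹) ^ m)) = q - q⁻¹ := by
  have : q⁻¹ * ((q⁻¹) ^ m * (q⁻¹) ^ m) = q * (q⁻¹) ^ (2 * (m + 1)) := by
    have hqq : q * q⁻¹ = 1 := mul_inv_cancel₀ hq
    linear_combination (-(q⁻¹) ^ (2 * m + 1)) * hqq
  rw [this]
  exact div_mul_cancel₀ _ h

section Scalars

variable {γ γ' y i w : ℂ}

/-- With `γ = γ_m`, `γ' = γ_{m+1}`, `y = q^{-m}` and `i = q⁻¹`, this is `1/γ_m - 1/γ_{m+1} =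
q^{-2m}` without denominators. It is the source of all later cancellations between consecutive
levels. -/
lemma gam_rel (hl : q - i ≠ 0) (e1 : γ * (μ + q * (y * y)) = q - i)
    (e2 : γ' * (μ + i * (y * y)) = q - i) : γ' * (y * y * γ - 1) = -γ := by
  apply mul_right_cancel₀ hl
  linear_combination γ' * e1 - γ * e2

lemma gam_rel' (hqq : q * i = 1) (hw : μ * w = 1) (e1 : γ * (μ + q * (y * y)) = q - i)
    (e3 : γ' * (y * y * γ - 1) = -γ) :
    γ' * (y * y * w + q * (y * y) * γ) = γ * q ^ 2 * (y * y) * w := by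
  apply mul_left_cancel₀ (left_ne_zero_of_mul_eq_one hw)
  linear_combination (γ' * y * y - γ * q ^ 2 * y * y) * hw + γ' * q * y * y * e1 -
    γ' * y * y * hqq - q ^ 2 * y * y * e3

/-- The scalar identity behind the coefficients `μ q^N - q^{1-N}` of the Newton relations. The
hypotheses on `γ` carry a factor `n = N_q` so that they also hold at `N = 0`, where `γ_0` may have a
zero denominator. -/
lemma newton_coeff {n δ Q : ℂ} (hl : q - i ≠ 0) (hqq : q * i = 1) (hw : μ * w = 1)
    (hQ : Q * y = 1) (hn : n * (q - i) = Q - y) (hδ : δ * (μ * (q - i)) = (q - μ) * (i + μ))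
    (e1 : n * (γ * (μ + q * (y * y))) = n * (q - i)) (e2 : γ' * (μ + i * (y * y)) = q - i)
    (e4 : n * (γ' * (y * y * w + q * (y * y) * γ)) = n * (γ * q ^ 2 * (y * y) * w)) :
    γ * q ^ 2 * (y * y) * n - μ * γ' * (Q * δ - n * w - μ * γ * n) = μ * Q - q * y := by
  have e4' : n * (γ * q ^ 2 * (y * y)) = n * (γ' * (y * y + q * (y * y) * γ * μ)) := by
    linear_combination (-μ) * e4 + (γ' * n * y ^ 2 - γ * q ^ 2 * n * y ^ 2) * hw
  apply mul_right_cancel₀ hl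
  linear_combination (q - i) * e4' + (q - i) * γ' * μ * e1 + γ' * n * (q - i) * hw +
    γ' * (1 + y ^ 2 + μ * (q - i)) * hn - γ' * Q * hδ + (μ * Q - q * y) * e2 +
    γ' * (-Q + y ^ 3) * hqq + γ' * (y - i * y * μ) * hQ

end Scalars

/-- The recursion satisfied by the hooks `t m i` and the contracted hooks `u m i`. -/
structure HookSystem (q μ : ℂ) (M : ℕ) (a p : ℕ → C) (g : C) (t u : ℕ → ℕ → C) : Prop where
  a_zero : a 0 = 1
  t_zero : ∀ i, t 0 i = 0
  u_zero : ∀ i, u 0 i = 0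
  t_self : ∀ m, m ≤ M → t m 0 = qnum q m • a m
  t_succ : ∀ m i, m < M →
    t (m + 1) i = q ^ m • (a m * p i) - t m (i + 1) - (μ * gam q μ m) • u m i
  u_succ : ∀ m i, m < M → u (m + 1) (i + 1) =
    (((q⁻¹) ^ m * μ⁻¹) • (a m * p i) - u m i +
      (q * (q⁻¹) ^ (2 * m) * gam q μ m) • t m (i + 1)) * g
  u_self : ∀ m, m < M → u (m + 1) 0 =
    (q ^ m * loopValue q μ - qnum q m * μ⁻¹ - μ * gam q μ m * qnum q m) • (a m * g)

namespace HookSystem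

variable {M : ℕ} {a p : ℕ → C} {g : C} {t u : ℕ → ℕ → C}

lemma mono (h : HookSystem q μ M a p g t u) {M' : ℕ} (hM : M' ≤ M) :
    HookSystem q μ M' a p g t u :=
  ⟨h.a_zero, h.t_zero, h.u_zero, fun m hm => h.t_self m (hm.trans hM),
    fun m i hm => h.t_succ m i (hm.trans_le hM), fun m i hm => h.u_succ m i (hm.trans_le hM),
    fun m hm => h.u_self m (hm.trans_le hM)⟩

/-- Eliminating `a_m p_i` between the two recursions leaves hooks only. The coefficient of `t_{m+1}`
is the coefficient of `t_m` with `m` replaced by `m+1`, so with alternating signs the hook terms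
telescope. -/
lemma gam_u_succ (hp : BMWParam q μ)
    (hd : ∀ i < M, μ + q * (q⁻¹) ^ (2 * (i + 1)) ≠ 0) (h : HookSystem q μ M a p g t u)
    {m : ℕ} (hm : m < M) (i : ℕ) :
    gam q μ (m + 1) • u (m + 1) (i + 1) =
      ((gam q μ (m + 1) * (q⁻¹) ^ (2 * m) * μ⁻¹) • t (m + 1) i +
        (gam q μ m * q ^ 2 * (q⁻¹) ^ (2 * m) * μ⁻¹) • t m (i + 1) - gam q μ m • u m i) * g := by
  have hq := hp.q_ne
  have hμ := hp.mu_ne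
  have hx : (q⁻¹) ^ (2 * m) = (q⁻¹) ^ m * (q⁻¹) ^ m := by rw [two_mul, pow_add]
  have hqx : q ^ m * (q⁻¹) ^ m = 1 := by rw [← mul_pow, mul_inv_cancel₀ hq, one_pow]
  rw [h.u_succ m i hm, h.t_succ m i hm, ← smul_mul_assoc]
  congr 1
  -- The level `m = 0` is separate because `μ + q`, the denominator of `γ_0`, is not assumed
  -- nonzero; there the hooks vanish anyway.
  cases m with
  | zero =>
    rw [h.t_zero, h.u_zero]
    simp only [smul_zero, sub_zero, add_zero, pow_zero, one_smul, mul_zero, mul_one, one_mul,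
      smul_smul]
  | succ m =>
    have h1 := hd m (by omega)
    have h2 := hd (m + 1) (by omega)
    have e1 : gam q μ (m + 1) * (μ + q * (q⁻¹) ^ (2 * (m + 1))) = q - q⁻¹ :=
      div_mul_cancel₀ _ h1
    have e2 := gam_succ_mul hq h2
    rw [hx] at e1 ⊢
    set γ := gam q μ (m + 1)
    set γ' := gam q μ (m + 2)
    change γ' • _ = (γ' * _ * _) • _ + _ - _
    set y := (q⁻¹) ^ (m + 1)
    set Q := q ^ (m + 1)
    have e3 := gam_rel hp.lam_ne e1 e2
    have e4 := gam_rel' (mul_inv_cancel₀ hq) (mul_inv_cancel₀ hμ) e1 e3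
    match_scalars
    · linear_combination (-γ' * y * μ⁻¹) * hqx
    · linear_combination e3 + (γ' * y * y * γ ) * (mul_inv_cancel₀ hμ)
    · linear_combination e4

/-- The end of the telescope: the last hook term and the contracted hook with empty word are both
multiples of `a_N g`, and this is their combined coefficient. -/
lemma gam_u_self (hp : BMWParam q μ) {N : ℕ}
    (hd : ∀ i < N + 1, μ + q * (q⁻¹) ^ (2 * (i + 1)) ≠ 0) :
    gam q μ N * q ^ 2 * (q⁻¹) ^ (2 * N) * qnum q N - μ * gam q μ (N + 1) *
      (q ^ N * loopValue q μ - qnum q N * μ⁻¹ - μ * gam q μ N * qnum q N) =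
      μ * q ^ N - q * (q⁻¹) ^ N := by
  have hq := hp.q_ne
  have hμ := hp.mu_ne
  have hx : (q⁻¹) ^ (2 * N) = (q⁻¹) ^ N * (q⁻¹) ^ N := by rw [two_mul, pow_add]
  have e2 := gam_succ_mul hq (hd N (by omega))
  have h0 : N = 0 ∨ gam q μ N * (μ + q * ((q⁻¹) ^ N * (q⁻¹) ^ N)) = q - q⁻¹ := by
    cases N with
    | zero => exact Or.inl rfl
    | succ N => rw [← hx]; exact Or.inr (div_mul_cancel₀ _ (hd N (by omega)))
  have hn0 : N = 0 → qnum q N = 0 := by rintro rfl; simp [qnum]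
  rw [hx]
  refine newton_coeff hp.lam_ne (mul_inv_cancel₀ hq) (mul_inv_cancel₀ hμ)
    (by rw [← mul_pow, mul_inv_cancel₀ hq, one_pow]) (div_mul_cancel₀ _ hp.lam_ne)
    (div_mul_cancel₀ _ (mul_ne_zero hμ hp.lam_ne)) ?_ e2 ?_
  · rcases h0 with h0 | h0
    · rw [hn0 h0, zero_mul, zero_mul]
    · rw [h0]
  · rcases h0 with h0 | h0
    · rw [hn0 h0, zero_mul, zero_mul]
    · rw [gam_rel' (mul_inv_cancel₀ hq) (mul_inv_cancel₀ hμ) h0 (gam_rel hp.lam_ne h0 e2)]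

lemma telescope (h : HookSystem q μ M a p g t u) {N : ℕ} (hN : N ≤ M) :
    ∑ m ∈ Finset.range N, (-q) ^ m • (a m * p (N - 1 - m)) =
      (-((-1) ^ N * qnum q N)) • a N +
        ∑ m ∈ Finset.range N, ((-1) ^ m * (μ * gam q μ m)) • u m (N - 1 - m) := by
  have e : ∀ m ∈ Finset.range N, (-q) ^ m • (a m * p (N - 1 - m)) =
      (((-1 : ℂ) ^ m • t m (N - m)) - ((-1 : ℂ) ^ (m + 1) • t (m + 1) (N - (m + 1)))) +
        ((-1) ^ m * (μ * gam q μ m)) • u m (N - 1 - m) := by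
    intro m hm
    have hm' := Finset.mem_range.1 hm
    have h1 : N - (m + 1) = N - 1 - m := by omega
    have h2 : N - m = N - 1 - m + 1 := by omega
    rw [h1, h2, h.t_succ m _ (by omega), neg_pow, pow_succ (-1 : ℂ)]
    module
  rw [Finset.sum_congr rfl e, Finset.sum_add_distrib, Finset.sum_range_sub', h.t_zero,
    Nat.sub_self, h.t_self N hN]
  congr 1
  module

/-- The contribution of the contracted hooks in degree `N`. -/
def kSum (q μ : ℂ) (u : ℕ → ℕ → C) (N : ℕ) : C :=
  ∑ m ∈ Finset.range N, ((-1) ^ m * (μ * gam q μ m)) • u m (N - 1 - m)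

/-- The term `m = 0` vanishes and the term `m = N+1` has an empty word. In between, `gam_u_succ`
lowers the degree by two, at the price of a factor `g` and of a telescoping sum of hooks. -/
lemma kSum_add_two (hp : BMWParam q μ) (hd : AsymDef q μ (M + 1))
    (h : HookSystem q μ M a p g t u) {N : ℕ} (hN : N + 1 ≤ M) :
    kSum q μ u (N + 2) = (kSum q μ u N +
      ((-1) ^ N * (μ * q ^ N - q * (q⁻¹) ^ N)) • a N) * g := by
  have hq := hp.q_ne
  have hμ := hp.mu_ne
  unfold kSum
  rw [Finset.sum_range_succ', h.u_zero, smul_zero, add_zero, Finset.sum_range_succ]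
  have e : ∀ m ∈ Finset.range N,
      ((-1) ^ (m + 1) * (μ * gam q μ (m + 1))) • u (m + 1) (N + 2 - 1 - (m + 1)) =
      ((((-1 : ℂ) ^ m * (gam q μ m * q ^ 2 * (q⁻¹) ^ (2 * m))) • -t m (N - m)) -
       (((-1 : ℂ) ^ (m + 1) * (gam q μ (m + 1) * q ^ 2 * (q⁻¹) ^ (2 * (m + 1)))) •
          -t (m + 1) (N - (m + 1)))) * g +
        (((-1) ^ m * (μ * gam q μ m)) • u m (N - 1 - m)) * g := by
    intro m hm
    have hm' := Finset.mem_range.1 hm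
    have h1 : N - (m + 1) = N - 1 - m := by omega
    have h2 : N - m = N - 1 - m + 1 := by omega
    have h3 : N + 2 - 1 - (m + 1) = N - 1 - m + 1 := by omega
    rw [h1, h2, h3, ← mul_assoc, mul_smul,
      h.gam_u_succ hp (fun i hi => (hd i (by omega)).2) (by omega), ← smul_mul_assoc,
      ← add_mul]
    congr 1
    have h4 : (q⁻¹) ^ (2 * (m + 1)) * q ^ 2 = (q⁻¹) ^ (2 * m) := by
      rw [mul_add, pow_add, mul_one, mul_assoc, ← mul_pow, inv_mul_cancel₀ hq, one_pow, mul_one]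
    rw [pow_succ (-1 : ℂ)]
    match_scalars
    · rw [← h4]
      field_simp
    · field_simp
    · ring
  rw [Finset.sum_congr rfl e, Finset.sum_add_distrib, ← Finset.sum_mul, ← Finset.sum_mul,
    Finset.sum_range_sub', h.t_zero, Nat.sub_self, h.t_self N (by omega),
    show N + 2 - 1 - (N + 1) = 0 by omega, h.u_self N (by omega)]
  set S := ∑ m ∈ Finset.range N, ((-1) ^ m * (μ * gam q μ m)) • u m (N - 1 - m)
  have key := gam_u_self hp (N := N) fun i hi => (hd i (by omega)).2
  rw [← key, add_mul, pow_succ (-1 : ℂ)]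
  simp only [smul_mul_assoc, neg_mul, smul_neg, smul_zero, neg_zero, zero_sub]
  module

lemma sum_Icc_one_succ {A : Type*} [AddCommMonoid A] (f : ℕ → A) (M : ℕ) :
    ∑ i ∈ Finset.Icc 1 (M + 1), f i = f 1 + ∑ i ∈ Finset.Icc 1 M, f (i + 1) := by
  have h : ∀ K, Finset.Icc 1 K = Finset.Ico 1 (K + 1) := fun K => by ext x; simp
  rw [h, h, Finset.sum_eq_sum_Ico_succ_bot (by omega), Finset.sum_Ico_add']

lemma kSum_eq (hp : BMWParam q μ) : ∀ N, AsymDef q μ N →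
    HookSystem q μ (N - 1) a p g t u →
    kSum q μ u N = (-1 : ℂ) ^ N • ∑ i ∈ Finset.Icc 1 (N / 2),
      (μ * q ^ ((N : ℤ) - 2 * i) - q ^ (1 - (N : ℤ) + 2 * i)) • (a (N - 2 * i) * g ^ i) := by
  intro N
  induction N using Nat.twoStepInduction with
  | zero => intro _ _; simp [kSum]
  | one => intro _ h; simp [kSum, h.u_zero]
  | more N ih _ =>
    intro hd h
    have hq := hp.q_ne
    rw [h.kSum_add_two hp (M := N + 1) hd le_rfl, ih (hd.mono (by omega)) (h.mono (by omega)),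
      add_mul, show (N + 2) / 2 = N / 2 + 1 by omega, sum_Icc_one_succ, smul_add,
      smul_mul_assoc ((-1 : ℂ) ^ N), Finset.sum_mul, add_comm,
      show (-1 : ℂ) ^ (N + 2) = (-1) ^ N by ring]
    congr 1
    · have h1 : ((N + 2 : ℕ) : ℤ) - 2 * ((1 : ℕ) : ℤ) = N := by push_cast; ring
      have h2 : 1 - ((N + 2 : ℕ) : ℤ) + 2 * ((1 : ℕ) : ℤ) = 1 + -N := by push_cast; ring
      rw [smul_mul_assoc, mul_smul, mul_one, pow_one, Nat.add_sub_cancel, h1, h2,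
        zpow_one_add₀ hq, zpow_neg, zpow_natCast, inv_pow]
    · congr 1
      refine Finset.sum_congr rfl fun i hi => ?_
      have h1 : ((N + 2 : ℕ) : ℤ) - 2 * ((i + 1 : ℕ) : ℤ) = N - 2 * i := by push_cast; ring
      have h2 : 1 - ((N + 2 : ℕ) : ℤ) + 2 * ((i + 1 : ℕ) : ℤ) = 1 - N + 2 * i := by
        push_cast; ring
      rw [smul_mul_assoc, mul_assoc, ← pow_succ, show N + 2 - 2 * (i + 1) = N - 2 * i by omega,
        h1, h2]

lemma newton (hp : BMWParam q μ) {N : ℕ} (hN : 1 ≤ N) (hd : AsymDef q μ N)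
    (h : HookSystem q μ N a p g t u) :
    ∑ m ∈ Finset.range N, (-q) ^ m • (a m * p (N - m - 1)) =
      ((-1) ^ (N - 1) * qnum q N) • a N + (-1 : ℂ) ^ N • ∑ i ∈ Finset.Icc 1 (N / 2),
        (μ * q ^ ((N : ℤ) - 2 * i) - q ^ (1 - (N : ℤ) + 2 * i)) • (a (N - 2 * i) * g ^ i) := by
  have h1 := h.telescope le_rfl
  change _ = _ + kSum q μ u N at h1
  rw [kSum_eq hp N hd (h.mono (by omega))] at h1
  obtain ⟨N, rfl⟩ : ∃ N', N = N' + 1 := ⟨N - 1, by omega⟩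
  rw [Nat.add_sub_cancel, show ((-1 : ℂ) ^ N * qnum q (N + 1)) =
    -((-1) ^ (N + 1) * qnum q (N + 1)) by ring, ← h1]
  refine Finset.sum_congr rfl fun m _ => ?_
  rw [Nat.add_sub_cancel, show N + 1 - m - 1 = N - m by omega]

end HookSystem

end HookSystem

/-! ### The hook system of a tower, and the height condition. -/

namespace BMWTower

variable {q μ : ℂ} {B : ℕ → Type} [∀ L, Ring (B L)] [∀ L, Algebra ℂ (B L)]
    {C : Type} [Ring C] [Algebra ℂ C] (𝒯 : BMWTower q μ B C)

/-- The hooks, normalised. -/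
def t : ℕ → ℕ → C
  | 0, _ => 0
  | m + 1, i => qnum q (m + 1) • 𝒯.hook m i

/-- The contracted hooks, normalised. -/
def u : ℕ → ℕ → C
  | 0, _ => 0
  | m + 1, i => qnum q (m + 1) • 𝒯.khook m i

/-- The factors `m_q` in `t` and `u` are those of `m_q a^{(m)}`, so the recursions are free of
`q`-number denominators, and setting level `0` to zero lets the case `m = 0` fit the general
pattern. -/
lemma hookSystem (hp : BMWParam q μ) {M : ℕ} (hd : AsymDef q μ M) :
    HookSystem q μ M 𝒯.a 𝒯.p 𝒯.g 𝒯.t 𝒯.u where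
  a_zero := 𝒯.a_zero
  t_zero _ := rfl
  u_zero _ := rfl
  t_self m _ := by
    cases m with
    | zero => simp [t, qnum]
    | succ m => rw [t, 𝒯.hook_self]
  t_succ m i hm := by
    cases m with
    | zero => simp [t, u, qnum_one hp.lam_ne, 𝒯.hook_zero, 𝒯.a_zero]
    | succ m =>
      have hq := (hd m (by omega)).1
      have h := 𝒯.ch_pre_desc hp (L := m + 1 + i + 1) (m := m) (i := i) (by omega)
        (hd.mono (by omega))
      rw [← 𝒯.qnum_smul_asym hp _ _ hq, smul_mul_assoc, map_smul] at h
      rw [t, hook, h, t, u, cCoeff_eq, smul_smul]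
  u_succ m i hm := by
    cases m with
    | zero => simp [t, u, qnum_one hp.lam_ne, 𝒯.khook_zero_succ hp, 𝒯.a_zero]
    | succ m =>
      have hq := (hd m (by omega)).1
      have h := 𝒯.ch_pre_desc_k hp (L := m + 1 + (i + 1) + 2) (m := m) (i := i) (by omega)
        (hd.mono (by omega))
      rw [← 𝒯.qnum_smul_asym hp _ _ hq, smul_mul_assoc, map_smul, ← mul_assoc,
        qnum_sub_cCoeff (hd m (by omega)).2] at h
      rw [u, khook, h, t, u, add_mul, sub_mul, smul_mul_assoc, smul_mul_assoc, smul_mul_assoc,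
        smul_mul_assoc, smul_smul]
  u_self m hm := by
    cases m with
    | zero => simp [u, 𝒯.khook_zero_zero hp, 𝒯.a_zero, qnum, div_self hp.lam_ne]
    | succ m =>
      have hq := (hd m (by omega)).1
      have h := 𝒯.ch_pre_k hp (L := m + 1 + 0 + 2) (m := m) (by omega) (hd.mono (by omega))
      rw [← 𝒯.qnum_smul_asym hp _ _ hq, smul_mul_assoc, map_smul, cCoeff_eq] at h
      rw [← h, u, khook, desc, mul_one]

/-- The hooks of height `k + 1` vanish with the numerator of the antisymmetrizer. -/
lemma hook_vanish (hp : BMWParam q μ) {k : ℕ} (hk : 1 ≤ k) (hd : AsymDef q μ k)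
    (h0 : 𝒯.asym (k + 1) k * sigmaMinus q μ ((q⁻¹) ^ (2 * k)) (𝒯.r (k + 1) (k - 1)) *
      𝒯.asym (k + 1) k = 0) (i : ℕ) :
    q ^ k • (𝒯.a k * 𝒯.p i) - 𝒯.t k (i + 1) - (μ * gam q μ k) • 𝒯.u k i = 0 := by
  obtain ⟨m, rfl⟩ : ∃ m, k = m + 1 := ⟨k - 1, by omega⟩
  -- The height condition lives on `k+1` strands; the inclusion of towers carries it to the strands
  -- occupied by a longer hook.
  have hpre : 𝒯.pre (m + i + 2) m = 0 := by
    have h1 : 𝒯.pre (m + 2) m = 0 := by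
      rw [pre, 𝒯.pre_factor hp, mul_smul_comm, smul_mul_assoc]
      rw [Nat.add_sub_cancel] at h0
      exact smul_eq_zero_of_right _ h0
    have hle : m + 2 ≤ m + i + 2 := by omega
    have h2 := congrArg (𝒯.incl hle) h1
    rw [map_zero, pre] at h2
    simp only [map_mul, map_sub, map_smul, map_one] at h2
    rw [𝒯.incl_asym hle (by omega), 𝒯.incl_k hle (by omega), 𝒯.incl_r hle m (by omega)] at h2
    exact h2
  have h := 𝒯.ch_pre_desc hp (L := m + i + 2) (m := m) (i := i) rfl hd
  rw [hpre, zero_mul, map_zero] at h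
  rw [h, t, u, cCoeff_eq, smul_smul]

end BMWTower

/-! ### Operators placed on a subset of the tensor factors. -/

section Embedding

variable {N w n : ℕ} {A : Type*} [Ring A]

/-- The operator `X` on `V^{⊗ w}` acting in the tensor factors `e 0, …, e (w - 1)` of
`V^{⊗ n}`. -/
def emb (e : Fin w → Fin n) (X : TensorOp N w A) : TensorOp N n A := fun a b =>
  open Classical in if ∀ l, l ∉ Set.range e → a l = b l then X (a ∘ e) (b ∘ e) else 0

lemma sum_extend {e : Fin w → Fin n} (he : Function.Injective e) (a : Fin n → Fin N)
    (f : (Fin n → Fin N) → A) (hf : ∀ c, ¬ (∀ l, l ∉ Set.range e → a l = c l) → f c = 0) :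
    ∑ c, f c = ∑ d : Fin w → Fin N, f (Function.extend e d a) := by
  symm
  refine Fintype.sum_of_injective (fun d => Function.extend e d a) ?_ _ _ ?_ fun _ => rfl
  · intro d d' h
    funext i
    have := congrFun h (e i)
    simpa only [he.extend_apply] using this
  · intro c hc
    refine hf c fun h => hc ⟨c ∘ e, ?_⟩
    funext l
    by_cases hl : l ∈ Set.range e
    · obtain ⟨i, rfl⟩ := hl
      simp only [he.extend_apply, Function.comp]
    · change Function.extend e (c ∘ e) a l = c l
      rw [Function.extend_apply' _ _ _ (by simpa using hl)]
      exact h l hl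

lemma extend_off {e : Fin w → Fin n} (d : Fin w → Fin N) (a : Fin n → Fin N) {l : Fin n}
    (hl : l ∉ Set.range e) : Function.extend e d a l = a l :=
  Function.extend_apply' d a l (by simpa using hl)

lemma extend_comp {e : Fin w → Fin n} (he : Function.Injective e) (d : Fin w → Fin N)
    (a : Fin n → Fin N) : Function.extend e d a ∘ e = d := by
  funext i; exact he.extend_apply _ _ _

lemma emb_mul_apply {e : Fin w → Fin n} (he : Function.Injective e) (X : TensorOp N w A)
    (Z : TensorOp N n A) (a b : Fin n → Fin N) :
    (emb e X * Z) a b = ∑ d, X (a ∘ e) d * Z (Function.extend e d a) b := by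
  rw [Matrix.mul_apply, sum_extend he a]
  · refine Finset.sum_congr rfl fun d _ => ?_
    rw [emb, if_pos fun l hl => (extend_off d a hl).symm, extend_comp he]
  · intro c hc
    rw [emb, if_neg hc, zero_mul]

lemma mul_emb_apply {e : Fin w → Fin n} (he : Function.Injective e) (X : TensorOp N w A)
    (Z : TensorOp N n A) (a b : Fin n → Fin N) :
    (Z * emb e X) a b = ∑ d, Z a (Function.extend e d b) * X d (b ∘ e) := by
  rw [Matrix.mul_apply, sum_extend he b]
  · refine Finset.sum_congr rfl fun d _ => ?_
    rw [emb, if_pos fun l hl => (extend_off d b hl), extend_comp he]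
  · intro c hc
    rw [emb, if_neg fun h => hc fun l hl => (h l hl).symm, mul_zero]

lemma emb_mul {e : Fin w → Fin n} (he : Function.Injective e) (X Y : TensorOp N w A) :
    emb e (X * Y) = emb e X * emb e Y := by
  ext a b
  rw [emb_mul_apply he]
  by_cases h : ∀ l, l ∉ Set.range e → a l = b l
  · rw [emb, if_pos h, Matrix.mul_apply]
    refine Finset.sum_congr rfl fun d _ => ?_
    rw [emb, if_pos fun l hl => by rw [extend_off d a hl, h l hl], extend_comp he]
  · rw [emb, if_neg h]
    symm
    refine Finset.sum_eq_zero fun d _ => ?_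
    rw [emb, if_neg, mul_zero]
    intro h'
    exact h fun l hl => by rw [← h' l hl, extend_off d a hl]

lemma emb_one {e : Fin w → Fin n} : emb e (1 : TensorOp N w A) = 1 := by
  ext a b
  rw [emb, Matrix.one_apply, Matrix.one_apply]
  by_cases h : a = b
  · subst h; simp
  · rw [if_neg h]
    split_ifs with h1 h2
    · exfalso
      apply h
      funext l
      by_cases hl : l ∈ Set.range e
      · obtain ⟨i, rfl⟩ := hl
        exact congrFun h2 i
      · exact h1 l hl
    · rfl
    · rfl

/-- `emb e` as a homomorphism of algebras. -/
def embHom [Algebra ℂ A] (e : Fin w → Fin n) (he : Function.Injective e) :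
    TensorOp N w A →ₐ[ℂ] TensorOp N n A :=
  AlgHom.ofLinearMap
    { toFun := emb e
      map_add' := fun X Y => by
        ext a b
        simp only [emb, Matrix.add_apply]
        split_ifs <;> simp
      map_smul' := fun c X => by
        ext a b
        simp only [emb, Matrix.smul_apply, RingHom.id_apply]
        split_ifs <;> simp } emb_one (emb_mul he)

lemma emb_emb {m : ℕ} {e : Fin w → Fin n} (he : Function.Injective e) (e' : Fin m → Fin w)
    (X : TensorOp N m A) : emb e (emb e' X) = emb (e ∘ e') X := by
  ext a b
  simp only [emb]
  by_cases h : ∀ l, l ∉ Set.range (e ∘ e') → a l = b l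
  · rw [if_pos h, if_pos, if_pos]
    · rfl
    · intro l hl
      exact h _ fun ⟨i, hi⟩ => hl ⟨i, he hi⟩
    · intro l hl
      exact h _ fun ⟨i, hi⟩ => hl ⟨e' i, hi⟩
  · rw [if_neg h]
    split_ifs with h1 h2
    · exfalso
      apply h
      intro l hl
      by_cases hl' : l ∈ Set.range e
      · obtain ⟨i, rfl⟩ := hl'
        exact h2 i fun ⟨j, hj⟩ => hl ⟨j, by simp [hj]⟩
      · exact h1 l hl'
    · rfl
    · rfl

/-- For disjoint sets of factors each matrix product collapses to a single term, the same on both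
sides up to the order of the entries. Commutation of the entries is assumed because the coefficient
ring is noncommutative. -/
lemma emb_commute {m : ℕ} {e : Fin w → Fin n} {e' : Fin m → Fin n} (he : Function.Injective e)
    (hd : ∀ i j, e i ≠ e' j) (X : TensorOp N w A)
    (Y : TensorOp N m A) (hXY : ∀ a b c d, Commute (X a b) (Y c d)) :
    Commute (emb e X) (emb e' Y) := by
  have off : ∀ j, e' j ∉ Set.range e := fun j ⟨i, hi⟩ => hd i j hi
  have off' : ∀ i, e i ∉ Set.range e' := fun i ⟨j, hj⟩ => hd i j hj.symm
  ext a b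
  rw [emb_mul_apply he, mul_emb_apply he]
  have hsum : ∀ d, Function.extend e d a ∘ e' = a ∘ e' := fun d => by
    funext j; exact extend_off d a (off j)
  have hsum' : ∀ d, Function.extend e d b ∘ e' = b ∘ e' := fun d => by
    funext j; exact extend_off d b (off j)
  have hl : ∀ d, d ≠ b ∘ e → emb e' Y (Function.extend e d a) b = 0 := by
    intro d hne
    rw [emb, if_neg]
    intro h
    apply hne
    funext i
    rw [Function.comp, ← h _ (off' i), he.extend_apply]
  have hr : ∀ d, d ≠ a ∘ e → emb e' Y a (Function.extend e d b) = 0 := by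
    intro d hne
    rw [emb, if_neg]
    intro h
    apply hne
    funext i
    rw [Function.comp, h _ (off' i), he.extend_apply]
  rw [Finset.sum_eq_single (b ∘ e) (fun d _ hne => by rw [hl d hne, mul_zero]) (by simp),
    Finset.sum_eq_single (a ∘ e) (fun d _ hne => by rw [hr d hne, zero_mul]) (by simp)]
  simp only [emb, hsum, hsum']
  have hiff : (∀ l, l ∉ Set.range e' → Function.extend e (b ∘ e) a l = b l) ↔
      (∀ l, l ∉ Set.range e' → a l = Function.extend e (a ∘ e) b l) := by
    constructor
    · intro h l hl
      by_cases hl' : l ∈ Set.range e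
      · obtain ⟨i, rfl⟩ := hl'
        rw [he.extend_apply]; rfl
      · rw [extend_off _ _ hl']
        have := h l hl
        rwa [extend_off _ _ hl'] at this
    · intro h l hl
      by_cases hl' : l ∈ Set.range e
      · obtain ⟨i, rfl⟩ := hl'
        rw [he.extend_apply]; rfl
      · rw [extend_off _ _ hl']
        have := h l hl
        rwa [extend_off _ _ hl'] at this
  by_cases h : ∀ l, l ∉ Set.range e' → Function.extend e (b ∘ e) a l = b l
  · rw [if_pos h, if_pos (hiff.1 h), (hXY _ _ _ _).eq]
  · rw [if_neg h, if_neg (fun h' => h (hiff.2 h')), mul_zero, zero_mul]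

/-- The consecutive tensor factors `s, …, s + w - 1`. -/
def block (s w n : ℕ) (h : s + w ≤ n) : Fin w → Fin n := fun i => ⟨s + i, by omega⟩

lemma block_injective {s : ℕ} (h : s + w ≤ n) : Function.Injective (block s w n h) := by
  intro i j hij
  have := congrArg Fin.val hij
  simp only [block] at this
  exact Fin.ext (by omega)

lemma notMem_range_block {s : ℕ} (h : s + w ≤ n) (l : Fin n) :
    l ∉ Set.range (block s w n h) ↔ (l : ℕ) < s ∨ s + w ≤ l := by
  constructor
  · intro hl
    by_contra hc
    push Not at hc
    exact hl ⟨⟨l - s, by omega⟩, Fin.ext (by simp only [block]; omega)⟩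
  · rintro hl ⟨i, rfl⟩
    simp only [block] at hl
    omega

lemma emb_block_block {s s' m : ℕ} (h : s + w ≤ n) (h' : s' + m ≤ w) (X : TensorOp N m A) :
    emb (block s w n h) (emb (block s' m w h') X) =
      emb (block (s + s') m n (by omega)) X := by
  rw [emb_emb (block_injective h)]
  congr 1
  funext i
  exact Fin.ext (by simp only [block, Function.comp]; omega)

lemma emb_block_self (X : TensorOp N n A) : emb (block 0 n n (by omega)) X = X := by
  have : block 0 n n (by omega) = id := by
    funext i; exact Fin.ext (by simp [block])
  ext a b
  rw [this, emb, if_pos]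
  · rfl
  · intro l hl; exact absurd ⟨l, rfl⟩ hl

lemma site_eq_emb {m : ℕ} (h : m + 2 ≤ n) (X : TwoSite N) :
    site n m X = emb (block m 2 n h) (site 2 0 X) := by
  ext a b
  have hm : m + 1 < n := h
  have hiff : (∀ l : Fin n, (l : ℕ) ≠ m → (l : ℕ) ≠ m + 1 → a l = b l) ↔
      (∀ l, l ∉ Set.range (block m 2 n h) → a l = b l) := by
    refine forall_congr' fun l => ?_
    rw [notMem_range_block]
    constructor
    · intro h1 h2; exact h1 (by omega) (by omega)
    · intro h1 h2 h3; exact h1 (by omega)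
  have h2 : ∀ l : Fin 2, (l : ℕ) ≠ 0 → (l : ℕ) ≠ 0 + 1 →
      (a ∘ block m 2 n h) l = (b ∘ block m 2 n h) l := by
    intro l h1 h2; omega
  rw [emb]
  simp only [site]
  rw [dif_pos hm, dif_pos (by omega), if_pos h2]
  by_cases hc : ∀ l : Fin n, (l : ℕ) ≠ m → (l : ℕ) ≠ m + 1 → a l = b l
  · rw [if_pos hc, if_pos (hiff.1 hc)]
    rfl
  · rw [if_neg hc, if_neg fun h' => hc (hiff.2 h')]

/-- The convention for positions out of range: statements about all sites still hold there,
trivially. -/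
lemma site_of_le {m : ℕ} (h : ¬ m + 2 ≤ n) (X : TwoSite N) : site n m X = 0 := by
  ext a b
  simp only [site]
  rw [dif_neg (by omega)]
  rfl

/-- `site 2 0` as a homomorphism of algebras. -/
def twoSiteHom (N : ℕ) : TwoSite N →ₐ[ℂ] TensorOp N 2 ℂ :=
  (Matrix.reindexAlgEquiv ℂ ℂ (finTwoArrowEquiv (Fin N)).symm).toAlgHom

lemma twoSiteHom_apply (X : TwoSite N) : twoSiteHom N X = site 2 0 X := by
  ext a b
  simp only [site]
  rw [dif_pos (by omega), if_pos (by intro l h1 h2; omega)]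
  rfl

/-- `site n m` as a homomorphism of algebras. -/
def siteHom (N : ℕ) {n m : ℕ} (h : m + 2 ≤ n) : TwoSite N →ₐ[ℂ] TensorOp N n ℂ :=
  (embHom (block m 2 n h) (block_injective h)).comp (twoSiteHom N)

lemma siteHom_apply {m : ℕ} (h : m + 2 ≤ n) (X : TwoSite N) : siteHom N h X = site n m X := by
  rw [site_eq_emb h, ← twoSiteHom_apply]
  rfl

lemma emb_site {s m : ℕ} (h : s + w ≤ n) (hm : m + 2 ≤ w) (X : TwoSite N) :
    emb (block s w n h) (site w m X) = site n (s + m) X := by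
  rw [site_eq_emb hm, emb_block_block, site_eq_emb (show s + m + 2 ≤ n by omega)]

lemma site_commute {i j : ℕ} (h : i + 2 ≤ j) (X Y : TwoSite N) :
    Commute (site n i X) (site n j Y) := by
  by_cases hj : j + 2 ≤ n
  · rw [site_eq_emb (show i + 2 ≤ n by omega), site_eq_emb hj]
    refine emb_commute (block_injective _) ?_ _ _
      fun _ _ _ _ => Commute.all _ _
    intro a b hab
    have := congrArg Fin.val hab
    simp only [block] at this
    omega
  · rw [site_of_le hj]
    exact Commute.zero_right _

lemma firstSite_eq_emb (h : 0 + 1 ≤ n) (M : Matrix (Fin N) (Fin N) A) :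
    firstSite n M = emb (block 0 1 n h) (firstSite 1 M) := by
  ext a b
  have hiff : (∀ l : Fin n, (l : ℕ) ≠ 0 → a l = b l) ↔
      (∀ l, l ∉ Set.range (block 0 1 n h) → a l = b l) := by
    refine forall_congr' fun l => ?_
    rw [notMem_range_block]
    constructor
    · intro h1 h2; exact h1 (by omega)
    · intro h1 h2; exact h1 (by omega)
  have h2 : ∀ l : Fin 1, (l : ℕ) ≠ 0 → (a ∘ block 0 1 n h) l = (b ∘ block 0 1 n h) l := by
    intro l hl; omega
  rw [emb]
  simp only [firstSite]
  rw [dif_pos (show 0 < n by omega), dif_pos (by omega), if_pos h2]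
  by_cases hc : ∀ l : Fin n, (l : ℕ) ≠ 0 → a l = b l
  · rw [if_pos hc, if_pos (hiff.1 hc)]
    rfl
  · rw [if_neg hc, if_neg fun h' => hc (hiff.2 h')]

lemma emb_firstSite {m : ℕ} (h : 0 + m ≤ n) (hm : 0 + 1 ≤ m) (M : Matrix (Fin N) (Fin N) A) :
    emb (block 0 m n h) (firstSite m M) = firstSite n M := by
  rw [firstSite_eq_emb hm, emb_block_block, firstSite_eq_emb (show 0 + 1 ≤ n by omega)]

end Embedding

section Scal

variable {N n w : ℕ} {A : Type*} [Ring A] [Algebra ℂ A]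

/-- `scal` as a homomorphism of algebras. -/
def scalHom (A : Type*) [Ring A] [Algebra ℂ A] (N n : ℕ) : TensorOp N n ℂ →ₐ[ℂ] TensorOp N n A :=
  (Algebra.ofId ℂ A).mapMatrix

lemma scalHom_apply (X : TensorOp N n ℂ) : scalHom A N n X = scal A X := rfl

lemma scal_mul (X Y : TensorOp N n ℂ) : scal A (X * Y) = scal A X * scal A Y :=
  map_mul (scalHom A N n) X Y

lemma scal_one : scal A (1 : TensorOp N n ℂ) = 1 := map_one (scalHom A N n)

lemma emb_scal (e : Fin w → Fin n) (X : TensorOp N w ℂ) :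
    emb e (scal A X) = scal A (emb e X) := by
  ext a b
  simp only [emb, scal, Matrix.map_apply]
  split_ifs <;> simp

lemma scal_firstSite_commute {m : ℕ} (hm : 1 ≤ m) (X : TwoSite N) (M : Matrix (Fin N) (Fin N) A) :
    Commute (scal A (site n m X)) (firstSite n M) := by
  by_cases h : m + 2 ≤ n
  · rw [site_eq_emb h, ← emb_scal, firstSite_eq_emb (show 0 + 1 ≤ n by omega)]
    refine emb_commute (block_injective _) ?_ _ _
      fun _ _ _ _ => Algebra.commutes _ _
    intro a b hab
    have := congrArg Fin.val hab
    simp only [block] at this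
    omega
  · rw [site_of_le h, ← scalHom_apply, map_zero]
    exact Commute.zero_left _

end Scal

/-! ### Braid operators and the copies of `M`. -/

section Copies

variable {N n : ℕ} {A : Type*} [Ring A] [Algebra ℂ A]

lemma scal_site_mul {m : ℕ} (h : m + 2 ≤ n) (X Y : TwoSite N) :
    scal A (site n m X) * scal A (site n m Y) = scal A (site n m (X * Y)) := by
  rw [← scal_mul, ← siteHom_apply h, ← siteHom_apply h, ← siteHom_apply h, map_mul]

lemma scal_site_one {m : ℕ} (h : m + 2 ≤ n) : scal A (site n m (1 : TwoSite N)) = 1 := by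
  rw [← siteHom_apply h, map_one, scal_one]

lemma site_mul_inv {F : TwoSite N} (hF : IsUnit F) {m : ℕ} (h : m + 2 ≤ n) :
    scal A (site n m F) * scal A (site n m F⁻¹) = 1 := by
  rw [scal_site_mul h, Matrix.mul_nonsing_inv F ((Matrix.isUnit_iff_isUnit_det F).1 hF),
    scal_site_one h]

lemma site_inv_mul {F : TwoSite N} (hF : IsUnit F) {m : ℕ} (h : m + 2 ≤ n) :
    scal A (site n m F⁻¹) * scal A (site n m F) = 1 := by
  rw [scal_site_mul h, Matrix.nonsing_inv_mul F ((Matrix.isUnit_iff_isUnit_det F).1 hF),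
    scal_site_one h]

/-- Relations between operators on three adjacent factors hold wherever they are placed. -/
lemma site_three {i : ℕ} (h : i + 3 ≤ n) {X Y Z X' Y' Z' : TwoSite N} {a b c a' b' c' : ℕ}
    (ha : a < 2) (hb : b < 2) (hc : c < 2) (ha' : a' < 2) (hb' : b' < 2) (hc' : c' < 2)
    (hrel : site 3 a X * site 3 b Y * site 3 c Z = site 3 a' X' * site 3 b' Y' * site 3 c' Z') :
    site n (i + a) X * site n (i + b) Y * site n (i + c) Z =
      site n (i + a') X' * site n (i + b') Y' * site n (i + c') Z' := by
  have := congrArg (emb (block i 3 n h)) hrel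
  rw [emb_mul (block_injective h), emb_mul (block_injective h), emb_mul (block_injective h),
    emb_mul (block_injective h)] at this
  rwa [emb_site h (by omega), emb_site h (by omega), emb_site h (by omega), emb_site h (by omega),
    emb_site h (by omega), emb_site h (by omega)] at this

lemma scal_site_commute {i j : ℕ} (h : i + 2 ≤ j) (X Y : TwoSite N) :
    Commute (scal A (site n i X)) (scal A (site n j Y)) := by
  have := (site_commute (n := n) h X Y).map (scalHom A N n)
  exact this

/-- Conjugation: `x u = u y` implies `y u' = u' x` for a two-sided inverse `u'` of `u`. -/
lemma intertwine_inv {B : Type*} [Ring B] {x y u u' : B} (h1 : u * u' = 1) (h2 : u' * u = 1)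
    (h : x * u = u * y) : y * u' = u' * x := by
  calc y * u' = u' * (u * y) * u' := by rw [← mul_assoc, h2, one_mul]
    _ = u' * x * (u * u') := by rw [← h]; noncomm_ring
    _ = u' * x := by rw [h1, mul_one]

variable (F : TwoSite N) (M : Matrix (Fin N) (Fin N) A)

lemma site_commute_copy_of_lt {i j : ℕ} (h : i < j) (X : TwoSite N) :
    Commute (scal A (site n j X)) (copy F M n i) := by
  induction i with
  | zero => exact scal_firstSite_commute h X M
  | succ i ih =>
    exact ((scal_site_commute (by omega) F X).symm.mul_right (ih (by omega))).mul_right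
      (scal_site_commute (by omega) F⁻¹ X).symm

variable {F}

/-- The copy number `j+2` is the copy number `j` conjugated by `F_{j+1} F_j`, which turns `X_j` into
`X_{j+1}`, and `X_{j+1}` acts on factors that the copy `j` does not touch. Used with `X = F` and
with `X = R`. -/
lemma site_commute_copy_of_gt (hF : IsUnit F) {X : TwoSite N}
    (hX : site 3 0 X * site 3 1 F * site 3 0 F = site 3 1 F * site 3 0 F * site 3 1 X)
    {i j : ℕ} (h : j + 2 ≤ i) (hi : i < n) :
    Commute (scal A (site n j X)) (copy F M n i) := by
  induction i, h using Nat.le_induction with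
  | base =>
    have h3 := congrArg (scal A) (site_three (n := n) (i := j) (by omega) (by omega) (by omega)
      (by omega) (by omega) (by omega) (by omega) hX)
    simp only [scal_mul, add_zero] at h3
    have hinv : scal A (site n (j + 1) X) * (scal A (site n j F⁻¹) * scal A (site n (j + 1) F⁻¹)) =
        scal A (site n j F⁻¹) * scal A (site n (j + 1) F⁻¹) * scal A (site n j X) := by
      refine intertwine_inv (u := scal A (site n (j + 1) F) * scal A (site n j F)) ?_ ?_ ?_
      · rw [mul_assoc, ← mul_assoc _ (scal A (site n j F⁻¹)), site_mul_inv hF (by omega), one_mul,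
          site_mul_inv hF (by omega)]
      · rw [mul_assoc, ← mul_assoc _ (scal A (site n (j + 1) F)), site_inv_mul hF (by omega),
          one_mul, site_inv_mul hF (by omega)]
      · rw [← mul_assoc, h3]
    have hc := site_commute_copy_of_lt F M (n := n) (show j < j + 1 by omega) X
    simp only [copy]
    rw [Commute, SemiconjBy]
    calc _ = (scal A (site n j X) * scal A (site n (j + 1) F) * scal A (site n j F)) *
          copy F M n j * (scal A (site n j F⁻¹) * scal A (site n (j + 1) F⁻¹)) := by noncomm_ring
      _ = scal A (site n (j + 1) F) * scal A (site n j F) *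
          (scal A (site n (j + 1) X) * copy F M n j) *
            (scal A (site n j F⁻¹) * scal A (site n (j + 1) F⁻¹)) := by rw [h3]; noncomm_ring
      _ = scal A (site n (j + 1) F) * scal A (site n j F) * copy F M n j *
            (scal A (site n (j + 1) X) * (scal A (site n j F⁻¹) * scal A (site n (j + 1) F⁻¹))) := by
          rw [hc.eq]; noncomm_ring
      _ = _ := by rw [hinv]; noncomm_ring
  | succ i hi' ih =>
    exact ((scal_site_commute (by omega) X F).mul_right (ih (by omega))).mul_right
      (scal_site_commute (by omega) X F⁻¹)

lemma copy_succ_mul_site (hF : IsUnit F) {i : ℕ} (h : i + 2 ≤ n) :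
    copy F M n (i + 1) * scal A (site n i F) = scal A (site n i F) * copy F M n i := by
  rw [copy, mul_assoc, site_inv_mul hF h, mul_one]

lemma copy_pair_succ (hF : IsRMatrix F) {j : ℕ} (h : j + 3 ≤ n) :
    copy F M n (j + 1) * copy F M n (j + 2) * (scal A (site n j F) * scal A (site n (j + 1) F)) =
      scal A (site n j F) * scal A (site n (j + 1) F) * (copy F M n j * copy F M n (j + 1)) := by
  have h1 := site_commute_copy_of_gt M (n := n) hF.1 hF.2 (le_refl (j + 2)) (by omega)
  have h2 := site_commute_copy_of_lt F M (n := n) (show j < j + 1 by omega) F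
  calc _ = copy F M n (j + 1) * (copy F M n (j + 2) * scal A (site n j F)) *
        scal A (site n (j + 1) F) := by noncomm_ring
    _ = copy F M n (j + 1) * scal A (site n j F) *
        (copy F M n (j + 2) * scal A (site n (j + 1) F)) := by rw [← h1.eq]; noncomm_ring
    _ = scal A (site n j F) * (copy F M n j * scal A (site n (j + 1) F)) *
        copy F M n (j + 1) := by
      rw [copy_succ_mul_site M hF.1 (by omega), copy_succ_mul_site M hF.1 (by omega)]
      noncomm_ring
    _ = _ := by rw [← h2.eq]; noncomm_ring

lemma emb_copy {w i : ℕ} (h : 0 + w ≤ n) (hi : i < w) :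
    emb (block 0 w n h) (copy F M w i) = copy F M n i := by
  induction i with
  | zero => exact emb_firstSite h (by omega) M
  | succ i ih =>
    rw [copy, emb_mul (block_injective h), emb_mul (block_injective h), ih (by omega), emb_scal,
      emb_scal, emb_site h (by omega), emb_site h (by omega), zero_add]
    rfl

lemma copyProd_two : copyProd F M 2 = copy F M 2 0 * copy F M 2 1 := by
  simp [copyProd, List.range_succ]

/-- `R_j` commutes with `M_{\bar j} M_{\overline{j+1}}`. -/
lemma site_commute_copy_pair {R : TwoSite N} (hRF : IsCompatiblePair R F)
    (hM : Commute (scal A (site 2 0 R)) (copyProd F M 2)) {j : ℕ} (h : j + 2 ≤ n) :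
    Commute (scal A (site n j R)) (copy F M n j * copy F M n (j + 1)) := by
  induction j with
  | zero =>
    have := hM.map (embHom (block 0 2 n h) (block_injective h))
    change Commute (emb _ _) (emb _ _) at this
    rwa [copyProd_two, emb_mul (block_injective h), emb_copy M h (by omega),
      emb_copy M h (by omega), emb_scal, emb_site h (by omega)] at this
  | succ j ih =>
    obtain ⟨hR, hF, -, h2⟩ := hRF
    have h3 := congrArg (scal A) (site_three (n := n) (i := j) (by omega) (by omega) (by omega)
      (by omega) (by omega) (by omega) (by omega) h2)
    simp only [scal_mul, add_zero] at h3
    have h4 := copy_pair_succ M (n := n) hF (j := j) (by omega)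
    -- Conjugation by `F_j F_{j+1}` shifts both `R_j` and the pair of copies by one strand, so it
    -- carries the relation to the next pair.
    set u := scal A (site n j F) * scal A (site n (j + 1) F) with hu
    have huu : u * (scal A (site n (j + 1) F⁻¹) * scal A (site n j F⁻¹)) = 1 := by
      rw [hu, mul_assoc, ← mul_assoc _ (scal A (site n (j + 1) F⁻¹)),
        site_mul_inv hF.1 (by omega), one_mul, site_mul_inv hF.1 (by omega)]
    have ih := (ih (by omega)).eq
    have key : scal A (site n (j + 1) R) * (copy F M n (j + 1) * copy F M n (j + 2)) * u =
        (copy F M n (j + 1) * copy F M n (j + 2)) * scal A (site n (j + 1) R) * u := by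
      have h3' : scal A (site n (j + 1) R) * u = u * scal A (site n j R) := by
        rw [hu, ← mul_assoc, h3]
      calc _ = (scal A (site n (j + 1) R) * u) * (copy F M n j * copy F M n (j + 1)) := by
            rw [mul_assoc, h4]; noncomm_ring
        _ = (u * (copy F M n j * copy F M n (j + 1))) * scal A (site n j R) := by
            rw [h3', mul_assoc, ih]; noncomm_ring
        _ = _ := by rw [← h4, mul_assoc, ← h3']; noncomm_ring
    have := congrArg (· * (scal A (site n (j + 1) F⁻¹) * scal A (site n j F⁻¹))) key
    rwa [mul_assoc, huu, mul_one, mul_assoc, huu, mul_one] at this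

/-- The product of the first `m` copies. -/
lemma range_prod_succ {B : Type*} [Monoid B] (f : ℕ → B) (m : ℕ) :
    ((List.range (m + 1)).map f).prod = ((List.range m).map f).prod * f m := by
  simp [List.range_succ]

lemma site_commute_copyProd {R : TwoSite N} (hRF : IsCompatiblePair R F)
    (hM : Commute (scal A (site 2 0 R)) (copyProd F M 2)) (j : ℕ) :
    Commute (scal A (site n j R)) (copyProd F M n) := by
  by_cases h : j + 2 ≤ n
  · have h0 : ∀ m ≤ j, Commute (scal A (site n j R)) ((List.range m).map (copy F M n)).prod := by
      intro m hm
      induction m with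
      | zero => simp
      | succ m ih =>
        rw [range_prod_succ]
        exact (ih (by omega)).mul_right (site_commute_copy_of_lt F M (by omega) R)
    have h1 : ∀ m, j + 2 ≤ m → m ≤ n →
        Commute (scal A (site n j R)) ((List.range m).map (copy F M n)).prod := by
      intro m hm
      induction m, hm using Nat.le_induction with
      | base =>
        intro _
        rw [range_prod_succ, range_prod_succ, mul_assoc]
        exact (h0 j le_rfl).mul_right (site_commute_copy_pair M hRF hM h)
      | succ m hm ih =>
        intro hn
        rw [range_prod_succ]
        exact (ih (by omega)).mul_right
          (site_commute_copy_of_gt M hRF.2.1.1 hRF.2.2.1 hm (by omega))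
    exact h1 n h le_rfl
  · rw [site_of_le h, ← scalHom_apply, map_zero]
    exact Commute.zero_left _

end Copies

/-! ### The weighted partial trace. -/

section PartialTrace

variable {N n : ℕ} {A : Type*} [Ring A]

/-- `V^{⊗ n}` acting as the first factors of `V^{⊗ (n+1)}`. -/
def padLast (Y : TensorOp N n A) : TensorOp N (n + 1) A :=
  emb (block 0 n (n + 1) (by omega)) Y

lemma snoc_comp_block (a : Fin n → Fin N) (d : Fin N) :
    Fin.snoc (α := fun _ => Fin N) a d ∘ block 0 n (n + 1) (by omega) = a := by
  funext i
  have : block 0 n (n + 1) (by omega) i = i.castSucc := Fin.ext (by simp [block])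
  rw [Function.comp, this, Fin.snoc_castSucc]

lemma padLast_snoc (a e : Fin n → Fin N) (d : Fin N) :
    Function.extend (block 0 n (n + 1) (by omega)) e (Fin.snoc (α := fun _ => Fin N) a d) =
      Fin.snoc (α := fun _ => Fin N) e d := by
  funext l
  refine Fin.lastCases ?_ (fun i => ?_) l
  · rw [extend_off _ _ ((notMem_range_block _ _).2 (Or.inr (by simp))), Fin.snoc_last,
      Fin.snoc_last]
  · have : i.castSucc = block 0 n (n + 1) (by omega) i := Fin.ext (by simp [block])
    rw [this, (block_injective _).extend_apply, ← this, Fin.snoc_castSucc]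

lemma padLast_apply (Y : TensorOp N n A) (a b : Fin n → Fin N) (d c : Fin N) :
    padLast Y (Fin.snoc (α := fun _ => Fin N) a d) (Fin.snoc (α := fun _ => Fin N) b c) =
      if d = c then Y a b else 0 := by
  rw [padLast, emb, snoc_comp_block, snoc_comp_block]
  refine if_congr ?_ rfl rfl
  constructor
  · intro h
    have := h (Fin.last n) ((notMem_range_block _ _).2 (Or.inr (by simp)))
    simpa using this
  · rintro rfl l hl
    refine Fin.lastCases (fun _ => by simp) (fun i hi => ?_) l hl
    rw [notMem_range_block] at hi
    simp at hi
    omega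

lemma padLast_mul (X Y : TensorOp N n A) : padLast (X * Y) = padLast X * padLast Y :=
  emb_mul (block_injective _) X Y

lemma padLast_one : padLast (1 : TensorOp N n A) = 1 := emb_one

variable [Algebra ℂ A]

/-- The partial trace over the last factor, weighted by `D`. -/
def ptr (D : Matrix (Fin N) (Fin N) ℂ) (Y : TensorOp N (n + 1) A) : TensorOp N n A :=
  fun a b => ∑ c, ∑ d, D c d • Y (Fin.snoc (α := fun _ => Fin N) a d)
    (Fin.snoc (α := fun _ => Fin N) b c)

variable (D : Matrix (Fin N) (Fin N) ℂ)

lemma ptr_padLast_mul (X : TensorOp N n A) (Y : TensorOp N (n + 1) A) :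
    ptr D (padLast X * Y) = X * ptr D Y := by
  ext a b
  rw [Matrix.mul_apply]
  simp only [ptr, padLast, emb_mul_apply (block_injective _), snoc_comp_block, padLast_snoc,
    Finset.smul_sum, Finset.mul_sum, mul_smul_comm]
  rw [Finset.sum_congr rfl fun c _ => Finset.sum_comm, Finset.sum_comm]

lemma ptr_mul_padLast (X : TensorOp N n A) (Y : TensorOp N (n + 1) A) :
    ptr D (Y * padLast X) = ptr D Y * X := by
  ext a b
  rw [Matrix.mul_apply]
  simp only [ptr, padLast, mul_emb_apply (block_injective _), snoc_comp_block, padLast_snoc,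
    Finset.smul_sum, Finset.sum_mul, smul_mul_assoc]
  rw [Finset.sum_congr rfl fun c _ => Finset.sum_comm, Finset.sum_comm]

lemma padLast_scal (X : TensorOp N n ℂ) : padLast (scal A X) = scal A (padLast X) := emb_scal _ X

lemma padLast_site {m : ℕ} (h : m + 2 ≤ n) (X : TwoSite N) :
    padLast (site n m X) = site (n + 1) m X := by
  rw [padLast, emb_site _ h, zero_add]

lemma ptr_one : ptr D (1 : TensorOp N (n + 1) A) = D.trace • 1 := by
  ext a b
  rw [← padLast_one]
  simp only [ptr, padLast_apply, Matrix.smul_apply, Matrix.trace, Matrix.diag, smul_ite, smul_zero,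
    Finset.sum_ite_eq', Finset.mem_univ, if_true, Finset.sum_smul]

lemma sum_snoc {β : Type*} [AddCommMonoid β] (f : (Fin (n + 1) → Fin N) → β) :
    ∑ a, f a = ∑ a : Fin n → Fin N, ∑ d, f (Fin.snoc (α := fun _ => Fin N) a d) := by
  rw [← (Fin.snocEquiv (fun _ : Fin (n + 1) => Fin N)).sum_comp, Fintype.sum_prod_type,
    Finset.sum_comm]
  rfl

lemma fullTrace_ptr (Y : TensorOp N (n + 1) A) : fullTrace D (ptr D Y) = fullTrace D Y := by
  simp only [fullTrace, ptr]
  rw [sum_snoc]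
  refine Finset.sum_congr rfl fun a _ => ?_
  simp only [sum_snoc (n := n)]
  rw [Finset.sum_comm]
  refine Finset.sum_congr rfl fun b _ => ?_
  rw [Finset.smul_sum]
  refine Finset.sum_congr rfl fun c _ => ?_
  rw [Finset.smul_sum]
  refine Finset.sum_congr rfl fun d _ => ?_
  rw [Fin.prod_univ_castSucc]
  simp only [Fin.snoc_castSucc, Fin.snoc_last, smul_smul]

lemma site_last_apply (X : TwoSite N) (a b : Fin n → Fin N) (i d k c : Fin N) :
    site (n + 2) n X
      (Fin.snoc (α := fun _ => Fin N) (Fin.snoc (α := fun _ => Fin N) a i) d)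
      (Fin.snoc (α := fun _ => Fin N) (Fin.snoc (α := fun _ => Fin N) b k) c) =
      if a = b then X (i, d) (k, c) else 0 := by
  have e1 : (⟨n, by omega⟩ : Fin (n + 2)) = (Fin.last n).castSucc := Fin.ext (by simp)
  have e2 : (⟨n + 1, by omega⟩ : Fin (n + 2)) = Fin.last (n + 1) := Fin.ext (by simp)
  simp only [site]
  rw [dif_pos (by omega), e1, e2]
  simp only [Fin.snoc_castSucc, Fin.snoc_last]
  refine if_congr ?_ rfl rfl
  constructor
  · intro h
    funext l
    have := h l.castSucc.castSucc (by simp; omega) (by simp; omega)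
    simpa using this
  · rintro rfl l h1 h2
    obtain ⟨j, rfl⟩ : ∃ j : Fin n, l = j.castSucc.castSucc :=
      ⟨⟨l, by omega⟩, Fin.ext (by simp)⟩
    simp

/-- The operator `Tr₍₂₎ D₂ F₁₂ X₁ F₁₂⁻¹` in terms of the entries of `X`. -/
def conjTrace (F F' : TwoSite N) (i k i' k' : Fin N) : ℂ :=
  ∑ c, ∑ d, ∑ d', D c d * F (i, d) (i', d') * F' (k', d') (k, c)

lemma ptr_conj_apply (F F' : TwoSite N) (Y : TensorOp N (n + 1) A) (a b : Fin n → Fin N)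
    (i k : Fin N) :
    ptr D (scal A (site (n + 2) n F) * padLast Y * scal A (site (n + 2) n F'))
      (Fin.snoc (α := fun _ => Fin N) a i) (Fin.snoc (α := fun _ => Fin N) b k) =
    ∑ i', ∑ k', conjTrace D F F' i k i' k' • Y (Fin.snoc (α := fun _ => Fin N) a i')
      (Fin.snoc (α := fun _ => Fin N) b k') := by
  have h1 : ∀ c d, (scal A (site (n + 2) n F) * padLast Y * scal A (site (n + 2) n F'))
      (Fin.snoc (α := fun _ => Fin N) (Fin.snoc (α := fun _ => Fin N) a i) d)
      (Fin.snoc (α := fun _ => Fin N) (Fin.snoc (α := fun _ => Fin N) b k) c) =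
      ∑ i', ∑ k', ∑ d', (F (i, d) (i', d') * F' (k', d') (k, c)) •
        Y (Fin.snoc (α := fun _ => Fin N) a i') (Fin.snoc (α := fun _ => Fin N) b k') := by
    intro c d
    rw [Matrix.mul_apply]
    simp only [sum_snoc (n := n + 1), sum_snoc (n := n), Matrix.mul_apply, scal, Matrix.map_apply,
      site_last_apply, padLast_apply]
    simp only [apply_ite (algebraMap ℂ A), map_zero, ite_mul, zero_mul, mul_ite, mul_zero,
      Finset.sum_ite_irrel, Finset.sum_ite_eq, Finset.sum_ite_eq', Finset.mem_univ, if_true,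
      Finset.sum_const_zero]
    simp only [Finset.sum_mul]
    rw [Finset.sum_congr rfl fun x _ => Finset.sum_comm, Finset.sum_comm]
    refine Finset.sum_congr rfl fun i' _ => Finset.sum_congr rfl fun k' _ =>
      Finset.sum_congr rfl fun d' _ => ?_
    rw [mul_assoc, ← Algebra.commutes, ← mul_assoc, ← map_mul, ← Algebra.smul_def]
  simp only [ptr, h1, conjTrace]
  simp only [Finset.smul_sum, Finset.sum_smul, smul_smul, ← mul_assoc]
  rw [Finset.sum_congr rfl fun c _ => Finset.sum_comm, Finset.sum_comm]
  refine Finset.sum_congr rfl fun i' _ => ?_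
  rw [Finset.sum_congr rfl fun c _ => Finset.sum_comm, Finset.sum_comm]

lemma ptr_conj {F F' : TwoSite N}
    (h : ∀ i k i' k', conjTrace D F F' i k i' k' = if i = k then D k' i' else 0)
    (Y : TensorOp N (n + 1) A) :
    ptr D (scal A (site (n + 2) n F) * padLast Y * scal A (site (n + 2) n F')) =
      padLast (ptr D Y) := by
  ext a b
  rw [← Fin.snoc_init_self a, ← Fin.snoc_init_self b, ptr_conj_apply, padLast_apply]
  simp only [h, ptr]
  split_ifs
  · rw [Finset.sum_comm]
  · simp

variable {R Ψ F : TwoSite N}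

lemma ptr_site_last (hΨ : IsSkewInverse R Ψ) : ptr (dMatrix Ψ) (site (n + 2) n R) = 1 := by
  ext a b
  rw [← Fin.snoc_init_self a, ← Fin.snoc_init_self b]
  simp only [ptr, site_last_apply, Matrix.one_apply]
  have key : ∀ i k, ∑ c, ∑ d, dMatrix Ψ c d * R (i, d) (k, c) = if i = k then 1 else 0 := by
    intro i k
    have := Finset.sum_congr (s₁ := Finset.univ) rfl fun x _ => hΨ.1 i x k x
    simp only [dMatrix, Finset.sum_mul]
    rw [Finset.sum_congr rfl fun c _ => Finset.sum_comm, Finset.sum_comm]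
    rw [Finset.sum_congr rfl fun x _ => Finset.sum_comm] at this
    simp only [mul_comm (Ψ _ _)]
    rw [this]
    by_cases h : i = k
    · subst h
      simp [Finset.sum_ite_eq, eq_comm]
    · rw [if_neg h]
      refine Finset.sum_eq_zero fun x _ => if_neg ?_
      rintro ⟨rfl, rfl⟩
      exact h rfl
  simp only [smul_eq_mul, mul_ite, mul_zero, Finset.sum_ite_irrel, Finset.sum_const_zero, key]
  rw [← ite_and]
  refine if_congr ?_ rfl rfl
  constructor
  · rintro ⟨h1, h2⟩; rw [h1, h2]
  · intro h
    have := (Fin.snoc_inj (α := fun _ => Fin N)).1 h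
    exact this

/-- By compatibility `F₂ R₁ F₂⁻¹ = F₁⁻¹ R₂ F₁`, and the weighted trace of the right side over the
last factor is `1` because `Tr₍₂₎ D₂ R₁₂ = 1`. So the unknown tensor is known after contraction with
`R`, and the skew inverse of `R` removes this contraction. -/
lemma conjTrace_eq (hΨ : IsSkewInverse R Ψ) (hF : IsUnit F)
    (h2 : site 3 1 R * site 3 0 F * site 3 1 F = site 3 0 F * site 3 1 F * site 3 0 R)
    (i k i' k' : Fin N) :
    conjTrace (dMatrix Ψ) F F⁻¹ i k i' k' = if i = k then dMatrix Ψ k' i' else 0 := by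
  have hinv : ∀ m, m + 2 ≤ 3 → site 3 m F * site 3 m F⁻¹ = 1 := fun m h => by
    rw [← siteHom_apply h, ← siteHom_apply h, ← map_mul,
      Matrix.mul_nonsing_inv F ((Matrix.isUnit_iff_isUnit_det F).1 hF), map_one]
  have hinv' : ∀ m, m + 2 ≤ 3 → site 3 m F⁻¹ * site 3 m F = 1 := fun m h => by
    rw [← siteHom_apply h, ← siteHom_apply h, ← map_mul,
      Matrix.nonsing_inv_mul F ((Matrix.isUnit_iff_isUnit_det F).1 hF), map_one]
  have h3 : site 3 1 F * site 3 0 R * site 3 1 F⁻¹ =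
      padLast (site 2 0 F⁻¹) * site 3 1 R * padLast (site 2 0 F) := by
    rw [padLast_site le_rfl, padLast_site le_rfl]
    calc _ = (site 3 0 F⁻¹ * site 3 0 F) * site 3 1 F * site 3 0 R * site 3 1 F⁻¹ := by
          rw [hinv' 0 (by omega), one_mul]
      _ = site 3 0 F⁻¹ * (site 3 0 F * site 3 1 F * site 3 0 R) * site 3 1 F⁻¹ := by
          noncomm_ring
      _ = site 3 0 F⁻¹ * site 3 1 R * site 3 0 F * (site 3 1 F * site 3 1 F⁻¹) := by
          rw [← h2]; noncomm_ring
      _ = _ := by rw [hinv 1 (by omega), mul_one]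
  have h4 : ptr (dMatrix Ψ) (site 3 1 F * padLast (site 2 0 R) * site 3 1 F⁻¹) = 1 := by
    rw [padLast_site le_rfl, h3, ptr_mul_padLast, ptr_padLast_mul, ptr_site_last hΨ, mul_one,
      ← siteHom_apply le_rfl, ← siteHom_apply le_rfl, ← map_mul,
      Matrix.nonsing_inv_mul F ((Matrix.isUnit_iff_isUnit_det F).1 hF), map_one]
  have h5 : ∀ x y : Fin N, ∑ i', ∑ k', conjTrace (dMatrix Ψ) F F⁻¹ i k i' k' * R (x, i') (y, k') =
      if x = y ∧ i = k then 1 else 0 := by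
    intro x y
    have := congrFun (congrFun h4 (Fin.snoc (α := fun _ => Fin N) (fun _ : Fin 1 => x) i))
      (Fin.snoc (α := fun _ => Fin N) (fun _ : Fin 1 => y) k)
    have h6 := ptr_conj_apply (dMatrix Ψ) F F⁻¹ (site 2 0 R) (fun _ : Fin 1 => x)
      (fun _ : Fin 1 => y) i k
    have hid : ∀ X : TensorOp N 3 ℂ, scal ℂ X = X := fun X => by ext; rfl
    rw [hid, hid] at h6
    rw [h6, Matrix.one_apply] at this
    refine Eq.trans ?_ (this.trans (if_congr ?_ rfl rfl))
    · refine Finset.sum_congr rfl fun i' _ => Finset.sum_congr rfl fun k' _ => ?_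
      rw [smul_eq_mul]
      congr 1
    · constructor
      · intro h
        have := (Fin.snoc_inj (α := fun _ => Fin N)).1 h
        exact ⟨congrFun this.1 0, this.2⟩
      · rintro ⟨rfl, rfl⟩; rfl
  -- Contraction with `Ψ` undoes the contraction with `R`; substituting `h5` then leaves the partial
  -- trace of `Ψ`, which is `D`.
  have h7 : ∑ x, ∑ y, Ψ (k', y) (i', x) *
      ∑ u, ∑ v, conjTrace (dMatrix Ψ) F F⁻¹ i k u v * R (x, u) (y, v) =
      conjTrace (dMatrix Ψ) F F⁻¹ i k i' k' := by
    simp only [Finset.mul_sum]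
    rw [Finset.sum_congr rfl fun c _ => Finset.sum_comm, Finset.sum_comm]
    rw [Finset.sum_congr rfl fun u _ => Finset.sum_congr rfl fun x _ => Finset.sum_comm,
      Finset.sum_congr rfl fun u _ => Finset.sum_comm]
    have : ∀ u v, ∑ x, ∑ y, Ψ (k', y) (i', x) *
        (conjTrace (dMatrix Ψ) F F⁻¹ i k u v * R (x, u) (y, v)) =
        if k' = v ∧ u = i' then conjTrace (dMatrix Ψ) F F⁻¹ i k u v else 0 := by
      intro u v
      have := congrArg (conjTrace (dMatrix Ψ) F F⁻¹ i k u v * ·) (hΨ.2 k' u i' v)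
      simp only [mul_ite, mul_one, mul_zero, Finset.mul_sum] at this
      rw [← this, Finset.sum_comm]
      refine Finset.sum_congr rfl fun x _ => Finset.sum_congr rfl fun y _ => by ring
    simp only [this, ite_and, Finset.sum_ite_eq, Finset.sum_ite_eq', Finset.mem_univ, if_true]
  rw [← h7]
  simp only [h5, ite_and, mul_ite, mul_one, mul_zero, Finset.sum_ite_eq, Finset.mem_univ, if_true]
  split_ifs
  · rfl
  · simp

end PartialTrace

/-! ### The weight `D ⊗ D` commutes with `R`, and cyclicity follows. -/

section Weight

variable {N n : ℕ} {R Ψ : TwoSite N}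

lemma braid_conj (hR : IsRMatrix R) :
    site 3 1 R * site 3 0 R⁻¹ * site 3 1 R⁻¹ = site 3 0 R⁻¹ * site 3 1 R⁻¹ * site 3 0 R := by
  have hdet := (Matrix.isUnit_iff_isUnit_det R).1 hR.1
  have hinv : ∀ m, m + 2 ≤ 3 → site 3 m R * site 3 m R⁻¹ = 1 := fun m h => by
    rw [← siteHom_apply h, ← siteHom_apply h, ← map_mul, Matrix.mul_nonsing_inv R hdet, map_one]
  have hinv' : ∀ m, m + 2 ≤ 3 → site 3 m R⁻¹ * site 3 m R = 1 := fun m h => by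
    rw [← siteHom_apply h, ← siteHom_apply h, ← map_mul, Matrix.nonsing_inv_mul R hdet, map_one]
  rw [mul_assoc]
  refine intertwine_inv (u := site 3 1 R * site 3 0 R) ?_ ?_ ?_
  · rw [mul_assoc, ← mul_assoc _ (site 3 0 R⁻¹), hinv 0 (by omega), one_mul, hinv 1 (by omega)]
  · rw [mul_assoc, ← mul_assoc _ (site 3 1 R), hinv' 1 (by omega), one_mul, hinv' 0 (by omega)]
  · rw [← mul_assoc, hR.2]

lemma sum_comm_two_three {ι β : Type*} [Fintype ι] [AddCommMonoid β] (f : ι → ι → ι → ι → ι → β) :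
    ∑ a, ∑ b, ∑ c, ∑ d, ∑ e, f a b c d e = ∑ c, ∑ d, ∑ e, ∑ a, ∑ b, f a b c d e := by
  simp only [← Fintype.sum_prod_type' (f := fun a b => f a b _ _ _)]
  rw [← Fintype.sum_prod_type' (f := fun a b => ∑ c, ∑ d, ∑ e, f a b c d e), Finset.sum_comm]
  refine Finset.sum_congr rfl fun c _ => ?_
  rw [Finset.sum_comm]
  refine Finset.sum_congr rfl fun d _ => ?_
  rw [Finset.sum_comm]

/-- The trace formula `conjTrace_eq` for the R-matrix `R⁻¹` in place of `F`, contracted with `Ψ`,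
which cancels the factor `R` in it. -/
lemma weight_mul_inv (hR : IsRMatrix R) (hΨ : IsSkewInverse R Ψ) (x i i' y : Fin N) :
    ∑ d, dMatrix Ψ x d * R⁻¹ (i, d) (i', y) = ∑ k, Ψ (x, i) (y, k) * dMatrix Ψ k i' := by
  have hdet := (Matrix.isUnit_iff_isUnit_det R).1 hR.1
  have hinv : R⁻¹⁻¹ = R := Matrix.nonsing_inv_nonsing_inv R hdet
  have h := conjTrace_eq (F := R⁻¹) hΨ (by
    rw [Matrix.isUnit_iff_isUnit_det, Matrix.isUnit_nonsing_inv_det_iff]; exact hdet)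
    (braid_conj hR)
  rw [hinv] at h
  have h1 : ∑ k', ∑ k, Ψ (x, k) (y, k') * conjTrace (dMatrix Ψ) R⁻¹ R i k i' k' =
      ∑ k, Ψ (x, i) (y, k) * dMatrix Ψ k i' := by
    simp only [h, mul_ite, mul_zero, Finset.sum_ite_eq, Finset.mem_univ, if_true]
  have h2 : ∀ c d', ∑ k', ∑ k, Ψ (x, k) (y, k') * R (k', d') (k, c) =
      if x = c ∧ d' = y then 1 else 0 := fun c d' => by
    rw [← hΨ.2 x d' y c, Finset.sum_comm]
  rw [← h1]
  simp only [conjTrace, Finset.mul_sum]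
  symm
  calc _ = ∑ c, ∑ d, ∑ d', dMatrix Ψ c d * R⁻¹ (i, d) (i', d') *
        ∑ k', ∑ k, Ψ (x, k) (y, k') * R (k', d') (k, c) := by
        rw [sum_comm_two_three]
        simp only [Finset.mul_sum]
        refine Finset.sum_congr rfl fun _ _ => Finset.sum_congr rfl fun _ _ =>
          Finset.sum_congr rfl fun _ _ => Finset.sum_congr rfl fun _ _ =>
          Finset.sum_congr rfl fun _ _ => by ring
    _ = _ := by
        simp only [h2, ite_and, mul_ite, mul_one, mul_zero, Finset.sum_ite_irrel,
          Finset.sum_ite_eq, Finset.sum_ite_eq', Finset.mem_univ, if_true,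
          Finset.sum_const_zero]

lemma inv_mul_weight (hR : IsRMatrix R) (hΨ : IsSkewInverse R Ψ) (k' x k y : Fin N) :
    ∑ c, R⁻¹ (k', x) (k, c) * dMatrix Ψ c y = ∑ i, dMatrix Ψ k' i * Ψ (x, i) (y, k) := by
  have h := conjTrace_eq (F := R) hΨ hR.1 hR.2.symm
  have h1 : ∑ i', ∑ i, Ψ (x, i') (y, i) * conjTrace (dMatrix Ψ) R R⁻¹ i k i' k' =
      ∑ i, dMatrix Ψ k' i * Ψ (x, i) (y, k) := by
    simp only [h, mul_ite, mul_zero, Finset.sum_ite_eq', Finset.mem_univ, if_true]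
    simp only [mul_comm]
  have h2 : ∀ d d', ∑ i', ∑ i, Ψ (x, i') (y, i) * R (i, d) (i', d') =
      if x = d' ∧ d = y then 1 else 0 := fun d d' => hΨ.2 x d y d'
  rw [← h1]
  simp only [conjTrace, Finset.mul_sum]
  symm
  calc _ = ∑ c, ∑ d, ∑ d', dMatrix Ψ c d * R⁻¹ (k', d') (k, c) *
        ∑ i', ∑ i, Ψ (x, i') (y, i) * R (i, d) (i', d') := by
        rw [sum_comm_two_three]
        simp only [Finset.mul_sum]
        refine Finset.sum_congr rfl fun _ _ => Finset.sum_congr rfl fun _ _ =>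
          Finset.sum_congr rfl fun _ _ => Finset.sum_congr rfl fun _ _ =>
          Finset.sum_congr rfl fun _ _ => by ring
    _ = _ := by
        simp only [h2, ite_and, mul_ite, mul_one, mul_zero, Finset.sum_ite_eq,
          Finset.sum_ite_eq', Finset.mem_univ, if_true]
        simp only [mul_comm]

-- The two preceding formulas turn both `(D ⊗ D) R⁻¹` and `R⁻¹ (D ⊗ D)` into the same contraction `D
-- Ψ D`. Commutation with `R⁻¹` implies commutation with `R`.
open Kronecker in
lemma weight_commute (hR : IsRMatrix R) (hΨ : IsSkewInverse R Ψ) :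
    Commute (dMatrix Ψ ⊗ₖ dMatrix Ψ) R := by
  have hdet := (Matrix.isUnit_iff_isUnit_det R).1 hR.1
  have h : Commute (dMatrix Ψ ⊗ₖ dMatrix Ψ) R⁻¹ := by
    ext ⟨a, x⟩ ⟨i', y⟩
    simp only [Matrix.mul_apply, Fintype.sum_prod_type, Matrix.kroneckerMap_apply]
    calc _ = ∑ i, dMatrix Ψ a i * ∑ d, dMatrix Ψ x d * R⁻¹ (i, d) (i', y) := by
          simp only [Finset.mul_sum, mul_assoc]
      _ = ∑ k, (∑ i, dMatrix Ψ a i * Ψ (x, i) (y, k)) * dMatrix Ψ k i' := by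
          simp only [weight_mul_inv hR hΨ, Finset.mul_sum, Finset.sum_mul, mul_assoc]
          exact Finset.sum_comm
      _ = _ := by
          simp only [← inv_mul_weight hR hΨ, Finset.sum_mul]
          refine Finset.sum_congr rfl fun k _ => Finset.sum_congr rfl fun c _ => by ring
  have h' := intertwine_inv (Matrix.nonsing_inv_mul R hdet) (Matrix.mul_nonsing_inv R hdet) h
  exact h'

end Weight

section WeightPower

variable {N n : ℕ}

/-- The operator `D^{⊗ n}`. -/
def weightPow (D : Matrix (Fin N) (Fin N) ℂ) (n : ℕ) : TensorOp N n ℂ :=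
  fun a b => ∏ l, D (a l) (b l)

lemma fullTrace_eq_trace {A : Type*} [Ring A] [Algebra ℂ A] (D : Matrix (Fin N) (Fin N) ℂ)
    (Y : TensorOp N n A) : fullTrace D Y = (scal A (weightPow D n) * Y).trace := by
  simp only [fullTrace, Matrix.trace, Matrix.diag, Matrix.mul_apply, scal, Matrix.map_apply,
    weightPow, Algebra.smul_def]

lemma weightPow_split (D : Matrix (Fin N) (Fin N) ℂ) {w : ℕ} {e : Fin w → Fin n}
    (he : Function.Injective e) (a b : Fin n → Fin N) :
    weightPow D n a b = weightPow D w (a ∘ e) (b ∘ e) *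
      ∏ l ∈ Finset.univ.filter (fun l => l ∉ Finset.univ.image e), D (a l) (b l) := by
  rw [weightPow, ← Finset.prod_filter_mul_prod_filter_not Finset.univ
    (fun l => l ∈ Finset.univ.image e)]
  congr 1
  rw [Finset.filter_mem_eq_inter, Finset.univ_inter, Finset.prod_image fun x _ y _ h => he h]
  rfl

lemma weightPow_commute_emb {D : Matrix (Fin N) (Fin N) ℂ} {w : ℕ} {e : Fin w → Fin n}
    (he : Function.Injective e) {X : TensorOp N w ℂ} (h : Commute (weightPow D w) X) :
    Commute (weightPow D n) (emb e X) := by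
  have hoff : ∀ l, l ∉ Finset.univ.image e → l ∉ Set.range e := by
    intro l hl; simpa using hl
  ext a b
  rw [emb_mul_apply he, mul_emb_apply he]
  simp only [weightPow_split D he, extend_comp he]
  have e1 : ∀ d, ∏ l ∈ Finset.univ.filter (fun l => l ∉ Finset.univ.image e),
      D (a l) (Function.extend e d b l) =
      ∏ l ∈ Finset.univ.filter (fun l => l ∉ Finset.univ.image e), D (a l) (b l) := by
    intro d
    refine Finset.prod_congr rfl fun l hl => ?_
    rw [extend_off _ _ (hoff l (Finset.mem_filter.1 hl).2)]
  have e2 : ∀ d, ∏ l ∈ Finset.univ.filter (fun l => l ∉ Finset.univ.image e),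
      D (Function.extend e d a l) (b l) =
      ∏ l ∈ Finset.univ.filter (fun l => l ∉ Finset.univ.image e), D (a l) (b l) := by
    intro d
    refine Finset.prod_congr rfl fun l hl => ?_
    rw [extend_off _ _ (hoff l (Finset.mem_filter.1 hl).2)]
  simp only [e1, e2]
  have := congrFun (congrFun h.eq (a ∘ e)) (b ∘ e)
  rw [Matrix.mul_apply, Matrix.mul_apply] at this
  calc _ = (∑ d, weightPow D w (a ∘ e) d * X d (b ∘ e)) *
      ∏ l ∈ Finset.univ.filter (fun l => l ∉ Finset.univ.image e), D (a l) (b l) := by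
        rw [Finset.sum_mul]; exact Finset.sum_congr rfl fun _ _ => by ring
    _ = _ := by
        rw [this, Finset.sum_mul]; exact Finset.sum_congr rfl fun _ _ => by ring

open Kronecker in
lemma weightPow_two (D : Matrix (Fin N) (Fin N) ℂ) : weightPow D 2 = site 2 0 (D ⊗ₖ D) := by
  rw [← twoSiteHom_apply]
  ext a b
  simp only [weightPow, Fin.prod_univ_two]
  rfl

lemma weightPow_commute_site {R Ψ : TwoSite N} (hR : IsRMatrix R) (hΨ : IsSkewInverse R Ψ)
    (m : ℕ) : Commute (weightPow (dMatrix Ψ) n) (site n m R) := by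
  by_cases h : m + 2 ≤ n
  · rw [site_eq_emb h]
    refine weightPow_commute_emb (block_injective h) ?_
    rw [weightPow_two, ← twoSiteHom_apply, ← twoSiteHom_apply]
    exact (weight_commute hR hΨ).map (twoSiteHom N)
  · rw [site_of_le h]
    exact Commute.zero_right _

/-- Intertwining every `R_m` entails intertwining the image of the braid group. -/
lemma intertwine_braidImage {R : TwoSite N} (hR : IsUnit R) {B : Type*} [Ring B] [Algebra ℂ B]
    (φ ψ : TensorOp N n ℂ →ₐ[ℂ] B) {Z : B}
    (h : ∀ m, m + 2 ≤ n → φ (site n m R) * Z = Z * ψ (site n m R))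
    {X : TensorOp N n ℂ} (hX : X ∈ braidImage R n) : φ X * Z = Z * ψ X := by
  have hdet := (Matrix.isUnit_iff_isUnit_det R).1 hR
  induction hX using Algebra.adjoin_induction with
  | mem x hx =>
    rcases hx with ⟨m, rfl⟩ | ⟨m, rfl⟩
    · by_cases hm : m + 2 ≤ n
      · exact h m hm
      · simp only [site_of_le hm, map_zero, zero_mul, mul_zero]
    · by_cases hm : m + 2 ≤ n
      · have h1 : ψ (site n m R) * ψ (site n m R⁻¹) = 1 := by
          rw [← map_mul, ← siteHom_apply hm, ← siteHom_apply hm, ← map_mul,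
            Matrix.mul_nonsing_inv R hdet, map_one, map_one]
        have h2 : φ (site n m R⁻¹) * φ (site n m R) = 1 := by
          rw [← map_mul, ← siteHom_apply hm, ← siteHom_apply hm, ← map_mul,
            Matrix.nonsing_inv_mul R hdet, map_one, map_one]
        calc _ = φ (site n m R⁻¹) * (Z * ψ (site n m R)) * ψ (site n m R⁻¹) := by
              rw [mul_assoc, mul_assoc, h1, mul_one]
          _ = _ := by rw [← h m hm, ← mul_assoc, h2, one_mul]
      · simp only [site_of_le hm, map_zero, zero_mul, mul_zero]
  | algebraMap c =>
    rw [AlgHom.commutes, AlgHom.commutes]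
    exact Algebra.commutes c Z
  | add x y _ _ hx hy => rw [map_add, map_add, add_mul, mul_add, hx, hy]
  | mul x y _ _ hx hy => rw [map_mul, map_mul, mul_assoc, hy, ← mul_assoc, hx, mul_assoc]

lemma trace_mul_scal {A : Type*} [Ring A] [Algebra ℂ A] (Y : TensorOp N n A)
    (X : TensorOp N n ℂ) : (Y * scal A X).trace = (scal A X * Y).trace := by
  simp only [Matrix.trace, Matrix.diag, Matrix.mul_apply, scal, Matrix.map_apply]
  rw [Finset.sum_comm]
  exact Finset.sum_congr rfl fun _ _ => Finset.sum_congr rfl fun _ _ =>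
    (Algebra.commutes _ _).symm

end WeightPower

/-! ### Cyclicity of `ch` on the quantum matrix algebra. -/

section GenMatrix

variable {N n : ℕ} {R F Ψ : TwoSite N}

lemma map_firstSite {A A' : Type*} [Ring A] [Algebra ℂ A] [Ring A'] [Algebra ℂ A']
    (φ : A →ₐ[ℂ] A') (M : Matrix (Fin N) (Fin N) A) :
    (firstSite n M).map φ = firstSite n (M.map φ) := by
  ext a b
  simp only [firstSite, Matrix.map_apply]
  split_ifs <;> simp

lemma map_scal {A A' : Type*} [Ring A] [Algebra ℂ A] [Ring A'] [Algebra ℂ A']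
    (φ : A →ₐ[ℂ] A') (X : TensorOp N n ℂ) : (scal A X).map φ = scal A' X := by
  ext a b
  simp only [scal, Matrix.map_apply, AlgHom.commutes]

lemma map_copy {A A' : Type*} [Ring A] [Algebra ℂ A] [Ring A'] [Algebra ℂ A']
    (φ : A →ₐ[ℂ] A') (M : Matrix (Fin N) (Fin N) A) (i : ℕ) :
    (copy F M n i).map φ = copy F (M.map φ) n i := by
  induction i with
  | zero => exact map_firstSite φ M
  | succ i ih => rw [copy, copy, Matrix.map_mul, Matrix.map_mul, ih, map_scal, map_scal]

lemma genMatrix_eq : genMatrix R F = (freeMatrix N).map (RingQuot.mkAlgHom ℂ (QMRel R F)) := rfl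

lemma genMatrix_rel : Commute (scal (QMAlgebra R F) (site 2 0 R))
    (copyProd F (genMatrix R F) 2) := by
  have h : (copyProd F (freeMatrix N) 2).map (RingQuot.mkAlgHom ℂ (QMRel R F)) =
      copyProd F (genMatrix R F) 2 := by
    rw [copyProd_two, copyProd_two, Matrix.map_mul, map_copy, map_copy, genMatrix_eq]
  rw [Commute, SemiconjBy, ← h, ← map_scal (RingQuot.mkAlgHom ℂ (QMRel R F)), ← Matrix.map_mul,
    ← Matrix.map_mul]
  ext a b
  exact RingQuot.mkAlgHom_rel ℂ (QMRel.entry a b)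

/-- The trace over a noncommutative ring is not cyclic in general, but it is when one factor has
scalar entries. Here `Y` is scalar and commutes with both the product of copies and the weight `D^{⊗
n}`, so it can be moved all the way round. -/
lemma chValue_comm (hRF : IsCompatiblePair R F) (hΨ : IsSkewInverse R Ψ)
    {X Y : TensorOp N n ℂ} (hY : Y ∈ braidImage R n) :
    chValue R F Ψ n (X * Y) = chValue R F Ψ n (Y * X) := by
  have hR := hRF.1
  have h1 : Commute (scal (QMAlgebra R F) Y) (copyProd F (genMatrix R F) n) :=
    intertwine_braidImage hR.1 (scalHom (QMAlgebra R F) N n) (scalHom (QMAlgebra R F) N n)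
      (fun m _ => (site_commute_copyProd (genMatrix R F) hRF genMatrix_rel m).eq) hY
  have h2 : Commute (scal (QMAlgebra R F) Y) (scal _ (weightPow (dMatrix Ψ) n)) :=
    Commute.map (show Commute Y (weightPow (dMatrix Ψ) n) from
      intertwine_braidImage hR.1 (AlgHom.id ℂ _) (AlgHom.id ℂ _)
        (fun m _ => (weightPow_commute_site hR hΨ m).eq.symm) hY) (scalHom (QMAlgebra R F) N n)
  rw [chValue, chValue, fullTrace_eq_trace, fullTrace_eq_trace, scal_mul, scal_mul, ← mul_assoc,
    ← mul_assoc, trace_mul_scal, ← mul_assoc, ← mul_assoc, ← mul_assoc, ← mul_assoc, h2.eq,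
    mul_assoc (scal _ (weightPow _ _)) (scal _ Y), h1.eq, ← mul_assoc]

end GenMatrix

/-! ### Tracing out the last factors one at a time. -/

section Reduction

variable {N m : ℕ} {A : Type*} [Ring A] [Algebra ℂ A]

/-- `Y` on `V^{⊗ L}` reduces to `Z` on `V^{⊗ m}` by tracing out the last factors. -/
inductive ReducesTo (D : Matrix (Fin N) (Fin N) ℂ) (Z : TensorOp N m A) :
    ∀ L : ℕ, TensorOp N L A → Prop
  | refl : ReducesTo D Z m Z
  | step {L : ℕ} (Y : TensorOp N (L + 1) A) : ReducesTo D Z L (ptr D Y) → ReducesTo D Z (L + 1) Y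

namespace ReducesTo

variable {D : Matrix (Fin N) (Fin N) ℂ} {Z : TensorOp N m A} {L : ℕ} {Y : TensorOp N L A}

lemma le (h : ReducesTo D Z L Y) : m ≤ L := by
  induction h with
  | refl => exact le_rfl
  | step _ _ ih => omega

lemma fullTrace_eq (h : ReducesTo D Z L Y) : fullTrace D Y = fullTrace D Z := by
  induction h with
  | refl => rfl
  | step Y _ ih => rw [← fullTrace_ptr, ih]

lemma mul_left (h : ReducesTo D Z L Y) (X : TensorOp N m A) :
    ReducesTo D (X * Z) L (emb (block 0 m L (by have := h.le; omega)) X * Y) := by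
  induction h with
  | refl => rw [emb_block_self]; exact .refl
  | @step L Y h ih =>
    refine .step _ ?_
    have : emb (block 0 m (L + 1) (by have := h.le; omega)) X =
        padLast (emb (block 0 m L (by have := h.le; omega)) X) := by
      rw [padLast, emb_block_block]
    rw [this, ptr_padLast_mul]
    exact ih

end ReducesTo

lemma exists_reducesTo (D : Matrix (Fin N) (Fin N) ℂ) :
    ∀ {L : ℕ} (Y : TensorOp N L A), ∃ Z : TensorOp N 0 A, ReducesTo D Z L Y
  | 0, Y => ⟨Y, .refl⟩
  | _ + 1, Y => (exists_reducesTo D (ptr D Y)).imp fun _ h => .step Y h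

lemma zero_site_eq (D : Matrix (Fin N) (Fin N) ℂ) (Z : TensorOp N 0 A) :
    Z = Matrix.scalar _ (fullTrace D Z) := by
  ext a b
  have ha : a = default := Subsingleton.elim _ _
  have hb : b = default := Subsingleton.elim _ _
  subst ha hb
  simp [fullTrace, Matrix.scalar_apply]

lemma reducesTo_scalar (D : Matrix (Fin N) (Fin N) ℂ) {L : ℕ} (Y : TensorOp N L A) :
    ReducesTo D (Matrix.scalar (Fin 0 → Fin N) (fullTrace D Y)) L Y := by
  obtain ⟨Z, h⟩ := exists_reducesTo D Y
  rw [h.fullTrace_eq, ← zero_site_eq]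
  exact h

lemma padLast_scalar {B : Type*} [Ring B] (c : B) : padLast (Matrix.scalar (Fin m → Fin N) c) =
    Matrix.scalar (Fin (m + 1) → Fin N) c := by
  ext a b
  rw [← Fin.snoc_init_self a, ← Fin.snoc_init_self b, padLast_apply]
  simp only [Matrix.scalar_apply, Matrix.diagonal_apply, ← ite_and]
  refine if_congr ?_ rfl rfl
  constructor
  · rintro ⟨h1, h2⟩; rw [h1, h2]
  · intro h
    have := (Fin.snoc_inj (α := fun _ => Fin N)).1 h
    exact ⟨this.2, this.1⟩

lemma fullTrace_mul_scalar (D : Matrix (Fin N) (Fin N) ℂ) (X : TensorOp N m A) (c : A) :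
    fullTrace D (X * Matrix.scalar (Fin m → Fin N) c) = fullTrace D X * c := by
  simp only [fullTrace, Matrix.scalar_apply, Matrix.mul_diagonal, Finset.sum_mul, smul_mul_assoc]

/-- The product `X_lo X_{lo+1} ⋯ X_{lo+len-1}` on `V^{⊗ L}`. -/
def ascProd (A : Type*) [Ring A] [Algebra ℂ A] (L : ℕ) (X : TwoSite N) (lo : ℕ) :
    ℕ → TensorOp N L A
  | 0 => 1
  | len + 1 => ascProd A L X lo len * scal A (site L (lo + len) X)

/-- The product `X_{lo+len-1} ⋯ X_{lo+1} X_lo` on `V^{⊗ L}`. -/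
def descProd (A : Type*) [Ring A] [Algebra ℂ A] (L : ℕ) (X : TwoSite N) (lo : ℕ) :
    ℕ → TensorOp N L A
  | 0 => 1
  | len + 1 => scal A (site L (lo + len) X) * descProd A L X lo len

lemma padLast_ascProd {L : ℕ} (X : TwoSite N) (lo len : ℕ) (h : lo + len + 1 ≤ L) :
    padLast (ascProd A L X lo len) = ascProd A (L + 1) X lo len := by
  induction len with
  | zero => exact padLast_one
  | succ len ih =>
    rw [ascProd, padLast_mul, ih (by omega), padLast_scal, padLast_site (by omega)]
    rfl

lemma padLast_descProd {L : ℕ} (X : TwoSite N) (lo len : ℕ) (h : lo + len + 1 ≤ L) :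
    padLast (descProd A L X lo len) = descProd A (L + 1) X lo len := by
  induction len with
  | zero => exact padLast_one
  | succ len ih =>
    rw [descProd, padLast_mul, ih (by omega), padLast_scal, padLast_site (by omega)]
    rfl

lemma ascProd_mul_descProd {F : TwoSite N} (hF : IsUnit F) {L lo len : ℕ}
    (h : lo + len + 1 ≤ L) : ascProd A L F lo len * descProd A L F⁻¹ lo len = 1 := by
  induction len with
  | zero => exact one_mul 1
  | succ len ih =>
    rw [ascProd, descProd, mul_assoc, ← mul_assoc (scal A _), site_mul_inv hF (by omega), one_mul,
      ih (by omega)]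

/-- The innermost pair of the conjugating chain sits on the last two factors. The trace over the
last factor absorbs it by the formula for `conjTrace`; the remaining chain then lies outside the
last factor, and the induction proceeds. -/
lemma ReducesTo.conj {D : Matrix (Fin N) (Fin N) ℂ} {F F' : TwoSite N}
    (hF : ∀ i k i' k', conjTrace D F F' i k i' k' = if i = k then D k' i' else 0)
    {Z : TensorOp N m A} {L : ℕ} {Y : TensorOp N L A} (h : ReducesTo D Z L Y) :
    ReducesTo D (padLast Z) (L + 1)
      (ascProd A (L + 1) F m (L - m) * padLast Y * descProd A (L + 1) F' m (L - m)) := by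
  induction h with
  | refl =>
    rw [Nat.sub_self, ascProd, descProd, one_mul, mul_one]
    exact .refl
  | @step L Y h ih =>
    refine .step _ ?_
    have hle := h.le
    rw [Nat.sub_add_comm hle, ascProd, descProd, show m + (L - m) = L by omega,
      ← padLast_ascProd F m (L - m) (by omega), ← padLast_descProd F' m (L - m) (by omega)]
    have : padLast (ascProd A (L + 1) F m (L - m)) * scal A (site (L + 1 + 1) L F) * padLast Y *
        (scal A (site (L + 1 + 1) L F') * padLast (descProd A (L + 1) F' m (L - m))) =
        padLast (ascProd A (L + 1) F m (L - m)) *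
          ((scal A (site (L + 2) L F) * padLast Y * scal A (site (L + 2) L F')) *
            padLast (descProd A (L + 1) F' m (L - m))) := by noncomm_ring
    rw [this, ptr_padLast_mul, ptr_mul_padLast, ptr_conj D hF, ← mul_assoc]
    exact ih

end Reduction

/-! ### Multiplicativity of `ch` on juxtaposed braids. -/

section Multiplicativity

variable {N : ℕ} {A : Type*} [Ring A] [Algebra ℂ A] {F : TwoSite N}
  (M : Matrix (Fin N) (Fin N) A)

lemma commute_ascProd {L lo len : ℕ} {X : TwoSite N} {Z : TensorOp N L A}
    (h : ∀ j, lo ≤ j → j < lo + len → Commute (scal A (site L j X)) Z) :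
    Commute (ascProd A L X lo len) Z := by
  induction len with
  | zero => exact Commute.one_left Z
  | succ len ih =>
    exact (ih fun j h1 h2 => h j h1 (by omega)).mul_left (h _ (by omega) (by omega))

lemma ascProd_mul_copy (hF : IsRMatrix F) {L lo len i : ℕ} (h : lo + len + 1 ≤ L) (h1 : lo ≤ i)
    (h2 : i < lo + len) :
    ascProd A L F lo len * copy F M L i = copy F M L (i + 1) * ascProd A L F lo len := by
  induction len with
  | zero => omega
  | succ len ih =>
    rw [ascProd]
    rcases Nat.lt_or_ge i (lo + len) with hi | hi
    · rw [mul_assoc, (site_commute_copy_of_lt F M hi F).eq, ← mul_assoc, ih (by omega) hi,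
        mul_assoc]
    · obtain rfl : i = lo + len := by omega
      rw [mul_assoc, ← copy_succ_mul_site M hF.1 (by omega), ← mul_assoc,
        (commute_ascProd fun j _ hj =>
          site_commute_copy_of_gt M hF.1 hF.2 (by omega) (by omega)).eq, mul_assoc]

/-- Conjugation by the chain `F_lo F_{lo+1} ⋯` shifts a braid operator by one strand, just as
`ascProd_mul_copy` shows for the copies of `M`. One compatibility relation acts where the operator
meets the end of the chain. -/
lemma ascProd_mul_site {X : TwoSite N}
    (hX : site 3 1 X * site 3 0 F * site 3 1 F = site 3 0 F * site 3 1 F * site 3 0 X)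
    {L lo len i : ℕ} (h : lo + len + 1 ≤ L) (h1 : lo ≤ i) (h2 : i + 1 < lo + len) :
    scal A (site L (i + 1) X) * ascProd A L F lo len =
      ascProd A L F lo len * scal A (site L i X) := by
  induction len with
  | zero => omega
  | succ len ih =>
    rw [ascProd]
    rcases Nat.lt_or_ge (i + 1) (lo + len) with hi | hi
    · rw [mul_assoc, ← (scal_site_commute (by omega) X F).eq, ← mul_assoc, ih (by omega) hi,
        mul_assoc]
    · obtain ⟨l, rfl⟩ : ∃ l, len = l + 1 := ⟨len - 1, by omega⟩
      obtain rfl : i = lo + l := by omega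
      have h3 := congrArg (scal A) (site_three (n := L) (i := lo + l) (by omega) (by omega)
        (by omega) (by omega) (by omega) (by omega) (by omega) hX)
      simp only [scal_mul, add_zero] at h3
      have hc : Commute (ascProd A L F lo l) (scal A (site L (lo + l + 1) X)) :=
        commute_ascProd fun j _ hj => scal_site_commute (by omega) F X
      rw [ascProd, ← add_assoc lo l 1]
      calc _ = scal A (site L (lo + l + 1) X) * ascProd A L F lo l * scal A (site L (lo + l) F) *
            scal A (site L (lo + l + 1) F) := by noncomm_ring
        _ = ascProd A L F lo l * (scal A (site L (lo + l + 1) X) * scal A (site L (lo + l) F) *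
            scal A (site L (lo + l + 1) F)) := by rw [← hc.eq]; noncomm_ring
        _ = _ := by rw [h3]; noncomm_ring

/-- The product `M_{\overline{s+1}} ⋯ M_{\overline{s+n}}` on `V^{⊗ L}`. -/
def copiesFrom (F : TwoSite N) (M : Matrix (Fin N) (Fin N) A) (L s n : ℕ) : TensorOp N L A :=
  ((List.range n).map (fun i => copy F M L (s + i))).prod

lemma copiesFrom_succ (L s n : ℕ) :
    copiesFrom F M L s (n + 1) = copiesFrom F M L s n * copy F M L (s + n) :=
  range_prod_succ _ n

lemma copyProd_eq (L : ℕ) : copyProd F M L = copiesFrom F M L 0 L := by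
  simp only [copyProd, copiesFrom, zero_add]

lemma copiesFrom_add (L s m n : ℕ) :
    copiesFrom F M L s (m + n) = copiesFrom F M L s m * copiesFrom F M L (s + m) n := by
  induction n with
  | zero => simp [copiesFrom]
  | succ n ih => rw [← add_assoc, copiesFrom_succ, ih, copiesFrom_succ, mul_assoc, add_assoc]

lemma copiesFrom_add_zero (L m n : ℕ) :
    copiesFrom F M L 0 (m + n) = copiesFrom F M L 0 m * copiesFrom F M L m n := by
  rw [copiesFrom_add, zero_add]

lemma emb_copiesFrom {w L s n : ℕ} (h : 0 + w ≤ L) (hn : s + n ≤ w) :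
    emb (block 0 w L h) (copiesFrom F M w s n) = copiesFrom F M L s n := by
  induction n with
  | zero => exact emb_one
  | succ n ih =>
    rw [copiesFrom_succ, emb_mul (block_injective h), ih (by omega), emb_copy M h (by omega),
      copiesFrom_succ]

lemma ascProd_mul_copiesFrom (hF : IsRMatrix F) {L lo len n : ℕ} (h : lo + len + 1 ≤ L)
    (hn : n ≤ len) : ascProd A L F lo len * copiesFrom F M L lo n =
      copiesFrom F M L (lo + 1) n * ascProd A L F lo len := by
  induction n with
  | zero => simp [copiesFrom]
  | succ n ih =>
    rw [copiesFrom_succ, copiesFrom_succ, ← mul_assoc, ih (by omega), mul_assoc,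
      ascProd_mul_copy M hF h (by omega) (by omega), mul_assoc,
      show lo + n + 1 = lo + 1 + n by omega]

variable {R Ψ : TwoSite N}

/-- Tracing out the last `n` factors of `M_{\overline{m+1}} ⋯ M_{\overline{m+n}} β^{↑m}` leaves a
multiple of the identity. -/
lemma reducesTo_copiesFrom (hRF : IsCompatiblePair R F) (hΨ : IsSkewInverse R Ψ) {n : ℕ}
    {β : TensorOp N n ℂ} (hβ : β ∈ braidImage R n) (m L : ℕ) (h : m + n = L) :
    ReducesTo (dMatrix Ψ) (Matrix.scalar (Fin m → Fin N)
        (fullTrace (dMatrix Ψ) (copyProd F M n * scal A β))) L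
      (copiesFrom F M L m n * scal A (emb (block m n L h.le) β)) := by
  induction m generalizing L with
  | zero =>
    obtain rfl : n = L := by omega
    rw [emb_block_self, ← copyProd_eq]
    exact reducesTo_scalar _ _
  | succ m ih =>
    obtain ⟨L, rfl⟩ : ∃ l, L = l + 1 := ⟨L - 1, by omega⟩
    have h' : m + n = L := by omega
    -- Adding a strand at the end and conjugating by `F_m ⋯ F_{L-1}` shifts both the copies and `β`
    -- by one strand, without affecting the scalar that remains after tracing.
    have key := (ih L h').conj
      (conjTrace_eq hΨ hRF.2.1.1 hRF.2.2.2)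
    rw [padLast_scalar] at key
    have hW := ascProd_mul_descProd (A := A) hRF.2.1.1 (L := L + 1) (lo := m) (len := L - m)
      (by omega)
    have e1 : padLast (copiesFrom F M L m n) = copiesFrom F M (L + 1) m n :=
      emb_copiesFrom M _ h'.le
    have e2 : padLast (scal A (emb (block m n L h'.le) β)) =
        scal A (emb (block m n (L + 1) (by omega)) β) := by
      rw [padLast_scal, padLast, emb_block_block]
      congr 3
      rw [zero_add]
    have e3 : scal A (emb (block (m + 1) n (L + 1) (by omega)) β) *
        ascProd A (L + 1) F m (L - m) =
        ascProd A (L + 1) F m (L - m) * scal A (emb (block m n (L + 1) (by omega)) β) := by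
      refine intertwine_braidImage hRF.1.1
        ((scalHom A N (L + 1)).comp (embHom (block (m + 1) n (L + 1) (by omega))
          (block_injective _)))
        ((scalHom A N (L + 1)).comp (embHom (block m n (L + 1) (by omega))
          (block_injective _))) (fun j hj => ?_) hβ
      change scal A (emb _ _) * _ = _ * scal A (emb _ _)
      rw [emb_site _ hj, emb_site _ hj, show m + 1 + j = m + j + 1 by omega]
      exact ascProd_mul_site hRF.2.2.2 (by omega) (by omega) (by omega)
    rw [padLast_mul, e1, e2, ← mul_assoc,
      ascProd_mul_copiesFrom M hRF.2.1 (by omega) (by omega), mul_assoc (copiesFrom _ _ _ _ _),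
      ← e3, mul_assoc, mul_assoc (scal A _), hW, mul_one] at key
    exact key

/-- `α` acts on the first `m` strands and commutes with the later copies, so the operator splits
into a part on those strands and a part whose trace over the last `n` strands is a scalar matrix. -/
lemma chValue_mul (hRF : IsCompatiblePair R F) (hΨ : IsSkewInverse R Ψ) {m n L : ℕ}
    (h : m + n = L) {α : TensorOp N m ℂ} (hα : α ∈ braidImage R m) {β : TensorOp N n ℂ}
    (hβ : β ∈ braidImage R n) :
    chValue R F Ψ L (emb (block 0 m L (by omega)) α * emb (block m n L h.le) β) =
      chValue R F Ψ m α * chValue R F Ψ n β := by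
  set M := genMatrix R F
  have hc : scal (QMAlgebra R F) (emb (block 0 m L (by omega)) α) * copiesFrom F M L m n =
      copiesFrom F M L m n * scal (QMAlgebra R F) (emb (block 0 m L (by omega)) α) := by
    refine intertwine_braidImage hRF.1.1
      ((scalHom (QMAlgebra R F) N L).comp (embHom (block 0 m L (by omega)) (block_injective _)))
      ((scalHom (QMAlgebra R F) N L).comp (embHom (block 0 m L (by omega)) (block_injective _)))
      (fun j hj => ?_) hα
    change scal (QMAlgebra R F) (emb _ _) * _ = _ * scal (QMAlgebra R F) (emb _ _)
    rw [emb_site _ hj]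
    have : ∀ n', m + n' ≤ L →
        Commute (scal (QMAlgebra R F) (site L (0 + j) R)) (copiesFrom F M L m n') := by
      intro n' hn'
      induction n' with
      | zero => exact Commute.one_right _
      | succ n' ih =>
        rw [copiesFrom_succ]
        exact (ih (by omega)).mul_right
          (site_commute_copy_of_gt M hRF.2.1.1 hRF.2.2.1 (by omega) (by omega))
    exact (this n h.le).eq
  have hr := (reducesTo_copiesFrom M hRF hΨ hβ m L h).mul_left
    (copyProd F M m * scal (QMAlgebra R F) α)
  have hf := hr.fullTrace_eq
  rw [fullTrace_mul_scalar] at hf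
  rw [chValue, chValue, chValue, ← hf]
  have e1 : copyProd F M L = copiesFrom F M L 0 m * copiesFrom F M L m n := by
    rw [copyProd_eq, ← copiesFrom_add_zero M L m n, h]
  have e2 : emb (block 0 m L (by omega)) (copyProd F M m) = copiesFrom F M L 0 m := by
    rw [copyProd_eq, emb_copiesFrom M _ (by omega)]
  congr 1
  rw [scal_mul, emb_mul (block_injective _), emb_scal, e1, e2, mul_assoc, mul_assoc,
    ← mul_assoc (copiesFrom F M L m n), ← hc, mul_assoc]

end Multiplicativity

/-! ### The braid group images as a tower. -/

section Realisation

variable {N : ℕ} {q μ : ℂ} {R F Ψ : TwoSite N}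

lemma IsBMWType.param (h : IsBMWType q μ R) : BMWParam q μ := by
  obtain ⟨⟨h0, h1, h2, h3, h4, h5⟩, -⟩ := h
  refine ⟨h0, fun h => ?_, h3, fun h => h4 (sub_eq_zero.1 h).symm,
    fun h => h5 (by linear_combination h)⟩
  have : (q - 1) * (q + 1) = 0 := by
    have h' := congrArg (q * ·) h
    simp only [mul_sub, mul_inv_cancel₀ h0, mul_zero] at h'
    linear_combination h'
  rcases mul_eq_zero.1 this with h | h
  · exact h1 (sub_eq_zero.1 h)
  · exact h2 (by linear_combination h)

lemma IsBMWType.cubic (h : IsBMWType q μ R) :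
    (R - algebraMap ℂ _ q) * (R + algebraMap ℂ _ q⁻¹) * (R - algebraMap ℂ _ μ) = 0 := by
  have := minpoly.aeval ℂ R
  rw [h.2.2.1] at this
  simpa using this

/-- If `κ` vanished, `R` would satisfy a quadratic equation, while its minimal polynomial is cubic.
-/
lemma IsBMWType.kappa_ne_zero (h : IsBMWType q μ R) : kappa q μ R ≠ 0 := by
  intro h0
  have hp := h.param
  have hne := mul_ne_zero hp.mu_ne hp.lam_ne
  rw [kappa, smul_eq_zero, inv_eq_zero, or_iff_right hne] at h0
  let P : Polynomial ℂ :=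
    (Polynomial.X - Polynomial.C q) * (Polynomial.X + Polynomial.C q⁻¹)
  have hP : P.Monic := (Polynomial.monic_X_sub_C q).mul (Polynomial.monic_X_add_C q⁻¹)
  have hroot : Polynomial.aeval R P = 0 := by
    have : Polynomial.aeval R P = -((algebraMap ℂ _ q - R) * (algebraMap ℂ _ q⁻¹ + R)) := by
      simp only [P, map_mul, map_sub, map_add, Polynomial.aeval_X, Polynomial.aeval_C]
      noncomm_ring
    rw [this, h0, neg_zero]
  have hdeg := minpoly.min ℂ R hP hroot
  rw [h.2.2.1, Polynomial.degree_mul] at hdeg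
  have hd : P.degree = 2 := by
    simp only [P, Polynomial.degree_mul, Polynomial.degree_X_sub_C, Polynomial.degree_X_add_C]
    norm_num
  change P.degree + _ ≤ P.degree at hdeg
  rw [hd, Polynomial.degree_X_sub_C] at hdeg
  exact absurd hdeg (by decide)

lemma kappa_site {n i : ℕ} (h : i + 2 ≤ n) :
    site n i (kappa q μ R) = kappa q μ (site n i R) := by
  rw [← siteHom_apply h, ← siteHom_apply h, map_kappa]

lemma bmwRel_site (h : IsBMWType q μ R) (n : ℕ) : BMWRel q μ n (fun i => site n i R) := by
  have hp := h.param
  have hdet := (Matrix.isUnit_iff_isUnit_det R).1 h.2.1.1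
  have hgen : ∀ i, i + 1 < n → BMWGen q μ (site n i R) (kappa q μ (site n i R)) := by
    intro i hi
    refine BMWGen.of_cubic hp ?_
    have := congrArg (siteHom N (show i + 2 ≤ n from hi)) h.cubic
    simpa only [map_mul, map_sub, map_add, AlgHom.commutes, siteHom_apply, map_zero] using this
  refine ⟨hgen, fun i hi => ?_, fun i j hij _ => site_commute hij R R⟩
  have hb : i + 3 ≤ n := hi
  obtain ⟨-, ⟨-, braid⟩, -, h1, h2, h3⟩ := h
  have e0 : ∀ X : TwoSite N, emb (block i 3 n hb) (site 3 0 X) = site n i X :=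
    fun X => emb_site hb (by omega) X
  have e1 : ∀ X : TwoSite N, emb (block i 3 n hb) (site 3 1 X) = site n (i + 1) X :=
    fun X => emb_site hb (by omega) X
  have k0 := kappa_site (q := q) (μ := μ) (R := R) (show i + 2 ≤ n by omega)
  have k1 := kappa_site (q := q) (μ := μ) (R := R) (show i + 1 + 2 ≤ n by omega)
  have tr := fun {X Y : TensorOp N 3 ℂ} (h : X = Y) => congrArg (emb (block i 3 n hb)) h
  have braid := tr braid
  have h1 := tr h1
  have h2 := tr h2
  have h3 := tr h3
  simp only [emb_mul (block_injective hb), e0, e1, k0, k1] at braid h1 h2 h3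
  refine BMWPair.of_rel (hgen i (by omega)) (hgen (i + 1) (by omega)) braid h1 ?_ h3
  have i0 : site n i R⁻¹ * site n i R = 1 := by
    rw [← siteHom_apply (show i + 2 ≤ n by omega), ← siteHom_apply (show i + 2 ≤ n by omega),
      ← map_mul, Matrix.nonsing_inv_mul R hdet, map_one]
  have i1 : site n (i + 1) R⁻¹ * site n (i + 1) R = 1 := by
    rw [← siteHom_apply (show i + 1 + 2 ≤ n by omega),
      ← siteHom_apply (show i + 1 + 2 ≤ n by omega),
      ← map_mul, Matrix.nonsing_inv_mul R hdet, map_one]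
  rw [h2, mul_assoc (_ * _) (site n (i + 1) R⁻¹), i1, mul_one, mul_assoc, i0, mul_one]

lemma BMWGen.of_injective {B B' : Type*} [Ring B] [Algebra ℂ B] [Ring B'] [Algebra ℂ B']
    (φ : B →ₐ[ℂ] B') (hφ : Function.Injective φ) {x k : B} (h : BMWGen q μ (φ x) (φ k)) :
    BMWGen q μ x k := by
  constructor <;> apply hφ <;> simp only [map_mul, map_add, map_sub, map_smul, map_one]
  exacts [h.sq, h.mul_k, h.k_mul, h.k_sq]

lemma BMWRel.of_injective {B B' : Type*} [Ring B] [Algebra ℂ B] [Ring B'] [Algebra ℂ B']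
    (φ : B →ₐ[ℂ] B') (hφ : Function.Injective φ) {n : ℕ} {r : ℕ → B}
    (h : BMWRel q μ n (fun i => φ (r i))) : BMWRel q μ n r := by
  have hk : ∀ i, kappa q μ (φ (r i)) = φ (kappa q μ (r i)) := fun i => (map_kappa φ _).symm
  have hgen : ∀ i, i + 1 < n → BMWGen q μ (r i) (kappa q μ (r i)) := fun i hi =>
    BMWGen.of_injective φ hφ (by rw [← hk]; exact h.gen i hi)
  refine ⟨hgen, fun i hi => ?_, fun i j hij hj => hφ ?_⟩
  · have hp := h.pair i hi
    simp only [hk] at hp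
    constructor
    · exact hgen _ (by omega)
    · exact hgen _ (by omega)
    all_goals apply hφ; simp only [map_mul]
    exacts [hp.braid, hp.kxyx, hp.kyxy, hp.xykx, hp.kyxy', hp.yxky, hp.kxyx']
  · simp only [map_mul]
    exact (h.comm i j hij hj).eq

lemma bmwRel_braidGen (h : IsBMWType q μ R) (n : ℕ) : BMWRel q μ n (braidGen R n) :=
  BMWRel.of_injective (braidImage R n).val Subtype.val_injective (bmwRel_site h n)

/-- The value of `p_0`. -/
lemma trace_dMatrix (h : IsBMWType q μ R) (hΨ : IsSkewInverse R Ψ) :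
    (dMatrix Ψ).trace = μ * loopValue q μ := by
  have hpair := (bmwRel_site h 3).pair 0 (by omega)
  simp only [zero_add] at hpair
  have hk : kappa q μ (site 3 0 R) = padLast (site 2 0 (kappa q μ R)) := by
    rw [padLast_site le_rfl, kappa_site (by omega)]
  have e1 : kappa q μ (site 3 0 R) * site 3 1 R * kappa q μ (site 3 0 R) =
      μ⁻¹ • kappa q μ (site 3 0 R) := by
    have : μ • (kappa q μ (site 3 0 R) * site 3 1 R * kappa q μ (site 3 0 R)) =
        kappa q μ (site 3 0 R) := by
      rw [← smul_mul_assoc, ← smul_mul_assoc, ← hpair.gen_x.k_mul, mul_assoc, mul_assoc,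
        ← mul_assoc (site 3 0 R), hpair.xykx, ← mul_assoc, hpair.kxyx]
    rw [← this, smul_smul, this, inv_mul_cancel₀ h.param.mu_ne, one_smul]
  -- In `κ₁ R₂ κ₁ = μ⁻¹ κ₁` the weighted trace over the last factor sends `R₂` to `1` and the
  -- identity to `Tr D`. So `κ² = μ⁻¹ (Tr D) κ`, and comparison with `κ² = δ κ`, for the loop value
  -- `δ` and `κ ≠ 0`, gives `Tr D = μ δ`.
  have e2 := congrArg (ptr (dMatrix Ψ)) e1
  have hlin : ptr (dMatrix Ψ) (μ⁻¹ • padLast (site 2 0 (kappa q μ R))) =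
      (μ⁻¹ * (dMatrix Ψ).trace) • site 2 0 (kappa q μ R) := by
    have : μ⁻¹ • padLast (site 2 0 (kappa q μ R)) =
        padLast (μ⁻¹ • site 2 0 (kappa q μ R)) * 1 := by
      rw [mul_one]
      exact (map_smul (embHom (block 0 2 3 (by omega)) (block_injective _)) _ _).symm
    rw [this, ptr_padLast_mul, ptr_one, smul_mul_smul_comm, mul_one]
  rw [hk, ptr_mul_padLast, ptr_padLast_mul, ptr_site_last hΨ, mul_one, hlin] at e2
  have hsq := congrArg (siteHom N (le_refl (0 + 2))) (BMWGen.of_cubic h.param h.cubic).k_sq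
  rw [map_mul, siteHom_apply, map_smul, siteHom_apply, e2] at hsq
  rw [← sub_eq_zero, ← sub_smul, smul_eq_zero] at hsq
  rcases hsq with hsq | hsq
  · have := h.param.mu_ne
    field_simp at hsq
    linear_combination hsq
  · exfalso
    apply h.kappa_ne_zero
    rw [← twoSiteHom_apply] at hsq
    exact (Matrix.reindexAlgEquiv ℂ ℂ (finTwoArrowEquiv (Fin N)).symm).injective
      (hsq.trans (map_zero _).symm)

lemma emb_mem_braidImage {s n L : ℕ} (h : s + n ≤ L) {X : TensorOp N n ℂ}
    (hX : X ∈ braidImage R n) : emb (block s n L h) X ∈ braidImage R L := by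
  have : braidImage R n ≤ (braidImage R L).comap (embHom (block s n L h) (block_injective h)) := by
    refine Algebra.adjoin_le ?_
    rintro _ (⟨m, rfl⟩ | ⟨m, rfl⟩)
    · by_cases hm : m + 2 ≤ n
      · change emb (block s n L h) (site n m R) ∈ braidImage R L
        rw [emb_site h hm]
        exact Algebra.subset_adjoin (Or.inl ⟨_, rfl⟩)
      · simp only [site_of_le hm]
        exact zero_mem _
    · by_cases hm : m + 2 ≤ n
      · change emb (block s n L h) (site n m R⁻¹) ∈ braidImage R L
        rw [emb_site h hm]
        exact Algebra.subset_adjoin (Or.inr ⟨_, rfl⟩)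
      · simp only [site_of_le hm]
        exact zero_mem _
  exact this hX

/-- The embedding of `ρ_R(ℂ[B_n])` into `ρ_R(ℂ[B_L])` on the strands `s, …, s + n - 1`. -/
def braidEmb (R : TwoSite N) (s : ℕ) {n L : ℕ} (h : s + n ≤ L) :
    braidImage R n →ₐ[ℂ] braidImage R L :=
  ((embHom (block s n L h) (block_injective h)).comp (braidImage R n).val).codRestrict _
    fun X => emb_mem_braidImage h X.2

lemma braidEmb_braidGen (s : ℕ) {n L : ℕ} (h : s + n ≤ L) {i : ℕ} (hi : i + 1 < n) :
    braidEmb R s h (braidGen R n i) = braidGen R L (s + i) :=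
  Subtype.ext (emb_site h (show i + 2 ≤ n from hi) R)

/-- `ch` as a linear map. -/
def chLinear (R F Ψ : TwoSite N) (n : ℕ) : braidImage R n →ₗ[ℂ] charSubalgebra R F Ψ where
  toFun := ch R F Ψ n
  map_add' X Y := Subtype.ext <| by
    change fullTrace _ (_ * scalHom _ N n (X.1 + Y.1)) = fullTrace _ (_ * scalHom _ N n X.1) +
      fullTrace _ (_ * scalHom _ N n Y.1)
    simp only [fullTrace_eq_trace, map_add, mul_add, Matrix.trace_add]
  map_smul' c X := Subtype.ext <| by
    change fullTrace _ (_ * scalHom _ N n (c • X.1)) = c • fullTrace _ (_ * scalHom _ N n X.1)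
    simp only [fullTrace_eq_trace, map_smul, mul_smul_comm, Matrix.trace_smul]

lemma ch_zero_one : ch R F Ψ 0 1 = 1 := Subtype.ext <| by
  change fullTrace (dMatrix Ψ) (copyProd F (genMatrix R F) 0 * scal _ 1) = 1
  rw [scal_one]
  simp [fullTrace, copyProd]

/-- The tower of braid group images, with the characters `ch`. -/
def braidTower (h : IsBMWType q μ R) (hRF : IsCompatiblePair R F) (hΨ : IsSkewInverse R Ψ) :
    BMWTower q μ (fun L => braidImage R L) (charSubalgebra R F Ψ) where
  r L := braidGen R L
  rel L := bmwRel_braidGen h L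
  ch := chLinear R F Ψ
  ch_comm L x y := Subtype.ext (chValue_comm hRF hΨ y.2)
  incl {m L} h := braidEmb R 0 (by omega)
  incl_r h i hi := (braidEmb_braidGen 0 _ hi).trans (by rw [zero_add])
  shift s h := braidEmb R s h
  shift_r s h i hi := braidEmb_braidGen s h hi
  ch_mul h x y := Subtype.ext (chValue_mul hRF hΨ h x.2 y.2)
  ch_one := ch_zero_one

end Realisation

/-! ### The symmetry `q ↦ -q⁻¹`. -/

section Dual

variable {q μ : ℂ} {B : Type*} [Ring B] [Algebra ℂ B]

lemma BMWGen.dual {x k : B} (h : BMWGen q μ x k) : BMWGen (-q⁻¹) μ x k := by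
  have hl : -q⁻¹ - (-q⁻¹)⁻¹ = q - q⁻¹ := by rw [inv_neg, inv_inv]; ring
  exact ⟨by rw [hl]; exact h.sq, h.mul_k, h.k_mul, by rw [loopValue_dual]; exact h.k_sq⟩

lemma BMWRel.dual {n : ℕ} {r : ℕ → B} (h : BMWRel q μ n r) : BMWRel (-q⁻¹) μ n r := by
  refine ⟨fun i hi => ?_, fun i hi => ?_, h.comm⟩
  · rw [kappa_dual]; exact (h.gen i hi).dual
  · rw [kappa_dual, kappa_dual]
    exact { h.pair i hi with
      gen_x := (h.pair i hi).gen_x.dual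
      gen_y := (h.pair i hi).gen_y.dual }

/-- The same tower for the parameter `-q⁻¹`, which exchanges symmetrizers and
antisymmetrizers. -/
def BMWTower.dual {B : ℕ → Type} [∀ L, Ring (B L)] [∀ L, Algebra ℂ (B L)] {C : Type} [Ring C]
    [Algebra ℂ C] (𝒯 : BMWTower q μ B C) : BMWTower (-q⁻¹) μ B C :=
  { 𝒯 with rel := fun L => (𝒯.rel L).dual }

end Dual

/-! ### The tower elements as elements of the characteristic subalgebra. -/

section Identification

variable {N : ℕ} {q μ : ℂ} {R F Ψ : TwoSite N} (h : IsBMWType q μ R)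
  (hRF : IsCompatiblePair R F) (hΨ : IsSkewInverse R Ψ)

lemma braidTower_a (m : ℕ) : (braidTower h hRF hΨ).a m = elemSym q μ R F Ψ m := rfl

lemma braidTower_dual_a (m : ℕ) : (braidTower h hRF hΨ).dual.a m = complSym q μ R F Ψ m := by
  rw [complSym, symmetrizer_eq]
  rfl

lemma braidTower_g : (braidTower h hRF hΨ).g = contraction q μ R F Ψ := by
  rw [BMWTower.g, contraction, loopValue, inv_div]
  rfl

lemma braidTower_dual_g : (braidTower h hRF hΨ).dual.g = contraction q μ R F Ψ := by
  rw [← braidTower_g h hRF hΨ, BMWTower.g, BMWTower.g, loopValue_dual, BMWTower.k, kappa_dual]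
  rfl

lemma prod_reverse_range {B : Type*} [Ring B] (r : ℕ → B) (n : ℕ) :
    ((List.range n).reverse.map r).prod = desc r 0 n := by
  induction n with
  | zero => rfl
  | succ n ih =>
    rw [List.range_succ, List.reverse_append, List.reverse_singleton, List.singleton_append,
      List.map_cons, List.prod_cons, ih, desc, zero_add]

lemma braidTower_p (n : ℕ) : (braidTower h hRF hΨ).p n = powerSum R F Ψ (n + 1) := by
  rw [powerSum, prod_reverse_range]
  rfl

lemma braidTower_dual_p (n : ℕ) : (braidTower h hRF hΨ).dual.p n = powerSum R F Ψ (n + 1) :=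
  braidTower_p h hRF hΨ n

lemma powerSum_zero (h : IsBMWType q μ R) (hΨ : IsSkewInverse R Ψ) :
    powerSum R F Ψ 0 = algebraMap ℂ _ (μ * loopValue q μ) := by
  rw [powerSum, trace_dMatrix h hΨ]

lemma braidTower_height {k : ℕ} (hk : HasHeight q μ R k) :
    (braidTower h hRF hΨ).asym (k + 1) k *
      sigmaMinus q μ ((q⁻¹) ^ (2 * k)) ((braidTower h hRF hΨ).r (k + 1) (k - 1)) *
      (braidTower h hRF hΨ).asym (k + 1) k = 0 := by
  apply Subtype.val_injective
  have := hk.2.2.2.2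
  have e1 : (braidImage R (k + 1)).val (antisymmetrizer q μ (braidGen R (k + 1)) k) =
      antisymmetrizer q μ (fun m => site (k + 1) m R) k := map_antisymmetrizer _ _ _
  have e2 : (braidImage R (k + 1)).val
      (sigmaMinus q μ ((q⁻¹) ^ (2 * k)) (braidGen R (k + 1) (k - 1))) =
      sigmaMinus q μ ((q⁻¹) ^ (2 * k)) (site (k + 1) (k - 1) R) := map_sigmaMinus _ _ _
  rw [← e1, ← e2, ← map_mul, ← map_mul] at this
  exact this

end Identification

/-! ### Newton relations as a triangular system. -/

section Newton

variable {C : Type*} [Ring C] [Algebra ℂ C]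

/-- The part of the Newton relation number `m` that involves only `a_0, …, a_{m-1}`. -/
def newtonRest (q μ : ℂ) (p : ℕ → C) (g : C) (a : ℕ → C) (m : ℕ) : C :=
  ∑ i ∈ Finset.range m, (-q) ^ i • (a i * p (m - i)) -
    (-1 : ℂ) ^ m • ∑ i ∈ Finset.Icc 1 (m / 2),
      (μ * q ^ ((m : ℤ) - 2 * i) - q ^ (1 - (m : ℤ) + 2 * i)) • (a (m - 2 * i) * g ^ i)

/-- The Newton relations up to order `n`. -/
def Newton (q μ : ℂ) (p : ℕ → C) (g : C) (n : ℕ) (a : ℕ → C) : Prop :=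
  a 0 = 1 ∧ ∀ m, 1 ≤ m → m ≤ n → newtonRest q μ p g a m = ((-1) ^ (m - 1) * qnum q m) • a m

variable {q μ : ℂ} {p : ℕ → C} {g : C}

lemma newtonRest_congr {a b : ℕ → C} {m : ℕ} (h : ∀ i < m, a i = b i) :
    newtonRest q μ p g a m = newtonRest q μ p g b m := by
  unfold newtonRest
  congr 1
  · exact Finset.sum_congr rfl fun i hi => by rw [h i (Finset.mem_range.1 hi)]
  · congr 1
    refine Finset.sum_congr rfl fun i hi => ?_
    obtain ⟨h1, h2⟩ := Finset.mem_Icc.1 hi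
    rw [h (m - 2 * i) (by omega)]

lemma newton_coeff_ne_zero (hl : q - q⁻¹ ≠ 0) {n : ℕ}
    (hn : ∀ i, 2 ≤ i → i ≤ n → qnum q i ≠ 0) {m : ℕ} (h1 : 1 ≤ m) (h2 : m ≤ n) :
    ((-1) ^ (m - 1) * qnum q m : ℂ) ≠ 0 := by
  refine mul_ne_zero (pow_ne_zero _ (by norm_num)) ?_
  rcases Nat.lt_or_ge m 2 with h | h
  · obtain rfl : m = 1 := by omega
    rw [qnum_one hl]
    exact one_ne_zero
  · exact hn m h h2

lemma Newton.mono {n n' : ℕ} {a : ℕ → C} (h : Newton q μ p g n a) (hn : n' ≤ n) :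
    Newton q μ p g n' a :=
  ⟨h.1, fun m h1 h2 => h.2 m h1 (h2.trans hn)⟩

/-- The system is triangular with diagonal entries `± m_q`, which are invertible. -/
lemma Newton.unique (hl : q - q⁻¹ ≠ 0) {n : ℕ} (hn : ∀ i, 2 ≤ i → i ≤ n → qnum q i ≠ 0)
    {a b : ℕ → C} (ha : Newton q μ p g n a) (hb : Newton q μ p g n b) : ∀ m ≤ n, a m = b m := by
  intro m
  induction m using Nat.strong_induction_on with
  | _ m ih =>
    intro hm
    rcases Nat.eq_zero_or_pos m with rfl | h1
    · rw [ha.1, hb.1]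
    · have h := (ha.2 m h1 hm).symm.trans
        ((newtonRest_congr fun i hi => ih i hi (by omega)).trans (hb.2 m h1 hm))
      exact smul_right_injective C (newton_coeff_ne_zero hl hn h1 hm) h

lemma Newton.exists (hl : q - q⁻¹ ≠ 0) {n : ℕ} (hn : ∀ i, 2 ≤ i → i ≤ n → qnum q i ≠ 0) :
    ∃ a, Newton q μ p g n a := by
  induction n with
  | zero => exact ⟨fun _ => 1, rfl, fun m h1 h2 => by omega⟩
  | succ n ih =>
    obtain ⟨a, h0, ha⟩ := ih fun i h1 h2 => hn i h1 (by omega)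
    let v : C := ((-1) ^ n * qnum q (n + 1))⁻¹ • newtonRest q μ p g a (n + 1)
    have hlt : ∀ i < n + 1, Function.update a (n + 1) v i = a i := fun i hi =>
      Function.update_of_ne (by omega) _ _
    refine ⟨Function.update a (n + 1) v, (hlt 0 (by omega)).trans h0, fun m h1 h2 => ?_⟩
    rw [newtonRest_congr (b := a) fun i hi => hlt i (by omega)]
    rcases Nat.lt_or_ge m (n + 1) with hm | hm
    · rw [hlt m hm]
      exact ha m h1 (by omega)
    · obtain rfl : m = n + 1 := by omega
      have hc := newton_coeff_ne_zero hl hn h1 le_rfl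
      rw [Nat.add_sub_cancel] at hc
      rw [Function.update_self, Nat.add_sub_cancel, smul_smul, mul_inv_cancel₀ hc, one_smul]

end Newton

section Dual

variable {C : Type*} [Ring C] [Algebra ℂ C] {q μ : ℂ}

lemma qnum_dual_ne_zero {n : ℕ} (hn : ∀ i, 2 ≤ i → i ≤ n → qnum q i ≠ 0) :
    ∀ i, 2 ≤ i → i ≤ n → qnum (-q⁻¹) i ≠ 0 := by
  intro i h1 h2
  obtain ⟨j, rfl⟩ : ∃ j, i = j + 1 := ⟨i - 1, by omega⟩
  rw [qnum_dual]
  exact mul_ne_zero (pow_ne_zero _ (by norm_num)) (hn _ h1 h2)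

/-- Only signs are at stake. The exponents `m - 2i` and `1 - m + 2i` have opposite parity, so with
the prefactor `(-1)^m` one sign cancels and the other turns the difference of powers into a sum. -/
lemma newton_dual_iff {p : ℕ → C} {g : C} {n : ℕ} {s : ℕ → C} :
    Newton (-q⁻¹) μ p g n s ↔ s 0 = 1 ∧ ∀ m, 1 ≤ m → m ≤ n →
      ∑ i ∈ Finset.range m, (q⁻¹) ^ i • (s i * p (m - i)) =
      qnum q m • s m +
        ∑ i ∈ Finset.Icc 1 (m / 2),
          (μ * q ^ (2 * (i : ℤ) - m) + q ^ ((m : ℤ) - 2 * i - 1)) • (s (m - 2 * i) * g ^ i) := by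
  refine and_congr_right fun _ => forall_congr' fun m => forall_congr' fun h1 =>
    forall_congr' fun _ => ?_
  obtain ⟨l, rfl⟩ : ∃ l, m = l + 1 := ⟨m - 1, by omega⟩
  have hsign : ((-1 : ℂ) ^ l) * (-1) ^ l = 1 := by rw [← mul_pow]; norm_num
  have hsum : (-1 : ℂ) ^ (l + 1) • ∑ i ∈ Finset.Icc 1 ((l + 1) / 2),
      (μ * (-q⁻¹) ^ (((l + 1 : ℕ) : ℤ) - 2 * i) - (-q⁻¹) ^ (1 - ((l + 1 : ℕ) : ℤ) + 2 * i)) •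
        (s (l + 1 - 2 * i) * g ^ i) =
      ∑ i ∈ Finset.Icc 1 ((l + 1) / 2),
        (μ * q ^ (2 * (i : ℤ) - (l + 1 : ℕ)) + q ^ (((l + 1 : ℕ) : ℤ) - 2 * i - 1)) •
          (s (l + 1 - 2 * i) * g ^ i) := by
    rw [Finset.smul_sum]
    refine Finset.sum_congr rfl fun i _ => ?_
    rw [smul_smul]
    congr 1
    have hm : ∀ z : ℤ, (-q⁻¹) ^ z = (-1) ^ z * q ^ (-z) := fun z => by
      rw [neg_eq_neg_one_mul, mul_zpow, inv_zpow']
    have h2 : ∀ z : ℤ, (-1 : ℂ) ^ (z * 2) = 1 := fun z => by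
      rw [mul_comm, zpow_mul]; norm_num
    have hne : (-1 : ℂ) ≠ 0 := by norm_num
    have e1 : (-1 : ℂ) ^ (l + 1) * (-1) ^ (((l + 1 : ℕ) : ℤ) - 2 * i) = 1 := by
      rw [← zpow_natCast, ← zpow_add₀ hne,
        show ((l + 1 : ℕ) : ℤ) + (((l + 1 : ℕ) : ℤ) - 2 * i) = (((l + 1 : ℕ) : ℤ) - i) * 2 by ring,
        h2]
    have e2 : (-1 : ℂ) ^ (l + 1) * (-1) ^ (1 - ((l + 1 : ℕ) : ℤ) + 2 * i) = -1 := by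
      rw [← zpow_natCast, ← zpow_add₀ hne,
        show ((l + 1 : ℕ) : ℤ) + (1 - ((l + 1 : ℕ) : ℤ) + 2 * i) = i * 2 + 1 by ring,
        zpow_add₀ hne, h2]
      norm_num
    rw [hm, hm, show -(((l + 1 : ℕ) : ℤ) - 2 * i) = 2 * (i : ℤ) - (l + 1 : ℕ) by ring,
      show -(1 - ((l + 1 : ℕ) : ℤ) + 2 * i) = ((l + 1 : ℕ) : ℤ) - 2 * i - 1 by ring]
    linear_combination (μ * q ^ (2 * (i : ℤ) - (l + 1 : ℕ))) * e1 -
      q ^ (((l + 1 : ℕ) : ℤ) - 2 * i - 1) * e2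
  rw [newtonRest, hsum, neg_neg, Nat.add_sub_cancel, qnum_dual, ← mul_assoc, hsign, one_mul,
    sub_eq_iff_eq_add]

end Dual

/-! ### Newton relations for `ch(a^{(m)})` and `ch(s^{(m)})`. -/

section Characters

variable {N : ℕ} {q μ : ℂ} {R F Ψ : TwoSite N}

lemma newtonElem_iff {n : ℕ} {a : ℕ → charSubalgebra R F Ψ} :
    NewtonElem q μ R F Ψ n a ↔
      Newton q μ (powerSum R F Ψ) (contraction q μ R F Ψ) n a := by
  refine and_congr_right fun _ => forall_congr' fun m => forall_congr' fun _ =>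
    forall_congr' fun _ => ?_
  rw [newtonRest, sub_eq_iff_eq_add]

lemma newtonCompl_iff {n : ℕ} {s : ℕ → charSubalgebra R F Ψ} :
    NewtonCompl q μ R F Ψ n s ↔
      Newton (-q⁻¹) μ (powerSum R F Ψ) (contraction q μ R F Ψ) n s := by
  rw [newton_dual_iff, NewtonCompl]

/-- Hook systems number the power sums from `0`, so `p i` there is `p_{i+1}` here. -/
lemma HookSystem.isNewton {C : Type*} [Ring C] [Algebra ℂ C] (hp : BMWParam q μ) {n : ℕ}
    {a p : ℕ → C} {g : C} {t u : ℕ → ℕ → ℕ → C}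
    (h : ∀ m ≤ n, HookSystem q μ m a (fun i => p (i + 1)) g (t m) (u m)) (hd : AsymDef q μ n) :
    Newton q μ p g n a := by
  refine ⟨(h 0 (by omega)).a_zero, fun m h1 h2 => ?_⟩
  have := HookSystem.newton hp h1 (hd.mono h2) (h m h2)
  rw [newtonRest, sub_eq_iff_eq_add, ← this]
  refine Finset.sum_congr rfl fun i hi => ?_
  have := Finset.mem_range.1 hi
  rw [show m - i - 1 + 1 = m - i by omega]

lemma newton_elemSym (h : IsBMWType q μ R) (hRF : IsCompatiblePair R F) (hΨ : IsSkewInverse R Ψ)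
    {n : ℕ} (hd : AsymDef q μ n) :
    Newton q μ (powerSum R F Ψ) (contraction q μ R F Ψ) n (elemSym q μ R F Ψ) := by
  refine HookSystem.isNewton (t := fun _ => (braidTower h hRF hΨ).t)
    (u := fun _ => (braidTower h hRF hΨ).u) h.param (fun m hm => ?_) hd
  have := (braidTower h hRF hΨ).hookSystem h.param (hd.mono hm)
  rwa [braidTower_g, funext (braidTower_p h hRF hΨ), funext (braidTower_a h hRF hΨ)] at this

lemma newton_complSym (h : IsBMWType q μ R) (hRF : IsCompatiblePair R F)
    (hΨ : IsSkewInverse R Ψ) {n : ℕ} (hd : AsymDef (-q⁻¹) μ n) :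
    Newton (-q⁻¹) μ (powerSum R F Ψ) (contraction q μ R F Ψ) n (complSym q μ R F Ψ) := by
  refine HookSystem.isNewton (t := fun _ => (braidTower h hRF hΨ).dual.t)
    (u := fun _ => (braidTower h hRF hΨ).dual.u) h.param.dual (fun m hm => ?_) hd
  have := (braidTower h hRF hΨ).dual.hookSystem h.param.dual (hd.mono hm)
  rwa [braidTower_dual_g, funext (braidTower_dual_p h hRF hΨ),
    funext (braidTower_dual_a h hRF hΨ)] at this

end Characters

/-! ### Solving the hook recursion for generating functions. -/

section Recursion

variable {A : Type*} [CommRing A] {k : ℕ} {T Y α β c : ℕ → A} {G : A}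

/-- The inhomogeneous term of the recursion for the generating functions of hooks. -/
def hookForce (α β : ℕ → A) (G : A) (M : ℕ) : A :=
  -∑ m ∈ Finset.range (M + 1), α m + G * ∑ m ∈ Finset.range M, (α m + β m)

/-- Summing the second relation expresses `∑ Y` through `c_M T_M` and a shorter sum of the `Y`, and
the first relation turns that shorter sum back into `T_M`. Thus `Y` drops out and a first order
recursion for `T` remains. -/
lemma hook_recursion (hT0 : T 0 = 0) (hY0 : Y 0 = 0)
    (hT : ∀ m ≤ k, T (m + 1) = T m + Y m - α m)
    (hY : ∀ m < k, Y (m + 1) = G * (c (m + 1) * T (m + 1) - c m * T m + Y m + β m)) :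
    ∀ M ≤ k, T (M + 1) = G * (1 + c M) * T M + hookForce α β G M := by
  intro M
  induction M with
  | zero =>
    intro _
    rw [hT 0 (by omega), hT0, hY0]
    simp [hookForce]
  | succ M ih =>
    intro hM
    have h1 := ih (by omega)
    have h2 := hT M (by omega)
    rw [hT (M + 1) hM, hY M (by omega)]
    unfold hookForce at h1 ⊢
    rw [Finset.sum_range_succ _ (M + 1), Finset.sum_range_succ (fun m => α m + β m)]
    linear_combination h1 - G * h2

/-- `∑_{m ≤ M} y^{M-m} x_m`. -/
def horner (x : ℕ → A) (y : A) (M : ℕ) : A := ∑ m ∈ Finset.range (M + 1), x m * y ^ (M - m)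

lemma horner_succ (x : ℕ → A) (y : A) (M : ℕ) :
    horner x y (M + 1) = y * horner x y M + x (M + 1) := by
  rw [horner, Finset.sum_range_succ, horner, Finset.mul_sum, Nat.sub_self, pow_zero, mul_one]
  congr 1
  refine Finset.sum_congr rfl fun m hm => ?_
  have := Finset.mem_range.1 hm
  rw [show M + 1 - m = M - m + 1 by omega, pow_succ]
  ring

lemma horner_zero (x : ℕ → A) (y : A) : horner x y 0 = x 0 := by simp [horner]

lemma mul_horner (x : ℕ → A) (y : A) (M : ℕ) :
    y * horner x y M = ∑ m ∈ Finset.range (M + 1), x m * y ^ (M + 1 - m) := by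
  rw [horner, Finset.mul_sum]
  refine Finset.sum_congr rfl fun m hm => ?_
  have := Finset.mem_range.1 hm
  rw [show M + 1 - m = M - m + 1 by omega, pow_succ]
  ring

lemma horner_hookForce (y : A) (M : ℕ) :
    (1 - y) * horner (hookForce α β G) y M =
      -(∑ m ∈ Finset.range (M + 1), α m - y * horner α y M) +
        G * (∑ m ∈ Finset.range (M + 1), (α m + β m) - horner α y M - horner β y M) := by
  induction M with
  | zero =>
    simp only [horner_zero, hookForce, zero_add, Finset.sum_range_one, Finset.sum_range_zero]
    ring
  | succ M ih =>
    simp only [horner_succ]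
    rw [Finset.sum_range_succ _ (M + 1), Finset.sum_range_succ _ (M + 1)]
    rw [mul_add, mul_left_comm, ih, hookForce, Finset.sum_range_succ _ (M + 1)]
    ring

/-- Multiplied by `1 - v_M`, the recursion has the constant homogeneous factor `q2 · G`, at the
price of the inhomogeneous term `(1 - v_M) f_M`. As `v` is geometric with ratio `q2`, the two parts
of this term sum to Horner sums at `q2 · G` and at `G`. -/
lemma horner_closed {q2 : A} {v : ℕ → A} (hT0 : T 0 = 0)
    (hrec : ∀ M ≤ k, T (M + 1) = G * (1 + c M) * T M + hookForce α β G M)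
    (hv : ∀ M < k, v (M + 1) = q2 * v M)
    (hc : ∀ M < k, (1 - v (M + 1)) * (1 + c (M + 1)) = q2 * (1 - v M)) :
    ∀ M ≤ k, (1 - v M) * T (M + 1) =
      horner (hookForce α β G) (q2 * G) M - v M * horner (hookForce α β G) G M := by
  intro M
  induction M with
  | zero =>
    intro _
    rw [hrec 0 (by omega), hT0, horner_zero, horner_zero]
    ring
  | succ M ih =>
    intro hM
    rw [hrec (M + 1) hM, horner_succ, horner_succ]
    linear_combination G * T (M + 1) * hc M (by omega) + q2 * G * ih (by omega) +
      G * horner (hookForce α β G) G M * hv M (by omega)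

variable {q i μ l z P : A} {a : ℕ → A}

/-- `∑_{m ≤ k} a_m (-z)^m s^m y^{k+1-m}`. -/
def hookTail (a : ℕ → A) (z : A) (k : ℕ) (s y : A) : A :=
  ∑ m ∈ Finset.range (k + 1), a m * (-z) ^ m * s ^ m * y ^ (k + 1 - m)

/-- `∑_{m ≤ k} a_m (-z)^m s^m`. -/
def hookHead (a : ℕ → A) (z : A) (k : ℕ) (s : A) : A :=
  ∑ m ∈ Finset.range (k + 1), a m * (-z) ^ m * s ^ m

lemma hookTail_scale (hqi : q * i = 1) :
    hookTail a z k q G = q ^ (2 * k + 2) * hookTail a z k i (i ^ 2 * G) := by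
  rw [hookTail, hookTail, Finset.mul_sum]
  refine Finset.sum_congr rfl fun m hm => ?_
  have hm := Finset.mem_range.1 hm
  obtain ⟨j, hj⟩ : ∃ j, k + 1 = m + j := ⟨k + 1 - m, by omega⟩
  have e : q ^ (2 * k + 2) * i ^ m * (i ^ 2) ^ j = q ^ m := by
    rw [show 2 * k + 2 = m + m + 2 * j by omega, pow_add, pow_add, ← pow_mul]
    calc _ = q ^ m * (q * i) ^ m * (q * i) ^ (2 * j) := by ring
      _ = q ^ m := by rw [hqi]; simp
  rw [show k + 1 - m = j by omega, mul_pow, ← e]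
  ring

lemma hook_elimination {B1 B2 B3 Qp Qm : A} (hqi : q * i = 1)
    (h : (1 - G) * (-(1 - G) * ((q - i) * P * Qp + Qp - Qm) +
        (1 - i ^ 2) * ((q - i) * P * B1 + B1 - B3) + (q - i) * G * (μ * Qp - q * Qm) -
        (q - i) * i ^ 2 * (μ * B1 - q * B3)) =
      (i ^ 2 - G) * (-(1 - G) * ((q - i) * P * Qp + Qp - Qm) +
        (q - i) * G * (μ * Qp - q * Qm) - (q - i) * (μ * B1 - q * B2))) :
    (q - i) * ((q - i) * (1 - G) * P * (Qp - B1)) =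
      (q - i) * ((1 - q ^ 2 * G) * (Qm - B2) + ((q - i) * μ * G - 1 + G) * (Qp - B1)) := by
  grind

/-- The Horner sums of the inhomogeneous term are partial sums in `α` and `β` (`horner_hookForce`),
and these are expressed through heads and tails of the sequence `a`. Besides the four quantities in
the conclusion one unwanted tail `B3` occurs; it cancels in `hook_elimination`. -/
theorem hook_functional_equation (hqi : q * i = 1) (hl : l = q - i) (hlu : IsUnit l)
    (hμ : μ * q ^ (2 * k + 1) = -1) {n : ℕ → A} (hn : ∀ m, l * n m = q ^ m - i ^ m)
    (hα : ∀ m, α m = a m * (-z) ^ m * (q ^ m * P + n m))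
    (hβ : ∀ m, β m = a m * (-z) ^ m * (μ * q ^ m - q * i ^ m))
    (h : horner (hookForce α β G) (q ^ 2 * G) k = i ^ 2 * horner (hookForce α β G) G k) :
    l * (1 - G) * P * (hookHead a z k q - hookTail a z k q (q ^ 2 * G)) =
      (1 - q ^ 2 * G) * (hookHead a z k i - hookTail a z k i (i ^ 2 * G)) +
        (l * μ * G - 1 + G) * (hookHead a z k q - hookTail a z k q (q ^ 2 * G)) := by
  have e1 := horner_hookForce (α := α) (β := β) (G := G) G k
  have e2 := horner_hookForce (α := α) (β := β) (G := G) (q ^ 2 * G) k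
  rw [Finset.sum_add_distrib] at e1 e2
  set Qp := hookHead a z k q with hQp
  set Qm := hookHead a z k i with hQm
  set B1 := hookTail a z k q (q ^ 2 * G) with hB1
  set B2 := hookTail a z k i (i ^ 2 * G) with hB2
  set SA := ∑ m ∈ Finset.range (k + 1), α m
  set SB := ∑ m ∈ Finset.range (k + 1), β m
  set B3 := hookTail a z k i (q ^ 2 * G) with hB3
  have hSA : l * SA = l * P * Qp + Qp - Qm := by
    simp only [SA, hQp, hQm, hookHead, Finset.mul_sum, ← Finset.sum_add_distrib,
      ← Finset.sum_sub_distrib]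
    refine Finset.sum_congr rfl fun m _ => ?_
    rw [hα]
    linear_combination (a m * (-z) ^ m) * hn m
  have hSB : SB = μ * Qp - q * Qm := by
    simp only [SB, hQp, hQm, hookHead, Finset.mul_sum, ← Finset.sum_sub_distrib]
    refine Finset.sum_congr rfl fun m _ => ?_
    rw [hβ]
    ring
  have hYA : l * (q ^ 2 * G * horner α (q ^ 2 * G) k) = l * P * B1 + B1 - B3 := by
    rw [mul_horner]
    simp only [hB1, hB3, hookTail, Finset.mul_sum, ← Finset.sum_add_distrib,
      ← Finset.sum_sub_distrib]
    refine Finset.sum_congr rfl fun m _ => ?_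
    rw [hα]
    linear_combination (a m * (-z) ^ m * (q ^ 2 * G) ^ (k + 1 - m)) * hn m
  have hYB : q ^ 2 * G * horner β (q ^ 2 * G) k = μ * B1 - q * B3 := by
    rw [mul_horner]
    simp only [hB1, hB3, hookTail, Finset.mul_sum, ← Finset.sum_sub_distrib]
    refine Finset.sum_congr rfl fun m _ => ?_
    rw [hβ]
    ring
  have hi : i ^ (2 * k + 1) = -μ := by
    calc i ^ (2 * k + 1) = -(μ * q ^ (2 * k + 1)) * i ^ (2 * k + 1) := by rw [hμ]; ring
      _ = -μ * (q * i) ^ (2 * k + 1) := by ring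
      _ = -μ := by rw [hqi]; ring
  have hiB : hookTail a z k i G = i ^ (2 * k + 2) * B1 := hookTail_scale (by rw [mul_comm, hqi])
  -- Rescaling the tails by `q^{2k+2}` and `q^{-2k-2}` and using `μ q^{2k+1} = -1` exchanges the two
  -- tails, so no new quantity appears.
  have hGB : G * horner β G k = μ * B1 - q * B2 := by
    have : G * horner β G k = μ * hookTail a z k q G - q * hookTail a z k i G := by
      rw [mul_horner]
      simp only [hookTail, Finset.mul_sum, ← Finset.sum_sub_distrib]
      refine Finset.sum_congr rfl fun m _ => ?_
      rw [hβ]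
      ring
    rw [this, hookTail_scale hqi, hiB]
    linear_combination q * B2 * hμ - q * i * B1 * hi + (μ * B1) * hqi
  have hq2 : q ^ 2 * i ^ 2 = 1 := by rw [← mul_pow, hqi, one_pow]
  have e3 : (1 - G) * horner (hookForce α β G) G k =
      -(1 - G) * SA + G * SB - (μ * B1 - q * B2) := by
    rw [e1, ← hGB]; ring
  have e4 : l * ((1 - q ^ 2 * G) * horner (hookForce α β G) (q ^ 2 * G) k) =
      -(1 - G) * (l * SA) + (1 - i ^ 2) * (l * P * B1 + B1 - B3) + l * G * SB -
        l * i ^ 2 * (μ * B1 - q * B3) := by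
    rw [e2, ← hYA, ← hYB]
    linear_combination (l * G * horner α (q ^ 2 * G) k + l * G * horner β (q ^ 2 * G) k) * hq2
  have e5 : (1 - G) * (-(1 - G) * (l * SA) + (1 - i ^ 2) * (l * P * B1 + B1 - B3) + l * G * SB -
        l * i ^ 2 * (μ * B1 - q * B3)) =
      (i ^ 2 - G) * (-(1 - G) * (l * SA) + l * G * SB - l * (μ * B1 - q * B2)) := by
    rw [← e4, h]
    linear_combination l * (i ^ 2 - G) * e3 -
      G * (1 - G) * l * horner (hookForce α β G) G k * hq2
  rw [hSA, hSB] at e5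
  apply hlu.mul_left_cancel
  subst hl
  exact hook_elimination hqi e5

end Recursion

lemma HookSystem.map {C C' : Type*} [Ring C] [Algebra ℂ C] [Ring C'] [Algebra ℂ C'] {q μ : ℂ}
    {M : ℕ} {a p : ℕ → C} {g : C} {t u : ℕ → ℕ → C} (φ : C →ₐ[ℂ] C')
    (h : HookSystem q μ M a p g t u) :
    HookSystem q μ M (fun m => φ (a m)) (fun i => φ (p i)) (φ g) (fun m i => φ (t m i))
      (fun m i => φ (u m i)) where
  a_zero := by rw [h.a_zero, map_one]
  t_zero i := by rw [h.t_zero, map_zero]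
  u_zero i := by rw [h.u_zero, map_zero]
  t_self m hm := by rw [h.t_self m hm, map_smul]
  t_succ m i hm := by simp only [h.t_succ m i hm, map_sub, map_smul, map_mul]
  u_succ m i hm := by simp only [h.u_succ m i hm, map_sub, map_add, map_smul, map_mul]
  u_self m hm := by simp only [h.u_self m hm, map_smul, map_mul]

/-! ### The functional equation for power series of hooks. -/

section Series

open PowerSeries

variable {S : Type*} [CommRing S] [Algebra ℂ S]

lemma X_mul_mk_of_rec {a : S} {x y p u : ℕ → S} {b c n : ℂ}
    (h : ∀ i, x i = b • (a * p i) - y (i + 1) - c • u i) (h0 : y 0 = n • a) :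
    X * mk x = algebraMap ℂ S⟦X⟧ b * C a * (X * mk p) - mk y + algebraMap ℂ S⟦X⟧ n * C a -
      X * (algebraMap ℂ S⟦X⟧ c * mk u) := by
  ext i
  cases i with
  | zero =>
    simp [PowerSeries.algebraMap_apply, mul_assoc, h0, Algebra.smul_def]
  | succ i =>
    rw [mul_left_comm _ X]
    simp [coeff_succ_X_mul, PowerSeries.algebraMap_apply, mul_assoc, h, Algebra.smul_def,
      ← map_mul, coeff_C_mul]

lemma mk_of_rec {a g : S} {x x' y u : ℕ → S} {b b' c d n : ℂ}
    (h : ∀ i, x (i + 1) = (b • x' i + c • y (i + 1) - d • u i) * g)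
    (h0 : x 0 = (c * n - b') • (a * g)) (hy : y 0 = n • a) :
    mk x = C g * (algebraMap ℂ S⟦X⟧ b * (X * mk x') + algebraMap ℂ S⟦X⟧ c * mk y -
      X * (algebraMap ℂ S⟦X⟧ d * mk u)) - algebraMap ℂ S⟦X⟧ b' * (C a * C g) := by
  ext i
  rw [mul_left_comm _ X (mk x')]
  cases i with
  | zero =>
    simp [PowerSeries.algebraMap_apply, h0, hy, Algebra.smul_def]
    ring
  | succ i =>
    simp [PowerSeries.algebraMap_apply, h, Algebra.smul_def, ← map_mul, coeff_C_mul,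
      coeff_succ_X_mul]
    ring

/-- For each level the hooks are collected into a power series in the word length. The sign and
power `(-X)^m` make the level recursions homogeneous in degree, with `G = g X²` counting
contractions. -/
theorem hookSystem_series {q μ : ℂ} {k : ℕ} {a p : ℕ → S} {g : S} {t u : ℕ → ℕ → S}
    (hp : BMWParam q μ) (hd : ∀ i < k, μ + q * (q⁻¹) ^ (2 * (i + 1)) ≠ 0)
    (hμ : μ * q ^ (2 * k + 1) = -1) (h : HookSystem q μ k a p g t u)
    (hv : ∀ i, q ^ k • (a k * p i) - t k (i + 1) - (μ * gam q μ k) • u k i = 0) :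
    algebraMap ℂ S⟦X⟧ (q - q⁻¹) * (1 - C g * X ^ 2) * (X * mk p) *
        (hookHead (fun m => C (a m)) X k (algebraMap ℂ S⟦X⟧ q) -
          hookTail (fun m => C (a m)) X k (algebraMap ℂ S⟦X⟧ q)
            (algebraMap ℂ S⟦X⟧ q ^ 2 * (C g * X ^ 2))) =
      (1 - algebraMap ℂ S⟦X⟧ q ^ 2 * (C g * X ^ 2)) *
        (hookHead (fun m => C (a m)) X k (algebraMap ℂ S⟦X⟧ q⁻¹) -
          hookTail (fun m => C (a m)) X k (algebraMap ℂ S⟦X⟧ q⁻¹)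
            (algebraMap ℂ S⟦X⟧ q⁻¹ ^ 2 * (C g * X ^ 2))) +
      (algebraMap ℂ S⟦X⟧ (q - q⁻¹) * algebraMap ℂ S⟦X⟧ μ * (C g * X ^ 2) - 1 + C g * X ^ 2) *
        (hookHead (fun m => C (a m)) X k (algebraMap ℂ S⟦X⟧ q) -
          hookTail (fun m => C (a m)) X k (algebraMap ℂ S⟦X⟧ q)
            (algebraMap ℂ S⟦X⟧ q ^ 2 * (C g * X ^ 2))) := by
  have hq := hp.q_ne
  have hμ0 := hp.mu_ne
  have hqi : q * q⁻¹ = 1 := mul_inv_cancel₀ hq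
  set ι := algebraMap ℂ S⟦X⟧ with hι
  set G : S⟦X⟧ := C g * X ^ 2 with hG
  let cc : ℕ → ℂ := fun m => gam q μ m * q ^ 2 * (q⁻¹) ^ (2 * m)
  -- The cut-off encodes the height condition: with `T (k+1) = 0` the recursion `hT` remains true at
  -- `m = k`, by `hv`.
  let T : ℕ → S⟦X⟧ := fun m => if m ≤ k then (-X) ^ m * mk (t m) else 0
  let Y : ℕ → S⟦X⟧ := fun m => (-X) ^ m * (X * (ι (μ * gam q μ m) * mk (u m)))
  let α : ℕ → S⟦X⟧ := fun m => C (a m) * (-X) ^ m * (ι q ^ m * (X * mk p) + ι (qnum q m))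
  let β : ℕ → S⟦X⟧ := fun m => C (a m) * (-X) ^ m * (ι μ * ι q ^ m - ι q * ι q⁻¹ ^ m)
  -- In the range used this is `-μ q^{2m-1}`, thanks to `μ = -q^{-1-2k}`. With `c_m = γ_m q^{2-2m}`
  -- one has `1 + c_{m+1} = (μ + q^{1-2m})/(μ + q^{-1-2m})`, and `1 - v` is the integrating factor
  -- for this ratio.
  let v : ℕ → S⟦X⟧ := fun m => ι q⁻¹ ^ (2 * (k + 1 - m))
  have hT : ∀ m ≤ k, T (m + 1) = T m + Y m - α m := by
    intro m hm
    have key : ∀ x : ℕ → S, (∀ i, x i = q ^ m • (a m * p i) - t m (i + 1) -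
        (μ * gam q μ m) • u m i) → (-X) ^ (m + 1) * mk x = T m + Y m - α m := by
      intro x hx
      have := X_mul_mk_of_rec hx (h.t_self m hm)
      simp only [T, Y, α, if_pos hm, ← map_pow]
      linear_combination (-(-X) ^ m) * this
    rcases Nat.lt_or_ge m k with hm' | hm'
    · rw [← key _ fun i => h.t_succ m i hm']
      simp only [T]
      rw [if_pos (by omega)]
    · obtain rfl : m = k := by omega
      rw [← key (fun _ => 0) fun i => (hv i).symm]
      simp only [T]
      rw [if_neg (by omega), show (mk fun _ => (0 : S)) = 0 from by ext; simp, mul_zero]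
  have hcc : ∀ m, cc (m + 1) = gam q μ (m + 1) * (q⁻¹) ^ (2 * m) := by
    intro m
    simp only [cc]
    rw [show 2 * (m + 1) = 2 * m + 2 by ring, pow_add]
    have : q ^ 2 * (q⁻¹) ^ 2 = 1 := by rw [← mul_pow, hqi, one_pow]
    linear_combination gam q μ (m + 1) * (q⁻¹) ^ (2 * m) * this
  have hY : ∀ m < k, Y (m + 1) =
      G * (ι (cc (m + 1)) * T (m + 1) - ι (cc m) * T m + Y m + β m) := by
    intro m hm
    have h1 : ∀ i, (μ * gam q μ (m + 1)) • u (m + 1) (i + 1) =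
        (cc (m + 1) • t (m + 1) i + cc m • t m (i + 1) - (μ * gam q μ m) • u m i) * g := by
      intro i
      rw [mul_smul, h.gam_u_succ hp hd hm i, hcc, ← smul_mul_assoc]
      congr 1
      simp only [cc]
      match_scalars <;> field_simp
    have h2 : (μ * gam q μ (m + 1)) • u (m + 1) 0 =
        (cc m * qnum q m - (μ * q ^ m - q * (q⁻¹) ^ m)) • (a m * g) := by
      rw [h.u_self m hm, smul_smul, ← HookSystem.gam_u_self hp (N := m) fun i hi => hd i (by omega)]
      congr 1
      simp only [cc]
      ring
    have h3 := mk_of_rec (x := fun i => (μ * gam q μ (m + 1)) • u (m + 1) i) h1 h2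
      (h.t_self m hm.le)
    have h4 : (mk fun i => (μ * gam q μ (m + 1)) • u (m + 1) i) =
        ι (μ * gam q μ (m + 1)) * mk (u (m + 1)) := by
      rw [hι, ← Algebra.smul_def]; rfl
    rw [h4] at h3
    simp only [Y, T, β, if_pos hm.le, if_pos (show m + 1 ≤ k from hm), hG]
    rw [h3]
    simp only [map_sub, map_mul, map_pow]
    ring
  have hv' : ∀ M < k, v (M + 1) = ι q ^ 2 * v M := by
    intro M hM
    simp only [v]
    rw [show 2 * (k + 1 - M) = 2 + 2 * (k + 1 - (M + 1)) by omega, pow_add, ← mul_assoc, ← mul_pow,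
      ← map_mul, hqi, map_one, one_pow, one_mul]
  have hc : ∀ M < k, (1 - v (M + 1)) * (1 + ι (cc (M + 1))) = ι q ^ 2 * (1 - v M) := by
    intro M hM
    have e : gam q μ (M + 1) * (μ + q * (q⁻¹) ^ (2 * (M + 1))) = q - q⁻¹ :=
      div_mul_cancel₀ _ (hd M hM)
    have e1 : (q⁻¹) ^ (2 * (k + 1 - (M + 1))) = -μ * q ^ (2 * M + 1) := by
      have : q ^ (2 * k + 1) = q ^ (2 * (k - M)) * q ^ (2 * M + 1) := by
        rw [← pow_add]; congr 1; omega
      rw [this] at hμ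
      have h5 : q ^ (2 * (k - M)) * (q⁻¹) ^ (2 * (k - M)) = 1 := by
        rw [← mul_pow, hqi, one_pow]
      rw [show k + 1 - (M + 1) = k - M by omega]
      linear_combination (q⁻¹) ^ (2 * (k - M)) * hμ - μ * q ^ (2 * M + 1) * h5
    have key : (1 - (q⁻¹) ^ (2 * (k + 1 - (M + 1)))) * (1 + cc (M + 1)) =
        q ^ 2 * (1 - (q⁻¹) ^ (2 * (k + 1 - M))) := by
      have e2 : (q⁻¹) ^ (2 * (k + 1 - M)) = (q⁻¹) ^ 2 * (q⁻¹) ^ (2 * (k + 1 - (M + 1))) := by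
        rw [← pow_add]; congr 1; omega
      rw [e2, e1, hcc]
      rw [show 2 * (M + 1) = 2 * M + 2 by ring, pow_add] at e
      have h6 : q ^ (2 * M) * (q⁻¹) ^ (2 * M) = 1 := by rw [← mul_pow, hqi, one_pow]
      set y := (q⁻¹) ^ (2 * M)
      set w := q ^ (2 * M) with hw
      rw [pow_succ, ← hw]
      generalize gam q μ (M + 1) = γ at e ⊢
      generalize q⁻¹ = j at *
      grind
    have := congrArg ι key
    simpa only [map_mul, map_sub, map_add, map_one, map_pow] using this
  have hT0 : T 0 = 0 := by
    simp only [T]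
    rw [if_pos (by omega), show t 0 = fun _ => 0 from funext h.t_zero,
      show (mk fun _ => (0 : S)) = 0 from by ext; simp, mul_zero]
  have hY0 : Y 0 = 0 := by
    simp only [Y]
    rw [show u 0 = fun _ => 0 from funext h.u_zero,
      show (mk fun _ => (0 : S)) = 0 from by ext; simp, mul_zero, mul_zero, mul_zero]
  have hclosed := horner_closed (c := fun m => ι (cc m)) hT0
    (hook_recursion (c := fun m => ι (cc m)) hT0 hY0 hT hY) hv' hc k le_rfl
  have hTk : T (k + 1) = 0 := if_neg (by omega)
  have hvk : v k = ι q⁻¹ ^ 2 := by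
    simp only [v]
    rw [show 2 * (k + 1 - k) = 2 by omega]
  -- At the top level the left side vanishes and `v_k = q⁻²`, so the closed form becomes an equation
  -- between two known Horner sums, linear in the generating series of the power sums.
  rw [hTk, mul_zero, hvk] at hclosed
  refine hook_functional_equation (n := fun m => ι (qnum q m)) (α := α) (β := β)
    (by rw [← map_mul, hqi, map_one]) (map_sub ι q q⁻¹)
    ((isUnit_iff_ne_zero.2 hp.lam_ne).map ι) ?_ ?_ (fun m => rfl) (fun m => rfl)
    (sub_eq_zero.1 hclosed.symm)
  · rw [← map_pow, ← map_mul, hμ, map_neg, map_one]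
  · intro m
    rw [← map_pow, ← map_pow, ← map_sub, ← map_mul, qnum, mul_div_cancel₀ _ hp.lam_ne]

end Series

/-! ### Symmetric functions of paired variables. -/

section Symmetric

open Polynomial in
lemma coeff_prod_one_add {S : Type*} [CommRing S] (s : Multiset S) (j : ℕ) :
    (s.map fun r => 1 + C r * X).prod.coeff j = s.esymm j := by
  induction s using Multiset.induction_on generalizing j with
  | empty =>
    cases j with
    | zero => simp [Multiset.esymm]
    | succ j => simp [Multiset.esymm, Polynomial.coeff_one, Multiset.powersetCard_zero_right]
  | cons r s ih =>
    rw [Multiset.map_cons, Multiset.prod_cons, add_mul, one_mul, coeff_add, ih, mul_assoc,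
      coeff_C_mul]
    cases j with
    | zero => simp [Multiset.esymm]
    | succ j =>
      rw [coeff_X_mul, ih]
      simp only [Multiset.esymm, Multiset.powersetCard_cons, Multiset.map_add, Multiset.sum_add,
        Multiset.map_map, Function.comp_def, Multiset.prod_cons, Multiset.sum_map_mul_left]

open Polynomial in
lemma natDegree_prod_one_add {S : Type*} [CommRing S] (s : Multiset S) :
    (s.map fun r => 1 + C r * X).prod.natDegree ≤ s.card := by
  induction s using Multiset.induction_on with
  | empty => simp
  | cons r s ih =>
    rw [Multiset.map_cons, Multiset.prod_cons, Multiset.card_cons, add_comm s.card]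
    refine natDegree_mul_le.trans (add_le_add ?_ ih)
    refine (natDegree_add_le _ _).trans ?_
    simp only [natDegree_one]
    exact max_le (by omega) ((natDegree_C_mul_le r X).trans natDegree_X_le)

lemma prod_rev {A : Type*} [CommMonoid A] {k : ℕ} (f : Fin (2 * k) → A) {c : A}
    (h : ∀ i, f i * f i.rev = c) : ∏ i, f i = c ^ k := by
  have e : ∏ i, f i = ∏ i : Fin (k + k), f (Fin.cast (two_mul k).symm i) :=
    ((finCongr (two_mul k).symm).prod_comp f).symm
  rw [e, Fin.prod_univ_add,
    ← Equiv.prod_comp Fin.revPerm (fun i : Fin k => f (Fin.cast _ (Fin.natAdd k i))),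
    ← Finset.prod_mul_distrib]
  have : ∀ i : Fin k, f (Fin.cast (two_mul k).symm (Fin.castAdd k i)) *
      f (Fin.cast (two_mul k).symm (Fin.natAdd k (Fin.revPerm i))) = c := by
    intro i
    rw [← h (Fin.cast (two_mul k).symm (Fin.castAdd k i))]
    congr 2
    apply Fin.ext
    simp [Fin.val_rev]
    omega
  simp only [this, Finset.prod_const, Finset.card_univ, Fintype.card_fin]

variable {S : Type*} [CommRing S] {k : ℕ} {ν : Fin (2 * k) → S} {w : S}

/-- The elementary symmetric functions of `w, -w` and the `ν`'s. -/
def pairElem (ν : Fin (2 * k) → S) (w : S) (m : ℕ) : S :=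
  (w ::ₘ -w ::ₘ Finset.univ.val.map ν).esymm m

-- Substituting `X ↦ w² X` in `∏ (X + r)` turns it into a multiple of `∏ (1 + r X)`, because `ν_j`
-- and its partner multiply to `w²`. The sign comes from the extra pair `w, -w`, whose product is
-- `-w²`.
open Polynomial in
lemma pairElem_reciprocal_mul (hν : ∀ i, ν i * ν i.rev = w ^ 2) {j : ℕ} (hj : j ≤ 2 * k + 2) :
    pairElem ν w (2 * k + 2 - j) * (w ^ 2) ^ j = -(w ^ 2) ^ (k + 1) * pairElem ν w j := by
  set s : Multiset S := w ::ₘ -w ::ₘ Finset.univ.val.map ν with hs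
  have hcard : s.card = 2 * k + 2 := by simp [hs]
  have h1 : (s.map fun r => X + C r).prod.coeff j = pairElem ν w (2 * k + 2 - j) := by
    rw [Multiset.prod_X_add_C_coeff s (by omega), hcard]
    rfl
  have h2 := coeff_prod_one_add s j
  have e1 : (s.map fun r => X + C r).prod = (X + C w) * ((X + C (-w)) * ∏ i, (X + C (ν i))) := by
    rw [hs, Multiset.map_cons, Multiset.prod_cons, Multiset.map_cons, Multiset.prod_cons,
      Multiset.map_map]
    rfl
  have e2 : (s.map fun r => 1 + C r * X).prod =
      (1 + C w * X) * ((1 + C (-w) * X) * ∏ i, (1 + C (ν i) * X)) := by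
    rw [hs, Multiset.map_cons, Multiset.prod_cons, Multiset.map_cons, Multiset.prod_cons,
      Multiset.map_map]
    rfl
  have e3 : (s.map fun r => X + C r).prod.comp (C (w ^ 2) * X) =
      -C ((w ^ 2) ^ (k + 1)) * (s.map fun r => 1 + C r * X).prod := by
    rw [e1, e2]
    simp only [mul_comp, add_comp, X_comp, C_comp, prod_comp]
    have hprod : ∏ i, (C (w ^ 2) * X + C (ν i)) =
        C ((w ^ 2) ^ k) * ∏ i, (1 + C (ν i) * X) := by
      rw [← prod_rev ν hν, map_prod, ← Equiv.prod_comp Fin.revPerm (fun i => 1 + C (ν i) * X),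
        ← Finset.prod_mul_distrib]
      refine Finset.prod_congr rfl fun i _ => ?_
      rw [← hν i, map_mul, Fin.revPerm_apply]
      ring
    rw [hprod]
    simp only [map_pow, map_neg]
    ring
  have h3 := congrArg (fun p => p.coeff j) e3
  simp only [comp_C_mul_X_coeff] at h3
  rw [h1, neg_mul, coeff_neg, coeff_C_mul, h2] at h3
  rw [h3, neg_mul]
  rfl

lemma pairElem_reciprocal [IsDomain S] (hw : w ≠ 0) (hν : ∀ i, ν i * ν i.rev = w ^ 2) {j : ℕ}
    (hj : j ≤ k + 1) :
    pairElem ν w (2 * k + 2 - j) = -(w ^ 2) ^ (k + 1 - j) * pairElem ν w j := by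
  apply mul_right_cancel₀ (pow_ne_zero j (pow_ne_zero 2 hw))
  rw [pairElem_reciprocal_mul hν (by omega), show k + 1 = (k + 1 - j) + j by omega, pow_add,
    show k + 1 - j + j - j = k + 1 - j by omega]
  ring

variable [Algebra ℂ S]

/-- The reciprocity is antisymmetric about degree `k+1`, so the middle element is its own negative.
-/
lemma pairElem_middle [IsDomain S] (hw : w ≠ 0) (hν : ∀ i, ν i * ν i.rev = w ^ 2) :
    pairElem ν w (k + 1) = 0 := by
  have h := pairElem_reciprocal (j := k + 1) hw hν le_rfl
  rw [show 2 * k + 2 - (k + 1) = k + 1 by omega, Nat.sub_self, pow_zero] at h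
  have h2 : algebraMap ℂ S 2 * pairElem ν w (k + 1) = 0 := by
    rw [map_ofNat]
    linear_combination h
  refine (mul_eq_zero.1 h2).resolve_left ?_
  exact (map_ne_zero_iff _ (FaithfulSMul.algebraMap_injective ℂ S)).2 two_ne_zero

-- The left side is the full expansion of the product over `w, -w` and the `ν_j`, with each
-- coefficient above the middle rewritten by reciprocity through one below it. The right side is
-- that product, with the pair `w, -w` giving `1 - w² y²`.
open Polynomial in
lemma sum_pairElem [IsDomain S] (hw : w ≠ 0) (hν : ∀ i, ν i * ν i.rev = w ^ 2)
    {A : Type*} [CommRing A] [Algebra S A] (y : A) :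
    ∑ m ∈ Finset.range (k + 1), algebraMap S A (pairElem ν w m) * y ^ m *
        (1 - (algebraMap S A (w ^ 2) * y ^ 2) ^ (k + 1 - m)) =
      (1 - algebraMap S A (w ^ 2) * y ^ 2) * ∏ i, (1 + algebraMap S A (ν i) * y) := by
  set s : Multiset S := w ::ₘ -w ::ₘ Finset.univ.val.map ν with hs
  have hcard : s.card = 2 * k + 2 := by simp [hs]
  have e2 : (s.map fun r => 1 + C r * X).prod =
      (1 + C w * X) * ((1 + C (-w) * X) * ∏ i, (1 + C (ν i) * X)) := by
    rw [hs, Multiset.map_cons, Multiset.prod_cons, Multiset.map_cons, Multiset.prod_cons,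
      Multiset.map_map]
    rfl
  have h1 : aeval y (s.map fun r => 1 + C r * X).prod =
      (1 - algebraMap S A (w ^ 2) * y ^ 2) * ∏ i, (1 + algebraMap S A (ν i) * y) := by
    rw [e2]
    simp only [map_mul, map_add, map_one, aeval_C, aeval_X, map_prod, map_neg, map_pow]
    ring
  rw [← h1, aeval_eq_sum_range' (n := 2 * k + 3)
    (lt_of_le_of_lt (natDegree_prod_one_add s) (by omega))]
  simp only [coeff_prod_one_add]
  rw [show 2 * k + 3 = (k + 1) + (k + 2) by omega, Finset.sum_range_add _ (k + 1) (k + 2),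
    Finset.sum_range_succ' _ (k + 1)]
  have h0 : s.esymm (k + 1 + 0) = 0 := pairElem_middle hw hν
  rw [h0, zero_smul, add_zero,
    ← Finset.sum_range_reflect (fun j => s.esymm (k + 1 + (j + 1)) • y ^ (k + 1 + (j + 1))),
    ← Finset.sum_add_distrib]
  refine Finset.sum_congr rfl fun m hm => ?_
  have hm := Finset.mem_range.1 hm
  have e3 : k + 1 + (k + 1 - 1 - m + 1) = 2 * k + 2 - m := by omega
  have h3 : s.esymm (2 * k + 2 - m) = -(w ^ 2) ^ (k + 1 - m) * pairElem ν w m :=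
    pairElem_reciprocal hw hν (by omega)
  rw [e3, h3, Algebra.smul_def, Algebra.smul_def,
    show 2 * k + 2 - m = m + 2 * (k + 1 - m) by omega, pow_add, pow_mul, mul_pow]
  simp only [map_mul, map_neg, map_pow]
  change _ = algebraMap S A (pairElem ν w m) * y ^ m + _
  ring

open PowerSeries in
lemma hsymm_series {σ : Type*} [Fintype σ] [DecidableEq σ] (ν : σ → S) :
    (mk fun n => MvPolynomial.aeval ν (MvPolynomial.hsymm σ ℂ n)) * ∏ i, (1 - C (ν i) * X) = 1 := by
  have hgeom : ∀ r : S, (mk fun n => r ^ n) * (1 - C r * X) = 1 := by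
    intro r
    ext n
    rw [mul_sub, mul_one, ← mul_assoc, map_sub]
    cases n with
    | zero => simp
    | succ n =>
      rw [coeff_succ_mul_X, mul_comm, coeff_C_mul]
      simp [coeff_one, pow_succ, mul_comm]
  have hprod : (mk fun n => MvPolynomial.aeval ν (MvPolynomial.hsymm σ ℂ n)) =
      ∏ i, mk fun n => ν i ^ n := by
    ext n
    rw [coeff_mk, coeff_prod]
    simp only [coeff_mk, MvPolynomial.hsymm, map_sum]
    symm
    refine Finset.sum_bij' (fun l hl => (Sym.equivNatSum σ n).symm ⟨l, ?_⟩)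
      (fun s _ => (Sym.equivNatSum σ n s).1) ?_ ?_ ?_ ?_ ?_
    · have := (Finset.mem_finsuppAntidiag'.1 hl).1
      exact this
    · intros; exact Finset.mem_univ _
    · intro s _
      rw [Finset.mem_finsuppAntidiag']
      exact ⟨(Sym.equivNatSum σ n s).2, Finset.subset_univ _⟩
    · intro l hl; simp
    · intro s _; simp
    · intro l hl
      rw [map_multiset_prod, Multiset.map_map]
      change _ = (Multiset.map _ (((Sym.equivNatSum σ n).symm ⟨l, _⟩ : Sym σ n) : Multiset σ)).prod
      rw [Sym.coe_equivNatSum_symm_apply]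
      simp only [Function.comp_def, MvPolynomial.aeval_X]
      rw [Finsupp.toMultiset_map, Finsupp.prod_toMultiset, Finsupp.prod_mapDomain_index
        (fun _ => pow_zero _) (fun _ _ _ => pow_add _ _ _), Finsupp.prod_fintype _ _
        (fun _ => pow_zero _)]
  rw [hprod, ← Finset.prod_mul_distrib]
  exact Finset.prod_eq_one fun i _ => hgeom (ν i)

end Symmetric

/-! ### The functional equation of the power sums. -/

section SpectralSeries

open PowerSeries

variable {S : Type*} [CommRing S]

/-- The functional equation that characterizes the generating series of the power sums:
`(q - i)(1 - g z²) P ∏ (1 - q ν_j z) =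
  (1 - i² g z²) ∏ (1 - i ν_j z) + ((q - i) μ g z² - 1 + g z²) ∏ (1 - q ν_j z)`. -/
def SpectralSeries {σ : Type*} [Fintype σ] (q i μ g : S) (ν : σ → S) (P : S⟦X⟧) : Prop :=
  C (q - i) * (1 - C g * X ^ 2) * P * ∏ j, (1 - C (q * ν j) * X) =
    (1 - C (i ^ 2 * g) * X ^ 2) * ∏ j, (1 - C (i * ν j) * X) +
      (C ((q - i) * μ * g) * X ^ 2 - 1 + C g * X ^ 2) * ∏ j, (1 - C (q * ν j) * X)

lemma isUnit_of_constantCoeff_eq_one {f : S⟦X⟧} (h : constantCoeff f = 1) : IsUnit f :=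
  isUnit_iff_constantCoeff.2 (h ▸ isUnit_one)

lemma isUnit_prod_one_sub {σ : Type*} [Fintype σ] (ν : σ → S) :
    IsUnit (∏ j, (1 - C (ν j) * X) : S⟦X⟧) :=
  isUnit_of_constantCoeff_eq_one (by simp [map_prod])

lemma isUnit_one_sub_sq (g : S) : IsUnit (1 - C g * X ^ 2 : S⟦X⟧) :=
  isUnit_of_constantCoeff_eq_one (by simp)

lemma isUnit_spectralSeries_coeff {σ : Type*} [Fintype σ] {q i g : S} (ν : σ → S)
    (hl : IsUnit (q - i)) :
    IsUnit (C (q - i) * (1 - C g * X ^ 2) * ∏ j, (1 - C (q * ν j) * X) : S⟦X⟧) :=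
  ((hl.map C).mul (isUnit_one_sub_sq g)).mul (isUnit_prod_one_sub fun j => q * ν j)

lemma SpectralSeries.unique {σ : Type*} [Fintype σ] {q i μ g : S} {ν : σ → S} {P P' : S⟦X⟧}
    (hl : IsUnit (q - i)) (h : SpectralSeries q i μ g ν P) (h' : SpectralSeries q i μ g ν P') :
    P = P' := by
  apply (isUnit_spectralSeries_coeff (g := g) ν hl).mul_left_cancel
  rw [mul_right_comm, h, mul_right_comm _ _ P', h']

lemma SpectralSeries.exists {σ : Type*} [Fintype σ] {q i μ g : S} (ν : σ → S)
    (hl : IsUnit (q - i)) : ∃ P, SpectralSeries q i μ g ν P := by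
  obtain ⟨u, hu⟩ := isUnit_spectralSeries_coeff (g := g) ν hl
  refine ⟨(u⁻¹ : S⟦X⟧ˣ).val * ((1 - C (i ^ 2 * g) * X ^ 2) * ∏ j, (1 - C (i * ν j) * X) +
      (C ((q - i) * μ * g) * X ^ 2 - 1 + C g * X ^ 2) * ∏ j, (1 - C (q * ν j) * X)), ?_⟩
  rw [SpectralSeries, mul_right_comm, ← hu, Units.mul_inv_cancel_left]

lemma SpectralSeries.map {S' : Type*} [CommRing S'] (φ : S →+* S') {σ : Type*} [Fintype σ]
    {q i μ g : S} {ν : σ → S} {P : S⟦X⟧} (h : SpectralSeries q i μ g ν P) :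
    SpectralSeries (φ q) (φ i) (φ μ) (φ g) (fun j => φ (ν j)) (PowerSeries.map φ P) := by
  have := congrArg (PowerSeries.map φ) h
  simpa only [SpectralSeries, map_mul, map_add, map_sub, map_one, map_pow, map_prod,
    PowerSeries.map_C, PowerSeries.map_X] using this

variable [Algebra ℂ S] [IsDomain S]

theorem spectralSeries_of_hookSystem {q μ : ℂ} {k : ℕ} {a p : ℕ → S} {t u : ℕ → ℕ → S}
    {ν : Fin (2 * k) → S} {w : S} (hp : BMWParam q μ)
    (hd : ∀ i < k, μ + q * (q⁻¹) ^ (2 * (i + 1)) ≠ 0)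
    (hμ : μ * q ^ (2 * k + 1) = -1) (h : HookSystem q μ k a p (w ^ 2) t u)
    (hv : ∀ i, q ^ k • (a k * p i) - t k (i + 1) - (μ * gam q μ k) • u k i = 0)
    (hw : w ≠ 0) (hν : ∀ i, ν i * ν i.rev = w ^ 2) (ha : ∀ m ≤ k, a m = pairElem ν w m) :
    SpectralSeries (algebraMap ℂ S q) (algebraMap ℂ S q⁻¹) (algebraMap ℂ S μ) (w ^ 2) ν
      (X * mk p) := by
  have key := hookSystem_series hp hd hμ h hv
  have hqi : algebraMap ℂ S q * algebraMap ℂ S q⁻¹ = 1 := by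
    rw [← map_mul, mul_inv_cancel₀ hp.q_ne, map_one]
  have head : ∀ s : S, hookHead (fun m => C (a m)) X k (C s) -
      hookTail (fun m => C (a m)) X k (C s) (C s ^ 2 * (C (w ^ 2) * X ^ 2)) =
      (1 - C (s ^ 2 * w ^ 2) * X ^ 2) * ∏ j, (1 - C (s * ν j) * X) := by
    intro s
    have e := sum_pairElem hw hν (A := S⟦X⟧) (-(C s * X))
    rw [hookHead, hookTail, ← Finset.sum_sub_distrib]
    rw [PowerSeries.algebraMap_eq] at e
    refine (Finset.sum_congr rfl fun m hm => ?_).trans (e.trans ?_)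
    · rw [ha m (by have := Finset.mem_range.1 hm; omega)]
      ring
    · congr 1
      · simp only [map_mul, map_pow]
        ring
      · refine Finset.prod_congr rfl fun j _ => ?_
        rw [map_mul]
        ring
  simp only [PowerSeries.algebraMap_apply] at key
  rw [head, head] at key
  -- Every term contains `1 - q² w² z²`: twice from the pair `w, -w` in the product at `q`, once as
  -- the explicit factor in front of the product at `q⁻¹`.
  apply (isUnit_one_sub_sq (algebraMap ℂ S q ^ 2 * w ^ 2)).mul_left_cancel
  simp only [map_sub, map_mul, map_pow] at key ⊢
  linear_combination key

end SpectralSeries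

/-! ### Newton relations for the complete symmetric functions. -/

section Complete

open PowerSeries

variable {S : Type*} [CommRing S] {σ : Type*} [Fintype σ] {ν : σ → S} {H : S⟦X⟧}

lemma rescale_mul_prod (hH : H * ∏ j, (1 - C (ν j) * X) = 1) (s : S) :
    rescale s H * ∏ j, (1 - C (s * ν j) * X) = 1 := by
  have := congrArg (rescale s) hH
  rw [map_mul, map_one, map_prod] at this
  refine Eq.trans ?_ this
  congr 1
  refine Finset.prod_congr rfl fun j _ => ?_
  have e : rescale s (C (ν j)) = C (ν j) := by
    ext n
    rw [coeff_rescale, coeff_C]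
    split_ifs with h <;> simp [h]
  rw [map_sub, map_one, map_mul (rescale s), rescale_X, e, map_mul]
  ring

/-- `∑_{1 ≤ i ≤ m/2} x_{m-2i} g^i`. -/
def evenTail (x : ℕ → S) (g : S) (m : ℕ) : S :=
  ∑ i ∈ Finset.Icc 1 (m / 2), x (m - 2 * i) * g ^ i

lemma evenTail_succ_succ (x : ℕ → S) (g : S) (m : ℕ) :
    evenTail x g (m + 2) = g * (x m + evenTail x g m) := by
  rw [evenTail, show (m + 2) / 2 = m / 2 + 1 by omega, ← Finset.add_sum_Ioc_eq_sum_Icc (by omega)]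
  have : Finset.Ioc 1 (m / 2 + 1) = (Finset.Icc 1 (m / 2)).map (addRightEmbedding 1) := by
    rw [Finset.map_add_right_Icc]
    rfl
  rw [this, Finset.sum_map, mul_add, evenTail, Finset.mul_sum]
  congr 1
  · simp [mul_comm]
  · refine Finset.sum_congr rfl fun i _ => ?_
    rw [addRightEmbedding_apply, show m + 2 - 2 * (i + 1) = m - 2 * i by omega]
    ring

/-- The sum over `g^i` in a Newton relation is multiplication by `g z² / (1 - g z²)` on generating
series. -/
lemma mk_evenTail (x : ℕ → S) (g : S) :
    (1 - C g * X ^ 2) * mk (evenTail x g) = C g * X ^ 2 * mk x := by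
  have : mk (evenTail x g) = X ^ 2 * (C g * (mk x + mk (evenTail x g))) := by
    ext m
    rcases m with _ | _ | m
    · simp [evenTail, coeff_X_pow_mul']
    · simp [evenTail, coeff_X_pow_mul']
    · rw [show m + 1 + 1 = m + 2 from rfl, coeff_X_pow_mul, coeff_mk, evenTail_succ_succ,
        coeff_C_mul, map_add, coeff_mk, coeff_mk]
  linear_combination this

/-- The functional equation multiplied by `H(q z) H(i z)`, which inverts both products, and divided
by `1 - g z²`. Its coefficients are the Newton relations for `H`. -/
lemma newton_series {q i μ g : S} {P : S⟦X⟧} (hqi : q * i = 1)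
    (h : SpectralSeries q i μ g ν P) (hH : H * ∏ j, (1 - C (ν j) * X) = 1) :
    C (q - i) * (rescale i H * P) = rescale q H - rescale i H + C (q - i) *
      mk (evenTail (fun m => μ * (i ^ m * coeff m H) + i * (q ^ m * coeff m H)) g) := by
  have hq := rescale_mul_prod hH q
  have hi := rescale_mul_prod hH i
  have hD := mk_evenTail (fun m => μ * (i ^ m * coeff m H) + i * (q ^ m * coeff m H)) g
  have hx : mk (fun m => μ * (i ^ m * coeff m H) + i * (q ^ m * coeff m H)) =
      C μ * rescale i H + C i * rescale q H := by
    ext m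
    simp [coeff_rescale]
  rw [hx] at hD
  rw [SpectralSeries] at h
  set D := mk (evenTail (fun m => μ * (i ^ m * coeff m H) + i * (q ^ m * coeff m H)) g)
  set Eq' := ∏ j, (1 - C (q * ν j) * X)
  set Ei := ∏ j, (1 - C (i * ν j) * X)
  apply (isUnit_one_sub_sq g).mul_left_cancel
  have e : C q * C i = (1 : S⟦X⟧) := by rw [← map_mul, hqi, map_one]
  simp only [map_sub, map_mul, map_pow] at h ⊢
  linear_combination rescale i H * rescale q H * h - ((C q - C i) * (1 - C g * X ^ 2) * P *
    rescale i H - rescale i H * ((C q - C i) * C μ * C g * X ^ 2 - 1 + C g * X ^ 2)) * hq +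
    (1 - C i ^ 2 * (C g * X ^ 2)) * rescale q H * hi - (C q - C i) * hD -
    C g * X ^ 2 * rescale q H * e

lemma newton_complete {q i μ g : S} {P : S⟦X⟧} (hqi : q * i = 1)
    (h : SpectralSeries q i μ g ν P) (h0 : coeff 0 P = 0) {c : ℕ → S}
    (hH : mk c * ∏ j, (1 - C (ν j) * X) = 1) (m : ℕ) :
    (q - i) * ∑ l ∈ Finset.range m, i ^ l * (c l * coeff (m - l) P) =
      (q ^ m - i ^ m) * c m + (q - i) * ∑ l ∈ Finset.Icc 1 (m / 2),
        (μ * i ^ (m - 2 * l) + i * q ^ (m - 2 * l)) * (c (m - 2 * l) * g ^ l) := by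
  have := congrArg (coeff m) (newton_series hqi h hH)
  rw [map_add, coeff_C_mul, coeff_C_mul, coeff_mul, map_sub (coeff m),
    Finset.Nat.sum_antidiagonal_eq_sum_range_succ_mk, Finset.sum_range_succ] at this
  simp only [coeff_rescale, coeff_mk, Nat.sub_self, h0, mul_zero, add_zero, evenTail] at this
  simp only [← mul_assoc] at this ⊢
  rw [this, sub_mul (q ^ m)]
  congr 2
  refine Finset.sum_congr rfl fun l _ => ?_
  ring

end Complete

/-! ### Partial fractions: the weights as residues. -/

section Residues

open Polynomial

variable {L : Type*} [Field L] {k : ℕ} {q i μ w : L} {ν d : Fin (2 * k) → L}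

/-- The numbers `ν_j` come in pairs with product `w²` and are generic. -/
structure IsSpectrum (q : L) (w : L) (ν : Fin (2 * k) → L) : Prop where
  ne_zero : w ≠ 0
  pair : ∀ j, ν j * ν j.rev = w ^ 2
  inj : Function.Injective ν
  generic : ∀ j, (q * ν j) ^ 2 ≠ w ^ 2

/-- The weights attached to a spectrum. -/
def spectrumWeight (i : L) (ν : Fin (2 * k) → L) (m : Fin (2 * k)) : L :=
  (ν m - i ^ 4 * ν m.rev) / (ν m - ν m.rev) *
    ∏ j ∈ Finset.univ.filter (fun j => j ≠ m ∧ j ≠ m.rev), (ν m - i ^ 2 * ν j) / (ν m - ν j)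

/-- `∑_m d_m ν_m z ∏_{j ≠ m} (1 - q ν_j z)`. -/
def residueSum (q i : L) (ν : Fin (2 * k) → L) : L[X] :=
  ∑ m, C (spectrumWeight i ν m * ν m) * X * ∏ j ∈ Finset.univ.erase m, (1 - C (q * ν j) * X)

lemma IsSpectrum.nu_ne_zero (h : IsSpectrum q w ν) (j : Fin (2 * k)) : ν j ≠ 0 := by
  intro h0
  have := h.pair j
  rw [h0, zero_mul] at this
  exact h.ne_zero (pow_eq_zero_iff two_ne_zero |>.1 this.symm)

lemma erase_eq_insert_rev (m : Fin (2 * k)) : Finset.univ.erase m =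
    insert m.rev (Finset.univ.filter (fun j => j ≠ m ∧ j ≠ m.rev)) := by
  ext j
  have := rev_ne k m
  simp only [Finset.mem_erase, Finset.mem_univ, and_true, Finset.mem_insert, Finset.mem_filter,
    true_and]
  constructor
  · intro h
    by_cases h' : j = m.rev
    · exact Or.inl h'
    · exact Or.inr ⟨h, h'⟩
  · rintro (rfl | h)
    · exact this
    · exact h.1

lemma prod_erase_pair {M : Type*} [CommMonoid M] (f : Fin (2 * k) → M) (m : Fin (2 * k)) :
    ∏ j ∈ Finset.univ.erase m, f j =
      f m.rev * ∏ j ∈ Finset.univ.filter (fun j => j ≠ m ∧ j ≠ m.rev), f j := by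
  rw [erase_eq_insert_rev, Finset.prod_insert (by simp)]

/-- At `y = ν_m⁻¹` the denominators of the weight are the factors of `∏_{j ≠ m} (1 - ν_j y)`, up to
powers of `ν_m` that cancel between numerator and denominator. -/
lemma IsSpectrum.weight_mul (h : IsSpectrum q w ν) {m : Fin (2 * k)} {y : L} (hy : ν m * y = 1) :
    spectrumWeight i ν m * ∏ j ∈ Finset.univ.erase m, (1 - ν j * y) =
      (1 - i ^ 4 * ν m.rev * y) *
        ∏ j ∈ Finset.univ.filter (fun j => j ≠ m ∧ j ≠ m.rev), (1 - i ^ 2 * ν j * y) := by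
  have hne : ∀ j, j ≠ m → ν m - ν j ≠ 0 := fun j hj =>
    sub_ne_zero.2 fun e => hj (h.inj e).symm
  rw [prod_erase_pair, spectrumWeight, mul_mul_mul_comm, ← Finset.prod_mul_distrib]
  congr 1
  · rw [div_mul_eq_mul_div, div_eq_iff (hne _ (rev_ne k m))]
    linear_combination (i ^ 4 * ν m.rev - ν m.rev) * hy
  · refine Finset.prod_congr rfl fun j hj => ?_
    rw [div_mul_eq_mul_div, div_eq_iff (hne j (Finset.mem_filter.1 hj).2.1)]
    linear_combination (i ^ 2 * ν j - ν j) * hy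

/-- The polynomial whose vanishing is the partial fraction expansion. -/
def residuePoly (q i μ w : L) (ν : Fin (2 * k) → L) : L[X] :=
  C (q - i) * (1 - C (w ^ 2) * X ^ 2) * residueSum q i ν -
    ((1 - C (i ^ 2 * w ^ 2) * X ^ 2) * ∏ j, (1 - C (i * ν j) * X) +
      (C ((q - i) * μ * w ^ 2) * X ^ 2 - 1 + C (w ^ 2) * X ^ 2) * ∏ j, (1 - C (q * ν j) * X))

lemma eval_residueSum (z : L) : (residueSum q i ν).eval z =
    ∑ m, spectrumWeight i ν m * ν m * z * ∏ j ∈ Finset.univ.erase m, (1 - q * ν j * z) := by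
  simp [residueSum, eval_finsetSum, eval_prod]

lemma eval_residuePoly (z : L) : (residuePoly q i μ w ν).eval z =
    (q - i) * (1 - w ^ 2 * z ^ 2) * (residueSum q i ν).eval z -
    ((1 - i ^ 2 * w ^ 2 * z ^ 2) * ∏ j, (1 - i * ν j * z) +
      ((q - i) * μ * w ^ 2 * z ^ 2 - 1 + w ^ 2 * z ^ 2) * ∏ j, (1 - q * ν j * z)) := by
  simp [residuePoly, eval_prod]

lemma eval_residuePoly_zero : (residuePoly q i μ w ν).eval 0 = 0 := by
  simp [eval_residuePoly, eval_residueSum]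

/-- At `z = 1/(q ν_m)` only the summand of index `m` survives, and the product at `q` vanishes. In
the product at `i = q⁻¹` the factor of the partner of `ν_m` is `1 - w² z²`, which matches the left
side; this pair explains the exceptional factor with `q⁻⁴` in the weight. -/
lemma IsSpectrum.eval_residuePoly_pole (h : IsSpectrum q w ν) (hqi : q * i = 1)
    (m : Fin (2 * k)) : (residuePoly q i μ w ν).eval (i * (ν m)⁻¹) = 0 := by
  have hy : ν m * (ν m)⁻¹ = 1 := mul_inv_cancel₀ (h.nu_ne_zero m)
  set y := (ν m)⁻¹
  have hw : w ^ 2 * y ^ 2 = ν m.rev * y := by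
    rw [← h.pair m]
    linear_combination (ν m.rev * y) * hy
  have hz : ∀ j, 1 - q * ν j * (i * y) = 1 - ν j * y := fun j => by
    linear_combination (-ν j * y) * hqi
  have hz' : ∀ j, 1 - i * ν j * (i * y) = 1 - i ^ 2 * ν j * y := fun j => by ring
  have hsum : (residueSum q i ν).eval (i * y) =
      i * ((1 - i ^ 4 * ν m.rev * y) *
        ∏ j ∈ Finset.univ.filter (fun j => j ≠ m ∧ j ≠ m.rev), (1 - i ^ 2 * ν j * y)) := by
    rw [eval_residueSum, Finset.sum_eq_single m]
    · simp only [hz]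
      rw [← h.weight_mul hy]
      linear_combination (spectrumWeight i ν m * i *
        ∏ j ∈ Finset.univ.erase m, (1 - ν j * y)) * hy
    · intro l _ hl
      rw [Finset.prod_eq_zero (Finset.mem_erase.2 ⟨hl.symm, Finset.mem_univ m⟩), mul_zero]
      rw [hz, hy, sub_self]
    · simp
  rw [eval_residuePoly, hsum]
  simp only [hz, hz']
  rw [Finset.prod_eq_zero (Finset.mem_univ m) (f := fun j => 1 - ν j * y) (by rw [hy, sub_self]),
    ← Finset.mul_prod_erase _ _ (Finset.mem_univ m), prod_erase_pair]
  set Φ := ∏ j ∈ Finset.univ.filter (fun j => j ≠ m ∧ j ≠ m.rev), (1 - i ^ 2 * ν j * y)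
  have e1 : w ^ 2 * (i * y) ^ 2 = i ^ 2 * (ν m.rev * y) := by rw [← hw]; ring
  have e2 : i ^ 2 * w ^ 2 * (i * y) ^ 2 = i ^ 4 * (ν m.rev * y) := by rw [← hw]; ring
  have e3 : i ^ 2 * ν m * y = i ^ 2 := by rw [mul_assoc, hy, mul_one]
  rw [e1, e2, e3]
  linear_combination ((1 - i ^ 2 * (ν m.rev * y)) * (1 - i ^ 4 * ν m.rev * y) * Φ) * hqi

/-- When `w² z² = 1` the numbers `ν_j z` are closed under inversion, which exchanges `1 - q ν_j z`
with a multiple of `1 - q⁻¹ ν_j z`. -/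
lemma IsSpectrum.prod_reflect (h : IsSpectrum q w ν) (hqi : q * i = 1) {z : L}
    (hz : w ^ 2 * z ^ 2 = 1) :
    ∏ j, (1 - q * ν j * z) = q ^ (2 * k) * ∏ j, (1 - i * ν j * z) := by
  have h1 : ∏ j, (ν j * z) = 1 := by
    rw [prod_rev (c := w ^ 2 * z ^ 2), hz, one_pow]
    intro j
    rw [← h.pair j]
    ring
  have h2 : ∀ j, 1 - q * ν j.rev * z = -q * (ν j.rev * z) * (1 - i * ν j * z) := by
    intro j
    have := h.pair j
    linear_combination -(ν j.rev * z * ν j * z) * hqi - hz - z ^ 2 * this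
  rw [← Equiv.prod_comp Fin.revPerm] at h1 ⊢
  simp only [Fin.revPerm_apply, h2] at h1 ⊢
  rw [Finset.prod_mul_distrib, Finset.prod_mul_distrib, h1, Finset.prod_const,
    Finset.card_univ, Fintype.card_fin, mul_one,
    (even_two_mul k).neg_pow]

/-- The left side of the functional equation vanishes at `z = ±1/w`. The right side does so
precisely because `1 - q⁻² + (q-q⁻¹) μ q^{2k} = 0` for the symplectic value of `μ`. -/
lemma IsSpectrum.eval_residuePoly_reflect (h : IsSpectrum q w ν) (hqi : q * i = 1)
    (hμ : μ * q ^ (2 * k + 1) = -1) {z : L} (hz : w ^ 2 * z ^ 2 = 1) :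
    (residuePoly q i μ w ν).eval z = 0 := by
  rw [eval_residuePoly, h.prod_reflect hqi hz, mul_assoc _ (w ^ 2), mul_assoc _ (w ^ 2), hz]
  rw [pow_succ] at hμ
  have e : 1 - i ^ 2 + (q - i) * μ * q ^ (2 * k) = 0 := by
    linear_combination (-1 - (q - i) * μ * q ^ (2 * k)) * hqi + (q - i) * i * hμ
  linear_combination (-∏ j, (1 - i * ν j * z)) * e

lemma natDegree_one_sub_C_mul_X_le (c : L) : (1 - C c * X).natDegree ≤ 1 := by
  compute_degree

lemma natDegree_prod_one_sub_le (s : Finset (Fin (2 * k))) (c : Fin (2 * k) → L) :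
    (∏ j ∈ s, (1 - C (c j) * X)).natDegree ≤ s.card := by
  refine (natDegree_prod_le _ _).trans ?_
  refine (Finset.sum_le_card_nsmul _ _ 1 fun j _ => natDegree_one_sub_C_mul_X_le _).trans ?_
  simp

lemma coeff_prod_one_sub (s : Finset (Fin (2 * k))) (c : Fin (2 * k) → L) :
    (∏ j ∈ s, (1 - C (c j) * X)).coeff s.card = ∏ j ∈ s, (-c j) := by
  have := coeff_prod_of_natDegree_le (s := s) (fun j => 1 - C (c j) * X) 1
    fun j _ => natDegree_one_sub_C_mul_X_le _
  rw [mul_one] at this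
  rw [this]
  refine Finset.prod_congr rfl fun j _ => ?_
  simp [coeff_one]

lemma natDegree_residueSum_le : (residueSum q i ν).natDegree ≤ 2 * k := by
  refine natDegree_sum_le_of_forall_le _ _ fun m _ => ?_
  have h := natDegree_prod_one_sub_le (Finset.univ.erase m) fun j => q * ν j
  rw [Finset.card_erase_of_mem (Finset.mem_univ m), Finset.card_univ, Fintype.card_fin] at h
  have := m.2
  refine natDegree_mul_le.trans ((add_le_add ((natDegree_C_mul_le _ _).trans natDegree_X_le) h).trans ?_)
  omega

lemma coeff_residueSum : -q * (residueSum q i ν).coeff (2 * k) =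
    (∏ j, (-(q * ν j))) * ∑ m, spectrumWeight i ν m := by
  rw [residueSum, finsetSum_coeff, Finset.mul_sum, Finset.mul_sum]
  refine Finset.sum_congr rfl fun m _ => ?_
  have hc : (Finset.univ.erase m).card = 2 * k - 1 := by
    rw [Finset.card_erase_of_mem (Finset.mem_univ m), Finset.card_univ, Fintype.card_fin]
  have h := coeff_prod_one_sub (Finset.univ.erase m) fun j => q * ν j
  have := m.2
  rw [hc] at h
  have hX : ∀ f : L[X], (X * f).coeff (2 * k) = f.coeff (2 * k - 1) := fun f => by
    obtain ⟨l, hl⟩ : ∃ l, 2 * k = l + 1 := ⟨2 * k - 1, by omega⟩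
    rw [hl, coeff_X_mul, Nat.add_sub_cancel]
  rw [mul_assoc, coeff_C_mul, hX, h, ← Finset.mul_prod_erase _ _ (Finset.mem_univ m)]
  ring

lemma natDegree_residuePoly_le : (residuePoly q i μ w ν).natDegree ≤ 2 * k + 2 := by
  have hE : ∀ c : L, (∏ j, (1 - C (c * ν j) * X)).natDegree ≤ 2 * k := fun c => by
    simpa using natDegree_prod_one_sub_le Finset.univ fun j => c * ν j
  have h1 : (C (q - i) * (1 - C (w ^ 2) * X ^ 2)).natDegree ≤ 2 := by compute_degree
  have h2 : (1 - C (i ^ 2 * w ^ 2) * X ^ 2).natDegree ≤ 2 := by compute_degree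
  have h3 : (C ((q - i) * μ * w ^ 2) * X ^ 2 - 1 + C (w ^ 2) * X ^ 2).natDegree ≤ 2 := by
    compute_degree
  rw [add_comm (2 * k)]
  rw [← max_self (2 + 2 * k)]
  exact natDegree_sub_le_of_le (natDegree_mul_le_of_le h1 natDegree_residueSum_le)
    (natDegree_add_le_of_degree_le (natDegree_mul_le_of_le h2 (hE i))
      (natDegree_mul_le_of_le h3 (hE q)))

theorem IsSpectrum.residuePoly_eq_zero [CharZero L] (h : IsSpectrum q w ν) (hqi : q * i = 1)
    (hμ : μ * q ^ (2 * k + 1) = -1) : residuePoly q i μ w ν = 0 := by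
  classical
  have hi : i ≠ 0 := right_ne_zero_of_mul_eq_one hqi
  have hinj : Function.Injective fun m => i * (ν m)⁻¹ := fun m m' e =>
    h.inj (inv_injective (mul_left_cancel₀ hi e))
  have hw : ∀ m, (i * (ν m)⁻¹) ^ 2 ≠ (w⁻¹) ^ 2 := by
    intro m e
    apply h.generic m
    have := h.ne_zero
    have := h.nu_ne_zero m
    field_simp at e
    linear_combination (-q ^ 2) * e + (q * i + 1) * w ^ 2 * hqi
  -- The `2k+3` zeros are `0`, `±1/w` and the `1/(q ν_m)`; the genericity condition of a spectrum
  -- keeps the last ones away from `±1/w`.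
  let s : Finset L := insert 0 (insert w⁻¹ (insert (-w⁻¹)
    (Finset.univ.image fun m => i * (ν m)⁻¹)))
  have hw0 : w⁻¹ ≠ 0 := inv_ne_zero h.ne_zero
  have hcard : s.card = 2 * k + 3 := by
    rw [Finset.card_insert_of_notMem, Finset.card_insert_of_notMem, Finset.card_insert_of_notMem,
      Finset.card_image_of_injective _ hinj, Finset.card_univ, Fintype.card_fin]
    · simp only [Finset.mem_image, Finset.mem_univ, true_and, not_exists]
      intro m e
      apply hw m
      rw [e, neg_sq]
    · simp only [Finset.mem_insert, Finset.mem_image, Finset.mem_univ, true_and, not_or,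
        not_exists]
      refine ⟨fun e => hw0 (self_eq_neg.1 e), fun m e => hw m (by rw [e])⟩
    · simp only [Finset.mem_insert, Finset.mem_image, Finset.mem_univ, true_and, not_or,
        not_exists]
      refine ⟨hw0.symm, (neg_ne_zero.2 hw0).symm, fun m => ?_⟩
      exact mul_ne_zero hi (inv_ne_zero (h.nu_ne_zero m))
  refine eq_zero_of_natDegree_lt_card_of_eval_eq_zero' _ s ?_ ?_
  · have hz : w ^ 2 * (w⁻¹) ^ 2 = 1 := by rw [← mul_pow, mul_inv_cancel₀ h.ne_zero, one_pow]
    intro z hz'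
    simp only [s, Finset.mem_insert, Finset.mem_image, Finset.mem_univ, true_and] at hz'
    rcases hz' with rfl | rfl | rfl | ⟨m, rfl⟩
    · exact eval_residuePoly_zero
    · exact h.eval_residuePoly_reflect hqi hμ hz
    · exact h.eval_residuePoly_reflect hqi hμ (by rw [neg_sq, hz])
    · exact h.eval_residuePoly_pole hqi m
  · have := natDegree_residuePoly_le (q := q) (i := i) (μ := μ) (w := w) (ν := ν)
    omega

/-- The coefficient of degree `2k+2` in the partial fraction identity. It covers exponent `0`, which
the power series identity does not see. -/
lemma IsSpectrum.sum_weight [CharZero L] (h : IsSpectrum q w ν) (hqi : q * i = 1)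
    (hμ : μ * q ^ (2 * k + 1) = -1) :
    (q - i) * (i * ∑ m, spectrumWeight i ν m) = (q - μ) * (i + μ) := by
  have hE : ∀ c : L, (∏ j, (1 - C (c * ν j) * X)).natDegree ≤ 2 * k := fun c => by
    simpa using natDegree_prod_one_sub_le Finset.univ fun j => c * ν j
  have hP : ∀ c : L, ∏ j, (-(c * ν j)) = (c ^ 2 * w ^ 2) ^ k := fun c => by
    refine prod_rev _ fun j => ?_
    rw [← h.pair j]
    ring
  have hc : ∀ c : L, (∏ j, (1 - C (c * ν j) * X)).coeff (2 * k) = (c ^ 2 * w ^ 2) ^ k := by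
    intro c
    rw [← hP]
    simpa using coeff_prod_one_sub Finset.univ fun j => c * ν j
  have h1 : (C (q - i) * (1 - C (w ^ 2) * X ^ 2)).natDegree ≤ 2 := by compute_degree
  have h2 : (1 - C (i ^ 2 * w ^ 2) * X ^ 2).natDegree ≤ 2 := by compute_degree
  have h3 : (C ((q - i) * μ * w ^ 2) * X ^ 2 - 1 + C (w ^ 2) * X ^ 2).natDegree ≤ 2 := by
    compute_degree
  have e := congrArg (fun f => f.coeff (2 + 2 * k)) (h.residuePoly_eq_zero hqi hμ)
  simp only [residuePoly, coeff_sub, coeff_add, coeff_zero] at e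
  rw [coeff_mul_add_eq_of_natDegree_le h1 natDegree_residueSum_le,
    coeff_mul_add_eq_of_natDegree_le h2 (hE i), coeff_mul_add_eq_of_natDegree_le h3 (hE q),
    hc, hc] at e
  have hs := coeff_residueSum (q := q) (i := i) (ν := ν)
  rw [hP] at hs
  simp only [coeff_C_mul, coeff_sub, coeff_add, coeff_one, coeff_X_pow, if_true] at e
  norm_num at e
  set r := (residueSum q i ν).coeff (2 * k)
  set D := ∑ m, spectrumWeight i ν m
  have hqk : q ^ (2 * k) * i ^ (2 * k) = 1 := by rw [← mul_pow, hqi, one_pow]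
  have hik : i ^ (2 * k) * i = -μ := by
    rw [pow_succ] at hμ
    linear_combination (i ^ (2 * k) * i) * hμ - μ * q ^ (2 * k) * i ^ (2 * k) * hqi - μ * hqk
  have hw := pow_ne_zero k (pow_ne_zero 2 h.ne_zero)
  have hw' := pow_ne_zero 2 h.ne_zero
  have hq0 : q ^ (2 * k) ≠ 0 := pow_ne_zero _ (left_ne_zero_of_mul_eq_one hqi)
  apply mul_left_cancel₀ (mul_ne_zero hq0 (mul_ne_zero hw hw'))
  simp only [mul_pow, ← pow_mul] at e hs hw ⊢
  generalize q ^ (2 * k) = x at *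
  generalize i ^ (2 * k) = y at *
  generalize w ^ (2 * k) = W at *
  grind

lemma mk_pow_mul_one_sub (c : L) : (PowerSeries.mk fun n => c ^ n) *
    (1 - PowerSeries.C c * PowerSeries.X) = 1 := by
  ext n
  rw [mul_sub, mul_one, ← mul_assoc, mul_right_comm, mul_comm _ (PowerSeries.X), map_sub]
  cases n with
  | zero => simp
  | succ n =>
    rw [mul_assoc, PowerSeries.coeff_succ_X_mul, mul_comm, PowerSeries.coeff_C_mul]
    simp [PowerSeries.coeff_one, pow_succ']

theorem IsSpectrum.spectralSeries [CharZero L] (h : IsSpectrum q w ν) (hqi : q * i = 1)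
    (hμ : μ * q ^ (2 * k + 1) = -1) :
    SpectralSeries q i μ (w ^ 2) ν
      (PowerSeries.X * PowerSeries.mk fun n => q ^ n * ∑ m, spectrumWeight i ν m * ν m ^ (n + 1)) := by
  have e := congrArg Polynomial.coeToPowerSeries.ringHom (h.residuePoly_eq_zero hqi hμ)
  simp only [residuePoly, residueSum, map_sub, map_add, map_mul (coeToPowerSeries.ringHom),
    map_prod, map_sum, map_pow (coeToPowerSeries.ringHom), map_one, map_zero,
    coeToPowerSeries.ringHom_apply, Polynomial.coe_C, Polynomial.coe_X] at e
  rw [sub_eq_zero] at e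
  rw [SpectralSeries]
  have hs : (PowerSeries.X * PowerSeries.mk fun n => q ^ n *
      ∑ m, spectrumWeight i ν m * ν m ^ (n + 1)) *
      ∏ j, (1 - PowerSeries.C (q * ν j) * PowerSeries.X) =
      ∑ m, PowerSeries.C (spectrumWeight i ν m * ν m) * PowerSeries.X *
        ∏ j ∈ Finset.univ.erase m, (1 - PowerSeries.C (q * ν j) * PowerSeries.X) := by
    have hm : (PowerSeries.mk fun n => q ^ n * ∑ m, spectrumWeight i ν m * ν m ^ (n + 1)) =
        ∑ m, PowerSeries.C (spectrumWeight i ν m * ν m) * PowerSeries.mk fun n => (q * ν m) ^ n := by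
      ext n
      rw [map_sum, PowerSeries.coeff_mk, Finset.mul_sum]
      refine Finset.sum_congr rfl fun m _ => ?_
      rw [PowerSeries.coeff_C_mul, PowerSeries.coeff_mk]
      ring
    rw [hm, Finset.mul_sum, Finset.sum_mul]
    refine Finset.sum_congr rfl fun m _ => ?_
    rw [← Finset.mul_prod_erase _ _ (Finset.mem_univ m)]
    linear_combination (PowerSeries.C (spectrumWeight i ν m * ν m) * PowerSeries.X *
      ∏ j ∈ Finset.univ.erase m, (1 - PowerSeries.C (q * ν j) * PowerSeries.X)) *
      mk_pow_mul_one_sub (q * ν m)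
  rw [mul_assoc _ (PowerSeries.X * _), hs]
  simp only [map_sub, map_mul, map_pow] at e ⊢
  exact e

end Residues

/-! ### The spectral variables as a spectrum, and polynomiality. -/

section Spectral

variable {k : ℕ} {q μ : ℂ}

lemma nu_mul_nu_rev (j : Fin (2 * k)) : nu k j * nu k j.rev = nuZero k ^ 2 := by
  rw [nu, nu, nuZero, ← map_mul, ← map_pow, Ideal.Quotient.eq]
  exact Ideal.subset_span ⟨j, rfl⟩

lemma nuZero_ne_zero : nuZero k ≠ 0 := by
  intro h
  have h' := Ideal.Quotient.eq_zero_iff_mem.1 h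
  rw [← ker_toricHom, RingHom.mem_ker] at h'
  change toricHom k (MvPolynomial.monomial _ 1) = 0 at h'
  rw [toricHom_monomial] at h'
  exact AddMonoidAlgebra.single_ne_zero.2 one_ne_zero h'

/-- The two variables map to monomials with different toric exponents. With `c = q²` this is the
genericity `(q ν_j)² ≠ ν_0²`, since `ν_0² = ν_j ν_{2k+1-j}`. -/
lemma algebraMap_mul_nu_ne_nu_rev {c : ℂ} (hc : c ≠ 0) (j : Fin (2 * k)) :
    algebraMap ℂ _ c * nu k j ≠ nu k j.rev := by
  intro h
  have h1 : (Ideal.Quotient.mk (spectralIdeal k)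
      (MvPolynomial.monomial (Finsupp.single (some j) 1) c)) = Ideal.Quotient.mk (spectralIdeal k)
      (MvPolynomial.monomial (Finsupp.single (some j.rev) 1) 1) := by
    rw [← MvPolynomial.C_mul_X_eq_monomial]
    exact h
  have h' := Ideal.Quotient.eq.1 h1
  rw [← ker_toricHom, RingHom.mem_ker, map_sub, sub_eq_zero, toricHom_monomial,
    toricHom_monomial] at h'
  have h2 := congrArg AddMonoidAlgebra.coeff h'
  simp only [AddMonoidAlgebra.coeff_single, Finsupp.single_eq_single_iff] at h2
  rcases h2 with h2 | h2
  · have h3 := congrFun h2.1 (some j)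
    have := rev_ne k j
    simp [toricExp_some, this, this.symm] at h3
  · exact hc h2.1

instance : CharZero (SpectralField k) := algebraRat.charZero _

/-- `ν_0` in the field of fractions. -/
def nuZeroF (k : ℕ) : SpectralField k := algebraMap (Spectral k) _ (nuZero k)

lemma isSpectrum_nuF (hq : q ≠ 0) :
    IsSpectrum (algebraMap ℂ (SpectralField k) q) (nuZeroF k) (nuF k) where
  ne_zero := (map_ne_zero_iff _ (IsFractionRing.injective _ _)).2 nuZero_ne_zero
  pair j := by rw [nuF, nuF, nuZeroF, ← map_mul, nu_mul_nu_rev, map_pow]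
  inj := (IsFractionRing.injective _ _).comp (nu_injective k)
  generic j h := by
    have h0 : nu k j ≠ 0 := fun h0 => by
      have := nu_mul_nu_rev j
      rw [h0, zero_mul] at this
      exact nuZero_ne_zero (pow_eq_zero_iff two_ne_zero |>.1 this.symm)
    apply algebraMap_mul_nu_ne_nu_rev (pow_ne_zero 2 hq) j
    apply mul_left_cancel₀ h0
    apply IsFractionRing.injective (Spectral k) (SpectralField k)
    rw [nu_mul_nu_rev, map_mul, map_mul,
      ← IsScalarTower.algebraMap_apply ℂ (Spectral k), map_pow, map_pow]
    rw [nuF, nuZeroF] at h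
    linear_combination h

lemma weight_eq (q : ℂ) (j : Fin (2 * k)) :
    weight q k j = spectrumWeight (algebraMap ℂ (SpectralField k) q⁻¹) (nuF k) j := by
  have h4 : q ^ (-4 : ℤ) = (q⁻¹) ^ 4 := by rw [zpow_neg, inv_pow]; rfl
  have h2 : q ^ (-2 : ℤ) = (q⁻¹) ^ 2 := by rw [zpow_neg, inv_pow]; rfl
  simp only [weight, spectrumWeight, h4, h2, Algebra.smul_def, map_pow]

lemma spectralPower_succ (q : ℂ) (n : ℕ) : spectralPower q k (n + 1) =
    algebraMap ℂ (SpectralField k) q ^ n * ∑ m, spectrumWeight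
      (algebraMap ℂ (SpectralField k) q⁻¹) (nuF k) m * nuF k m ^ (n + 1) := by
  simp only [spectralPower, weight_eq]
  rw [show ((n + 1 : ℕ) : ℤ) - 1 = n by push_cast; ring, zpow_natCast, Algebra.smul_def, map_pow]

lemma algebraMap_mul_pow_eq_neg_one {A : Type*} [Ring A] [Algebra ℂ A]
    (hμ : μ * q ^ (2 * k + 1) = -1) : algebraMap ℂ A μ * algebraMap ℂ A q ^ (2 * k + 1) = -1 := by
  rw [← map_pow, ← map_mul, hμ, map_neg, map_one]

lemma spectralPower_zero (hp : BMWParam q μ) (hμ : μ * q ^ (2 * k + 1) = -1) :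
    spectralPower q k 0 = algebraMap ℂ (SpectralField k) (μ * loopValue q μ) := by
  have hqi : algebraMap ℂ (SpectralField k) q * algebraMap ℂ (SpectralField k) q⁻¹ = 1 := by
    rw [← map_mul, mul_inv_cancel₀ hp.q_ne, map_one]
  have h := (isSpectrum_nuF hp.q_ne).sum_weight hqi (algebraMap_mul_pow_eq_neg_one hμ)
  simp only [spectralPower, weight_eq, pow_zero, mul_one]
  have hl : algebraMap ℂ (SpectralField k) (q - q⁻¹) ≠ 0 :=
    (map_ne_zero_iff _ (algebraMap ℂ (SpectralField k)).injective).2 hp.lam_ne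
  apply mul_left_cancel₀ hl
  rw [← map_mul, show (q - q⁻¹) * (μ * loopValue q μ) = (q - μ) * (q⁻¹ + μ) by
    rw [loopValue, ← mul_assoc, mul_comm (q - q⁻¹),
      mul_div_cancel₀ _ (mul_ne_zero hp.mu_ne hp.lam_ne)],
    show ((0 : ℕ) : ℤ) - 1 = -1 by norm_num, zpow_neg_one, Algebra.smul_def]
  simpa only [map_sub, map_mul, map_add] using h

open PowerSeries in
/-- The power sums are determined by the functional equation of their generating series. -/
theorem algebraMap_coeff_eq_spectralPower (hp : BMWParam q μ) (hμ : μ * q ^ (2 * k + 1) = -1)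
    {P : (Spectral k)⟦X⟧} (h : SpectralSeries (algebraMap ℂ (Spectral k) q)
      (algebraMap ℂ (Spectral k) q⁻¹) (algebraMap ℂ (Spectral k) μ) (nuZero k ^ 2) (nu k) P)
    (n : ℕ) : algebraMap (Spectral k) (SpectralField k) (coeff (n + 1) P) =
      spectralPower q k (n + 1) := by
  have hqi : algebraMap ℂ (SpectralField k) q * algebraMap ℂ (SpectralField k) q⁻¹ = 1 := by
    rw [← map_mul, mul_inv_cancel₀ hp.q_ne, map_one]
  have h1 := h.map (algebraMap (Spectral k) (SpectralField k))
  simp only [← IsScalarTower.algebraMap_apply ℂ (Spectral k), map_pow] at h1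
  have h2 := (isSpectrum_nuF (k := k) hp.q_ne).spectralSeries hqi
    (algebraMap_mul_pow_eq_neg_one hμ)
  have hl : IsUnit (algebraMap ℂ (SpectralField k) q - algebraMap ℂ (SpectralField k) q⁻¹) := by
    rw [← map_sub]
    exact (isUnit_iff_ne_zero.2 hp.lam_ne).map _
  have h3 := congrArg (coeff (n + 1)) (SpectralSeries.unique hl h1 h2)
  rw [coeff_map, coeff_succ_X_mul, coeff_mk] at h3
  rw [h3, spectralPower_succ]

/-- The functional equation can be solved over `E_{2k}` itself, its leading coefficient being a unit
there, and by uniqueness that solution maps to the partial fraction solution. For `n = 0` the sum is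
a constant. -/
theorem exists_algebraMap_eq_spectralPower (hp : BMWParam q μ) (hμ : μ * q ^ (2 * k + 1) = -1)
    (n : ℕ) : ∃ f : Spectral k, algebraMap _ (SpectralField k) f = spectralPower q k n := by
  cases n with
  | zero =>
    refine ⟨algebraMap ℂ _ (μ * loopValue q μ), ?_⟩
    rw [spectralPower_zero hp hμ, ← IsScalarTower.algebraMap_apply]
  | succ n =>
    have hl : IsUnit (algebraMap ℂ (Spectral k) q - algebraMap ℂ (Spectral k) q⁻¹) := by
      rw [← map_sub]
      exact (isUnit_iff_ne_zero.2 hp.lam_ne).map _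
    obtain ⟨P, hP⟩ := SpectralSeries.exists (μ := algebraMap ℂ (Spectral k) μ)
      (g := nuZero k ^ 2) (nu k) hl
    exact ⟨_, algebraMap_coeff_eq_spectralPower hp hμ hP n⟩

end Spectral

/-! ### The image of the characteristic subalgebra. -/

section Homomorphism

open PowerSeries

variable {N k : ℕ} {q : ℂ} {R F Ψ : TwoSite N}

lemma spMu_mul_pow (hq : q ≠ 0) : spMu q k * q ^ (2 * k + 1) = -1 := by
  rw [spMu, ← zpow_natCast, neg_mul, ← zpow_add₀ hq,
    show -1 - 2 * (k : ℤ) + ((2 * k + 1 : ℕ) : ℤ) = 0 by push_cast; ring, zpow_zero]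

lemma add_mul_inv_pow_ne_zero {μ : ℂ} (hq : q ≠ 0) {i : ℕ} {z : ℤ} (hz : z = 1 - 2 * ((i : ℤ) + 1))
    (h : μ ≠ -q ^ z) : μ + q * (q⁻¹) ^ (2 * (i + 1)) ≠ 0 := by
  intro e
  apply h
  have : q * (q⁻¹) ^ (2 * (i + 1)) = q ^ z := by
    rw [hz, sub_eq_add_neg, zpow_add₀ hq, zpow_one, inv_pow, zpow_neg, ← zpow_natCast]
    push_cast
    rfl
  rw [← this]
  exact eq_neg_of_add_eq_zero_left e

lemma HasHeight.add_ne_zero {μ : ℂ} (hq : q ≠ 0) (h : HasHeight q μ R k) :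
    ∀ i < k, μ + q * (q⁻¹) ^ (2 * (i + 1)) ≠ 0 := fun i hi =>
  add_mul_inv_pow_ne_zero hq (by push_cast; ring) (h.2.2.1 (i + 1) (by omega) (by omega))

lemma HasHeight.asymDef {μ : ℂ} (hq : q ≠ 0) (h : HasHeight q μ R k) : AsymDef q μ k :=
  fun i hi => ⟨h.2.1 _ (by omega) hi, h.add_ne_zero hq i (by omega)⟩

theorem spectralSeries_powerSum (hR : IsSpType q k R) (hΨ : IsSkewInverse R Ψ)
    (hRF : IsCompatiblePair R F) (π : charSubalgebra R F Ψ →ₐ[ℂ] Spectral k)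
    (hg : π (contraction q (spMu q k) R F Ψ) = nuZero k ^ 2)
    (ha : ∀ i, 1 ≤ i → i ≤ k → π (elemSym q (spMu q k) R F Ψ i) = spectralElem k i) :
    SpectralSeries (algebraMap ℂ (Spectral k) q) (algebraMap ℂ (Spectral k) q⁻¹)
      (algebraMap ℂ (Spectral k) (spMu q k)) (nuZero k ^ 2) (nu k)
      (X * mk fun n => π (powerSum R F Ψ (n + 1))) := by
  obtain ⟨-, h, hk⟩ := hR
  have hp := h.param
  have hd := hk.asymDef hp.q_ne
  have hs := ((braidTower h hRF hΨ).hookSystem hp hd)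
  have hv := BMWTower.hook_vanish (braidTower h hRF hΨ) hp (by have := hk.1; omega) hd
    (braidTower_height h hRF hΨ hk)
  have hs' := hs.map π
  rw [braidTower_g, hg] at hs'
  have := spectralSeries_of_hookSystem hp (hk.add_ne_zero hp.q_ne) (spMu_mul_pow hp.q_ne) hs'
    (fun i => by
      have := congrArg π (hv i)
      simpa only [map_sub, map_smul, map_mul, map_zero] using this)
    nuZero_ne_zero nu_mul_nu_rev (fun m hm => by
      rcases Nat.eq_zero_or_pos m with rfl | h1
      · rw [hs.a_zero, map_one]
        simp [pairElem, Multiset.esymm]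
      · rw [braidTower_a, ha m h1 hm]
        rfl)
  simpa only [braidTower_p] using this

/-- Translates the coefficient identity `newton_complete`, which carries an overall factor `q -
q⁻¹`, into the normalisation with `q`-numbers and integer powers of `q`. -/
theorem newton_spectralCompl (hp : BMWParam q (spMu q k)) {p : ℕ → Spectral k}
    (h : SpectralSeries (algebraMap ℂ (Spectral k) q) (algebraMap ℂ (Spectral k) q⁻¹)
      (algebraMap ℂ (Spectral k) (spMu q k)) (nuZero k ^ 2) (nu k)
      (X * mk fun n => p (n + 1))) (n : ℕ) :
    Newton (-q⁻¹) (spMu q k) p (nuZero k ^ 2) n (spectralCompl k) := by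
  rw [newton_dual_iff]
  have hq := hp.q_ne
  have hqi : algebraMap ℂ (Spectral k) q * algebraMap ℂ (Spectral k) q⁻¹ = 1 := by
    rw [← map_mul, mul_inv_cancel₀ hq, map_one]
  have hl : IsUnit (algebraMap ℂ (Spectral k) (q - q⁻¹)) :=
    (isUnit_iff_ne_zero.2 hp.lam_ne).map _
  refine ⟨by simp [spectralCompl], fun m _ _ => ?_⟩
  have key := newton_complete (c := spectralCompl k) hqi h (by simp) (hsymm_series (nu k)) m
  apply hl.mul_left_cancel
  rw [map_sub]
  refine Eq.trans ?_ (key.trans ?_)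
  · congr 1
    refine Finset.sum_congr rfl fun l hl => ?_
    have := Finset.mem_range.1 hl
    rw [show m - l = m - l - 1 + 1 by omega, coeff_succ_X_mul, coeff_mk, Algebra.smul_def, map_pow]
  · rw [mul_add]
    congr 1
    · rw [← map_pow, ← map_pow, ← map_sub, ← map_sub, ← Algebra.smul_def, ← Algebra.smul_def,
        smul_smul, qnum, mul_div_cancel₀ _ hp.lam_ne]
    · congr 1
      refine Finset.sum_congr rfl fun l hl => ?_
      obtain ⟨h1, h2⟩ := Finset.mem_Icc.1 hl
      obtain ⟨j, hj⟩ : ∃ j, m = j + 2 * l := ⟨m - 2 * l, by omega⟩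
      subst hj
      rw [Nat.add_sub_cancel, Algebra.smul_def]
      congr 1
      rw [show 2 * (l : ℤ) - ((j + 2 * l : ℕ) : ℤ) = -(j : ℤ) by push_cast; ring,
        show ((j + 2 * l : ℕ) : ℤ) - 2 * l - 1 = (j : ℤ) + -1 by push_cast; ring, zpow_add₀ hq,
        zpow_neg, zpow_neg_one, zpow_natCast, ← inv_pow]
      simp only [map_add, map_mul, map_pow]
      ring

lemma Newton.map {C C' : Type*} [Ring C] [Algebra ℂ C] [Ring C'] [Algebra ℂ C'] (φ : C →ₐ[ℂ] C')
    {q μ : ℂ} {p : ℕ → C} {g : C} {n : ℕ} {a : ℕ → C} (h : Newton q μ p g n a) :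
    Newton q μ (fun i => φ (p i)) (φ g) n (fun i => φ (a i)) := by
  refine ⟨(congrArg φ h.1).trans (map_one φ), fun m h1 h2 => ?_⟩
  have := congrArg φ (h.2 m h1 h2)
  simpa only [newtonRest, map_sub, map_smul, map_sum, map_mul, map_pow] using this

end Homomorphism

end QuantumMatrix

end

open QuantumMatrix

theorem mainTheorem4 (N k : ℕ) (q : ℂ) (R F Ψ : TwoSite N)
    (hR : IsSpType q k R) (hΨ : IsSkewInverse R Ψ)
    (hRF : IsCompatiblePair R F) (hF : IsStrictSkewInvertible F)
    (n : ℕ) (hn : ∀ i, 2 ≤ i → i ≤ n → qnum q i ≠ 0) :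
    -- the Newton relations define `a_m` recursively for `m ≤ n`, and agree with `ch(a^{(m)})`
    -- whenever the antisymmetrizer `a^{(m)}` is defined
    ((∃ a, NewtonElem q (spMu q k) R F Ψ n a) ∧
      (∀ a b, NewtonElem q (spMu q k) R F Ψ n a → NewtonElem q (spMu q k) R F Ψ n b →
        ∀ m ≤ n, a m = b m) ∧
      (∀ a, NewtonElem q (spMu q k) R F Ψ n a → ∀ m ≤ n,
        (∀ j : ℕ, 2 ≤ j → j ≤ m → spMu q k ≠ -q ^ (3 - 2 * (j : ℤ))) →
          a m = elemSym q (spMu q k) R F Ψ m)) ∧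
    -- the same for `s_m`
    ((∃ s, NewtonCompl q (spMu q k) R F Ψ n s) ∧
      (∀ s t, NewtonCompl q (spMu q k) R F Ψ n s → NewtonCompl q (spMu q k) R F Ψ n t →
        ∀ m ≤ n, s m = t m) ∧
      (∀ s, NewtonCompl q (spMu q k) R F Ψ n s → ∀ m ≤ n,
        (∀ j : ℕ, 2 ≤ j → j ≤ m → spMu q k ≠ q ^ (2 * (j : ℤ) - 3)) →
          s m = complSym q (spMu q k) R F Ψ m)) ∧
    -- the images of `s_n` and `p_n` under the spectral homomorphism
    (∀ π : charSubalgebra R F Ψ →ₐ[ℂ] Spectral k,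
      π (contraction q (spMu q k) R F Ψ) = nuZero k ^ 2 →
      (∀ i, 1 ≤ i → i ≤ k → π (elemSym q (spMu q k) R F Ψ i) = spectralElem k i) →
      (∀ s, NewtonCompl q (spMu q k) R F Ψ n s → π (s n) = spectralCompl k n) ∧
      algebraMap (Spectral k) (SpectralField k) (π (powerSum R F Ψ n)) = spectralPower q k n) ∧
    -- the rational function `q^{n-1} ∑ d_i ν_i^n` is a polynomial in the spectral variables
    ∃ f : Spectral k, algebraMap (Spectral k) (SpectralField k) f = spectralPower q k n := by
  have h := hR.2.1
  have hp := h.param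
  have hq := hp.q_ne
  have hn' := qnum_dual_ne_zero hn
  simp only [newtonElem_iff, newtonCompl_iff]
  refine ⟨⟨Newton.exists hp.lam_ne hn, fun a b ha hb => ha.unique hp.lam_ne hn hb, ?_⟩,
    ⟨Newton.exists hp.dual.lam_ne hn', fun s t hs ht => hs.unique hp.dual.lam_ne hn' ht, ?_⟩, ?_,
    exists_algebraMap_eq_spectralPower hp (spMu_mul_pow hq) n⟩
  · intro a ha m hm hj
    have hd : AsymDef q (spMu q k) m := fun i hi => ⟨hn _ (by omega) (by omega),
      add_mul_inv_pow_ne_zero hq (by push_cast; ring) (hj (i + 2) (by omega) hi)⟩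
    exact (ha.mono hm).unique hp.lam_ne (fun i h1 h2 => hn i h1 (h2.trans hm))
      (newton_elemSym h hRF hΨ hd) m le_rfl
  · intro s hs m hm hj
    have hd : AsymDef (-q⁻¹) (spMu q k) m := fun i hi => by
      refine ⟨hn' _ (by omega) (by omega), ?_⟩
      refine add_mul_inv_pow_ne_zero (neg_ne_zero.2 (inv_ne_zero hq)) rfl ?_
      -- The exponent is odd, so the two signs cancel: the forbidden values of `μ` for symmetrizers
      -- are those for antisymmetrizers at `-q⁻¹`.
      have e : -(-q⁻¹) ^ (1 - 2 * ((i : ℤ) + 1)) = q ^ (2 * ((i + 2 : ℕ) : ℤ) - 3) := by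
        have ho : Odd (1 - 2 * ((i : ℤ) + 1)) := ⟨-i - 1, by ring⟩
        rw [ho.neg_zpow, neg_neg, inv_zpow', show -(1 - 2 * ((i : ℤ) + 1)) =
          2 * ((i + 2 : ℕ) : ℤ) - 3 by push_cast; ring]
      rw [e]
      exact hj (i + 2) (by omega) hi
    exact (hs.mono hm).unique hp.dual.lam_ne (fun i h1 h2 => hn' i h1 (h2.trans hm))
      (newton_complSym h hRF hΨ hd) m le_rfl
  · intro π hg ha
    have hP := spectralSeries_powerSum hR hΨ hRF π hg ha
    constructor
    · intro s hs
      -- The elements `π(s_m)` and `h_m` satisfy the same Newton relations, with the same `π(p_m)`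
      -- and `ν_0²`, so they agree by uniqueness.
      have hs' := hs.map π
      rw [hg] at hs'
      exact hs'.unique hp.dual.lam_ne hn'
        (newton_spectralCompl (p := fun i => π (powerSum R F Ψ i)) hp hP n) n le_rfl
    · cases n with
      -- The functional equation determines only `p_n` with `n ≥ 1`; `p_0` is the scalar `Tr D`.
      | zero =>
        rw [powerSum_zero h hΨ, AlgHom.commutes, spectralPower_zero hp (spMu_mul_pow hq),
          ← IsScalarTower.algebraMap_apply]
      | succ n =>
        rw [← algebraMap_coeff_eq_spectralPower hp (spMu_mul_pow hq) hP n,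
          PowerSeries.coeff_succ_X_mul, PowerSeries.coeff_mk]
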